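/- **Setting.** Let $N\ge 1$, $t_c>0$, $\tau>0$, and let $\mathcal H=\ell^2(\mathbb N)\oplus\ell^2(\mathbb N)\oplus\mathbb C^N$ (two leads and a sample; $\zeta_1,\dots,\zeta_N$ is the standard basis of $\mathbb C^N$, also viewed in $\mathcal H$). On lead $j\in\{1,2\}$ let $h_j$ be the Dirichlet Laplacian, $(h_j\psi)(n)=t_c(\psi(n+1)+\psi(n-1))$ for $n\ge1$ and $(h_j\psi)(0)=t_c\psi(1)$. Let $h_s$ be a self-adjoint operator on $\mathbb C^N$, let $L_j$ be a finitely supported vector in lead $j$ and $S_j\in\mathbb C^N$, and put $$H_L=h_1+h_2,\qquad H=h_1+h_2+h_s+\tau\sum_{j=1}^2\big(|S_j\rangle\langle L_j|+|L_j\rangle\langle S_j|\big).$$ For real $\nu_{jk}$ ($1\le j,k\le N$), $\lambda\ge 0$ and a bounded operator $\gamma$ on $\mathcal H$ (or on $\mathbb C^N$) let $$V_\lambda\{\gamma\}=\lambda\sum_{j=1}^N\Big(\sum_{k=1}^N\nu_{jk}\langle\zeta_k,\gamma\zeta_k\rangle\Big)|\zeta_j\rangle\langle\zeta_j|.$$ Let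 $0<\beta_j\le\infty$, $\mu_j\in\mathbb R$, and $f_{\beta,\mu}(x)=1/(\mathrm e^{\beta(x-\mu)}+1)$, read as the indicator function of $(-\infty,\mu]$ if $\beta=\infty$. The initial state is $$\rho_i=f_{\beta_1,\mu_1}(h_1)\oplus f_{\beta_2,\mu_2}(h_2)\oplus\rho_s,$$ where $\rho_s\ge0$ is any self-consistent equilibrium state of the sample: for some $\beta_s\in(0,\infty)$, $\mathcal N\in(0,N)$ and $\mu_s\in\mathbb R$, $\rho_s=f_{\beta_s,\mu_s}(h_s+V_\lambda\{\rho_s\})$ and $\operatorname{Tr}\rho_s=\mathcal N$. Let $\rho_\lambda(t)$ be the solution on $[0,\infty)$, continuously differentiable in operator norm, of $$\mathrm i\,\rho'(t)=[H+V_\lambda\{\rho(t)\},\rho(t)],\qquad \rho(0)=\rho_i .$$ It exists, is unique, and equals $U(t)\rho_iU(t)^*$, where $U(t)$ is the unique solution of $\mathrm i\,U'(t)=HU(t)+V_\lambda\{U(t)\rho_iU(t)^*\}U(t)$, $U(0)=1$, and each $U(t)$ is unitary. **Theorem.** Assume the dispersive bound $\int_{\mathbb R}|\langle f,\mathrm e^{\mathrm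 itH}g\rangle|\,\mathrm dt<\infty$ for all finitely supported $f,g\in\mathcal H$. Put $$M=\max_{1\le j,n\le N}\int_0^\infty|\langle\zeta_j,\mathrm e^{\mathrm isH}\zeta_n\rangle|\,\mathrm ds,\qquad \|\nu\|_1=\sum_{j,k}|\nu_{jk}|,\qquad \lambda_0=\frac1{12\,\|\nu\|_1M}$$ ($\lambda_0=\infty$ if $\nu=0$). Let $P_{\rm ac}$ denote the projection onto the absolutely continuous subspace. The wave operators $$W_-(H,H_L)=\operatorname*{s-lim}_{t\to\infty}\mathrm e^{-\mathrm itH}\mathrm e^{\mathrm itH_L}P_{\rm ac}(H_L),\qquad W_-(H_L,H)=\operatorname*{s-lim}_{t\to\infty}\mathrm e^{-\mathrm itH_L}\mathrm e^{\mathrm itH}P_{\rm ac}(H)$$ exist and $W_-(H_L,H)=W_-(H,H_L)^*$. For every $0\le\lambda<\lambda_0$ there is a bounded operator $\rho_{\lambda,\infty}\ge0$ on $\mathcal H$ such that: (a) for every trace class operator $O$ on $\mathcal H$, $\lim_{t\to\infty}\operatorname{Tr}(\rho_\lambda(t)O)=\operatorname{Tr}(\rho_{\lambda,\infty}O)$;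 moreover the limit $A_{\lambda,\infty}=\operatorname{s-lim}_{t\to\infty}\mathrm e^{-\mathrm itH}U(t)^*$ exists and $$\rho_{\lambda,\infty}=A_{\lambda,\infty}^*\,W_-(H,H_L)\,\rho_i\,W_-(H_L,H)\,A_{\lambda,\infty};$$ (b) $\rho_{\lambda,\infty}$ does not depend on the component $\rho_s$ of $\rho_i$; (c) $\rho_{\lambda,\infty}$ commutes with $H+V_\lambda\{\rho_{\lambda,\infty}\}$; (d) if $\beta_1=\beta_2=\beta$ and $\mu_1=\mu_2=\mu$, then $\rho_{\lambda,\infty}=f_{\beta,\mu}(H+V_\lambda\{\rho_{\lambda,\infty}\})$, and the steady currents vanish: $\operatorname{Tr}(\rho_{\lambda,\infty}I_k)=0$ for $k=1,2$, where $I_k=\mathrm i[H,\Pi_k]$ and $\Pi_k$ is the projection on lead $k$; (e) $\rho_{0,\infty}=W_-(H,H_L)\,\rho_i\,W_-(H_L,H)$. -/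

import Mathlib

open scoped InnerProductSpace ENNReal NNReal Topology
open MeasureTheory Filter

noncomputable section

namespace HartreeNESS

/-! ### General notions for bounded operators on a Hilbert space -/

section General

variable {E : Type*} [NormedAddCommGroup E] [InnerProductSpace ℂ E] [CompleteSpace E]

/-- The unitary group `exp(i t A)` generated by a bounded self-adjoint operator `A`. -/
def unitaryGroup (A : E →L[ℂ] E) (t : ℝ) : E →L[ℂ] E :=
  NormedSpace.exp ((Complex.I * (t : ℂ)) • A)

/-- `s-lim_{t → ∞} F t = L` (strong operator convergence as `t → +∞`). -/
def IsStrongLimit (F : ℝ → E →L[ℂ] E) (L : E →L[ℂ] E) : Prop :=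
  ∀ ψ : E, Tendsto (fun t => F t ψ) atTop (𝓝 (L ψ))

/-- The spectral projection `χ_{(-∞, μ]}(A)` of a bounded self-adjoint operator `A`: the orthogonal
projection onto the kernel of the positive part `(A - μ)_+`. -/
def spectralProjectionIic (μ : ℝ) (A : E →L[ℂ] E) : E →L[ℂ] E :=
  (cfc (fun x : ℝ => max (x - μ) 0) A).ker.starProjection

/-- The Fermi-Dirac operator `1 / (exp(β (A - μ)) + 1)` at inverse temperature `β ∈ (0, ∞]`;
for `β = ∞` it is the spectral projection `χ_{(-∞, μ]}(A)`. -/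
def fermiDirac (β : ℝ≥0∞) (μ : ℝ) (A : E →L[ℂ] E) : E →L[ℂ] E :=
  open Classical in
  if β = ∞ then spectralProjectionIic μ A
  else cfc (fun x : ℝ => 1 / (Real.exp (β.toReal * (x - μ)) + 1)) A

/-- The vectors whose spectral measure with respect to `A` is absolutely continuous with respect
to Lebesgue measure. -/
def acVectors (A : E →L[ℂ] E) : Set E :=
  {ψ | ∃ m : Measure ℝ, IsFiniteMeasure m ∧ m ≪ (volume : Measure ℝ) ∧
    ∀ f : BoundedContinuousFunction ℝ ℝ,
      ⟪ψ, cfc (fun x : ℝ => f x) A ψ⟫_ℂ = ((∫ x, f x ∂m : ℝ) : ℂ)}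

/-- The orthogonal projection onto the absolutely continuous subspace of the bounded self-adjoint
operator `A`. (The absolutely continuous vectors already form a closed subspace; the span and the
closure only provide that structure.) -/
def acProjection (A : E →L[ℂ] E) : E →L[ℂ] E :=
  (Submodule.span ℂ (acVectors A)).topologicalClosure.starProjection

/-- `W = W_-(A, B) = s-lim_{t → ∞} exp(-i t A) exp(i t B) P_ac(B)`. -/
def IsWaveOperator (A B W : E →L[ℂ] E) : Prop :=
  IsStrongLimit (fun t => unitaryGroup A (-t) * unitaryGroup B t * acProjection B) W

/-- The Hartree potential
`V{γ} = lam * ∑ j, (∑ k, ν j k ⟨ζ k, γ (ζ k)⟩) |ζ j⟩⟨ζ j|`. -/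
def hartree {N : ℕ} (ζ : Fin N → E) (ν : Fin N → Fin N → ℝ) (lam : ℝ) (γ : E →L[ℂ] E) :
    E →L[ℂ] E :=
  (lam : ℂ) • ∑ j, (∑ k, (ν j k : ℂ) * ⟪ζ k, γ (ζ k)⟫_ℂ) • InnerProductSpace.rankOne ℂ (ζ j) (ζ j)

/-- A (global, operator-norm `C¹`) solution on `[0, ∞)` of the non-linear Liouville equation
`i ρ'(t) = [H + V{ρ(t)}, ρ(t)]`, `ρ(0) = ρi`. -/
def IsLiouvilleSolution (H : E →L[ℂ] E) (V : (E →L[ℂ] E) → (E →L[ℂ] E)) (ρi : E →L[ℂ] E)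
    (ρ : ℝ → E →L[ℂ] E) : Prop :=
  ρ 0 = ρi ∧ ∀ t : ℝ, 0 ≤ t →
    HasDerivWithinAt ρ ((-Complex.I) • ((H + V (ρ t)) * ρ t - ρ t * (H + V (ρ t)))) (Set.Ici 0) t

/-- A (global, operator-norm `C¹`) solution on `[0, ∞)` of
`i U'(t) = H U(t) + V{U(t) ρi U(t)*} U(t)`, `U(0) = 1`. -/
def IsPropagator (H : E →L[ℂ] E) (V : (E →L[ℂ] E) → (E →L[ℂ] E)) (ρi : E →L[ℂ] E)
    (U : ℝ → E →L[ℂ] E) : Prop :=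
  U 0 = 1 ∧ ∀ t : ℝ, 0 ≤ t →
    HasDerivWithinAt U ((-Complex.I) • (H * U t + V (U t * ρi * star (U t)) * U t)) (Set.Ici 0) t

/-- With respect to an orthonormal basis `e`, the operator `O` is trace class: `Tr √(O* O) < ∞`. -/
def IsTraceClassWrt {ι : Type*} (e : ι → E) (O : E →L[ℂ] E) : Prop :=
  Summable fun i => (⟪e i, CFC.sqrt (star O * O) (e i)⟫_ℂ).re

end General

/-! ### The one-particle space -/

/-- `ℓ²(ℕ)`. -/
abbrev Lead : Type := lp (fun _ : ℕ => ℂ) 2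

/-- `ℂ^N` with its Euclidean inner product. -/
abbrev Sample (N : ℕ) : Type := EuclideanSpace ℂ (Fin N)

/-- The Hilbert space `(ℓ²(ℕ) ⊕ ℓ²(ℕ)) ⊕ ℂ^N`. -/
abbrev Hilb (N : ℕ) : Type := WithLp 2 (PiLp 2 (fun _ : Fin 2 => Lead) × Sample N)

/-- The isometric embedding of the `j`-th lead. -/
def leadEmb (N : ℕ) (j : Fin 2) : Lead →L[ℂ] Hilb N :=
  (WithLp.prodContinuousLinearEquiv 2 ℂ (PiLp 2 (fun _ : Fin 2 => Lead)) (Sample N)).symm ∘L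
    ContinuousLinearMap.inl ℂ (PiLp 2 (fun _ : Fin 2 => Lead)) (Sample N) ∘L
    (PiLp.continuousLinearEquiv 2 ℂ (fun _ : Fin 2 => Lead)).symm ∘L
    ContinuousLinearMap.single ℂ (fun _ : Fin 2 => Lead) j

/-- The isometric embedding of the sample. -/
def sampleEmb (N : ℕ) : Sample N →L[ℂ] Hilb N :=
  (WithLp.prodContinuousLinearEquiv 2 ℂ (PiLp 2 (fun _ : Fin 2 => Lead)) (Sample N)).symm ∘L
    ContinuousLinearMap.inr ℂ (PiLp 2 (fun _ : Fin 2 => Lead)) (Sample N)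

theorem leadEmb_apply (N : ℕ) (j : Fin 2) (u : Lead) :
    leadEmb N j u = WithLp.toLp 2 (WithLp.toLp 2 (Pi.single j u), 0) := rfl

theorem sampleEmb_apply (N : ℕ) (v : Sample N) :
    sampleEmb N v = WithLp.toLp 2 (0, v) := rfl

/-- An operator on the `j`-th lead, extended by zero to the whole system. -/
def onLead (N : ℕ) (j : Fin 2) (A : Lead →L[ℂ] Lead) : Hilb N →L[ℂ] Hilb N :=
  leadEmb N j ∘L A ∘L ContinuousLinearMap.adjoint (leadEmb N j)

/-- An operator on the sample, extended by zero to the whole system. -/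
def onSample {N : ℕ} (A : Sample N →L[ℂ] Sample N) : Hilb N →L[ℂ] Hilb N :=
  sampleEmb N ∘L A ∘L ContinuousLinearMap.adjoint (sampleEmb N)

/-- The standard basis of the sample `ℂ^N`. -/
def sampleBasis {N : ℕ} (k : Fin N) : Sample N := EuclideanSpace.single k 1

/-- The vectors `ζ k`, as vectors of the whole system. -/
def zeta {N : ℕ} (k : Fin N) : Hilb N := sampleEmb N (sampleBasis k)

/-- The standard orthonormal basis of the whole system. -/
def stdVec {N : ℕ} : (Fin 2 × ℕ) ⊕ Fin N → Hilb N
  | Sum.inl (j, n) => leadEmb N j (lp.single 2 n (1 : ℂ))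
  | Sum.inr k => zeta k

/-- Vectors of finite support: only finitely many sites of each lead are occupied. -/
def IsCompactlySupported {N : ℕ} (f : Hilb N) : Prop :=
  ∀ j : Fin 2, {n : ℕ | f.fst j n ≠ 0}.Finite

/-- `O` is trace class: `Tr √(O* O) < ∞`. -/
def IsTraceClass {N : ℕ} (O : Hilb N →L[ℂ] Hilb N) : Prop := IsTraceClassWrt stdVec O

/-- The trace of a trace class operator. -/
def trace {N : ℕ} (O : Hilb N →L[ℂ] Hilb N) : ℂ :=
  ∑' i, ⟪stdVec i, O (stdVec i)⟫_ℂ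

/-! ### The Dirichlet Laplacian on `ℓ²(ℕ)` -/

theorem memlp_left (ψ : Lead) : Memℓp (fun n => ψ (n + 1)) 2 := by
  have h := (memℓp_gen_iff (p := 2) (by norm_num)).1 (lp.memℓp ψ)
  exact (memℓp_gen_iff (by norm_num)).2 ((summable_nat_add_iff 1).2 h)

theorem memlp_right (ψ : Lead) :
    Memℓp (fun n : ℕ => if n = 0 then (0 : ℂ) else ψ (n - 1)) 2 := by
  have h := (memℓp_gen_iff (p := 2) (by norm_num)).1 (lp.memℓp ψ)
  refine (memℓp_gen_iff (by norm_num)).2 ((summable_nat_add_iff 1).1 ?_)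
  simpa using h

/-- `(leftShift ψ) n = ψ (n + 1)`. -/
def leftShift : Lead →L[ℂ] Lead :=
  LinearMap.mkContinuous
    { toFun := fun ψ => ⟨fun n => ψ (n + 1), memlp_left ψ⟩
      map_add' := fun _ _ => rfl
      map_smul' := fun _ _ => rfl } 1 (by
    intro ψ
    rw [one_mul]
    refine lp.norm_le_of_tsum_le (by norm_num) (norm_nonneg _) ?_
    rw [lp.norm_rpow_eq_tsum (by norm_num)]
    have h := (memℓp_gen_iff (p := 2) (by norm_num)).1 (lp.memℓp ψ)
    rw [h.tsum_eq_zero_add]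
    exact le_add_of_nonneg_left (by positivity))

/-- `(rightShift ψ) n = ψ (n - 1)` for `n ≥ 1` and `(rightShift ψ) 0 = 0`. -/
def rightShift : Lead →L[ℂ] Lead :=
  LinearMap.mkContinuous
    { toFun := fun ψ => ⟨fun n => if n = 0 then 0 else ψ (n - 1), memlp_right ψ⟩
      map_add' := fun x y => by
        ext n
        change (if n = 0 then (0 : ℂ) else x (n - 1) + y (n - 1)) =
          (if n = 0 then 0 else x (n - 1)) + (if n = 0 then 0 else y (n - 1))
        by_cases hn : n = 0 <;> simp [hn]
      map_smul' := fun c x => by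
        ext n
        by_cases hn : n = 0 <;> simp [hn] } 1 (by
    intro ψ
    rw [one_mul]
    refine lp.norm_le_of_tsum_le (by norm_num) (norm_nonneg _) ?_
    rw [lp.norm_rpow_eq_tsum (by norm_num)]
    have h := (memℓp_gen_iff (p := 2) (by norm_num)).1 (memlp_right ψ)
    refine le_of_eq (h.tsum_eq_zero_add.trans ?_)
    simp)

/-- The Dirichlet Laplacian with hopping constant `tc`. -/
def dirichletLaplacian (tc : ℝ) : Lead →L[ℂ] Lead := (tc : ℂ) • (leftShift + rightShift)

theorem dirichletLaplacian_apply_succ (tc : ℝ) (ψ : Lead) (n : ℕ) :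
    dirichletLaplacian tc ψ (n + 1) = tc * (ψ (n + 2) + ψ n) := by
  change (tc : ℂ) * (ψ (n + 1 + 1) + (if n + 1 = 0 then 0 else ψ (n + 1 - 1))) = _
  simp

theorem dirichletLaplacian_apply_zero (tc : ℝ) (ψ : Lead) :
    dirichletLaplacian tc ψ 0 = tc * ψ 1 := by
  change (tc : ℂ) * (ψ (0 + 1) + (if 0 = 0 then 0 else ψ (0 - 1))) = _
  simp

/-! ### The Hamiltonians, the initial state and the critical coupling -/

/-- The Hamiltonian of the leads, `H_L = h₁ + h₂` (and zero on the sample). -/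
def leadHam (N : ℕ) (tc : ℝ) : Hilb N →L[ℂ] Hilb N :=
  ∑ j : Fin 2, onLead N j (dirichletLaplacian tc)

/-- The tunneling Hamiltonian `τ ∑ j, (|S j⟩⟨L j| + |L j⟩⟨S j|)`. -/
def tunnelHam {N : ℕ} (τ : ℝ) (L : Fin 2 → Lead) (S : Fin 2 → Sample N) : Hilb N →L[ℂ] Hilb N :=
  (τ : ℂ) • ∑ j : Fin 2,
    (InnerProductSpace.rankOne ℂ (sampleEmb N (S j)) (leadEmb N j (L j)) +
      InnerProductSpace.rankOne ℂ (leadEmb N j (L j)) (sampleEmb N (S j)))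

/-- The linear coupled Hamiltonian `H = h₁ + h₂ + h_s + h_τ`. -/
def coupledHam {N : ℕ} (tc : ℝ) (hs : Sample N →L[ℂ] Sample N) (τ : ℝ) (L : Fin 2 → Lead)
    (S : Fin 2 → Sample N) : Hilb N →L[ℂ] Hilb N :=
  leadHam N tc + onSample hs + tunnelHam τ L S

/-- The self-consistent equilibrium states of the sample with inverse temperature `βs` and mean
particle number `n`: density matrices with
`ρs = 1 / (exp(βs (hs + V{ρs} - μs)) + 1)` and `Tr ρs = n`, for some chemical potential `μs`
(which the second equation determines). -/
def IsSampleEquilibrium {N : ℕ} (hs : Sample N →L[ℂ] Sample N) (ν : Fin N → Fin N → ℝ)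
    (lam βs n : ℝ) (ρs : Sample N →L[ℂ] Sample N) : Prop :=
  ρs.IsPositive ∧ LinearMap.trace ℂ (Sample N) (ρs : Sample N →ₗ[ℂ] Sample N) = (n : ℂ) ∧
    ∃ μs : ℝ, ρs = fermiDirac (ENNReal.ofReal βs) μs (hs + hartree sampleBasis ν lam ρs)

/-- The partitioned initial state
`ρi = f_{β₁,μ₁}(h₁) ⊕ f_{β₂,μ₂}(h₂) ⊕ ρs`. -/
def initialState {N : ℕ} (tc : ℝ) (β : Fin 2 → ℝ≥0∞) (μ : Fin 2 → ℝ)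
    (ρs : Sample N →L[ℂ] Sample N) : Hilb N →L[ℂ] Hilb N :=
  ∑ j : Fin 2, onLead N j (fermiDirac (β j) (μ j) (dirichletLaplacian tc)) + onSample ρs

/-- The dispersive bound: `∫ |⟨f, exp(itH) g⟩| dt < ∞` for all finitely supported `f`, `g`. -/
def Dispersive {N : ℕ} (H : Hilb N →L[ℂ] Hilb N) : Prop :=
  ∀ f g : Hilb N, IsCompactlySupported f → IsCompactlySupported g →
    Integrable (fun t : ℝ => ⟪f, unitaryGroup H t g⟫_ℂ)

/-- `M = max_{j,n} ∫_0^∞ |⟨ζ j, exp(isH) ζ n⟩| ds`, as an extended non-negative number. -/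
def maxDecay {N : ℕ} (H : Hilb N →L[ℂ] Hilb N) : ℝ≥0∞ :=
  ⨆ j : Fin N, ⨆ n : Fin N, ∫⁻ s in Set.Ioi (0 : ℝ), ‖⟪zeta j, unitaryGroup H s (zeta n)⟫_ℂ‖ₑ

/-- `‖ν‖₁ = ∑ j k, |ν j k|`. -/
def nuNorm {N : ℕ} (ν : Fin N → Fin N → ℝ) : ℝ := ∑ j, ∑ k, |ν j k|

/-- `λ₀ = 1 / (12 ‖ν‖₁ M)`, with `λ₀ = ∞` when `ν = 0`. -/
def criticalCoupling {N : ℕ} (ν : Fin N → Fin N → ℝ) (H : Hilb N →L[ℂ] Hilb N) : ℝ≥0∞ :=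
  1 / (12 * ENNReal.ofReal (nuNorm ν) * maxDecay H)

/-- The projection `Π_k` on the `k`-th lead. -/
def leadProj (N : ℕ) (k : Fin 2) : Hilb N →L[ℂ] Hilb N := onLead N k 1

/-- The current intensity operator `I_k = i [H, Π_k]` through the `k`-th lead. -/
def currentOp {N : ℕ} (H : Hilb N →L[ℂ] Hilb N) (k : Fin 2) : Hilb N →L[ℂ] Hilb N :=
  Complex.I • (H * leadProj N k - leadProj N k * H)

end HartreeNESS

end

open HartreeNESS

set_option linter.unusedSectionVars false

namespace HartreeNESS

/-! ### Unitary groups -/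

section UnitaryGroup

variable {E F : Type*} [NormedAddCommGroup E] [InnerProductSpace ℂ E] [CompleteSpace E]
  [NormedAddCommGroup F] [InnerProductSpace ℂ F] [CompleteSpace F]

/-! In the interaction picture Y(t) = e^{-itH} U(t)*, the Hartree potential enters only through the
N vectors y_k(t) = Y(t) ζ_k: its coefficients are quadratic forms of the free evolution e^{-itH} ρ_i
e^{itH} at the y_k. Duhamel's formula becomes a closed Volterra equation for y, with a source cubic
in y and kernels ⟨ζ_j, e^{irH} ζ_k⟩ e^{-irH} that the dispersive bound makes integrable. As ‖ρ_i‖ ≤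
1, a coupling below λ₀ makes the right-hand side a contraction of the sup-norm ball of radius 6/5.
It also preserves the closed set of functions with a limit at infinity, because the free evolution
converges strongly to σ = W ρ_i W'. So y converges, to the only solution of the limiting equation in
that ball (`SmallCoupling.exists_volterra`, `SmallCoupling.limit_unique`). The propagator is rebuilt
from y (`SmallCoupling.exists_propagator`), and Y(t) converges strongly to an isometry A.

The sample state is forgotten because A depends on ρ_i only through σ, and σ does not see ρ_s: the
component of W' x along a sample vector v is the limit of ⟨v, e^{itH} x⟩, which is integrable for x
in a dense set, so it is zero (`waveOperator_snd_eq_zero`).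

The wave operators come from Cook's method, H - H_L being of finite rank and built on finitely
supported vectors. For H the decay is the assumed dispersive bound, which also gives P_ac(H) = 1,
since a finite measure with integrable Fourier transform is absolutely continuous. For the leads the
decay is proved: Chebyshev polynomials turn ⟨δ₀, q(h) δ₀⟩ into integration against the semicircle
law, and two integrations by parts yield t⁻² on a dense set (`integrable_returnAmplitude`).

Stationarity holds because Y(t) x and its derivative both converge, so the derivative tends to zero:
H A = A (H + V{A* σ A}). Functional calculus carries commutation and Fermi functions through A. With
K = H + V{ρ_{λ,∞}}, the equilibrium current is, up to a factor i, the trace of f(K) [K, Π_k]; for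
powers, (m + 1) Tr K^m [K, Π_k] is the sum of the diagonal of [K^{m+1}, Π_k], which vanishes in a
basis adapted to Π_k (`sum_inner_pow_eq_zero`), and approximation reaches f. Convergence against
trace class operators is weak convergence plus a uniform tail bound (`sum_norm_inner_le`). -/

theorem unitaryGroup_zero (A : E →L[ℂ] E) : unitaryGroup A 0 = 1 := by
  simp [unitaryGroup]

theorem unitaryGroup_add (A : E →L[ℂ] E) (s t : ℝ) :
    unitaryGroup A (s + t) = unitaryGroup A s * unitaryGroup A t := by
  unfold unitaryGroup
  let : NormedAlgebra ℚ (E →L[ℂ] E) := .restrictScalars ℚ ℂ _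
  rw [← NormedSpace.exp_add_of_commute]
  · congr 1
    rw [← add_smul]
    push_cast
    ring_nf
  · exact ((Commute.refl A).smul_left _).smul_right _

theorem unitaryGroup_neg_mul (A : E →L[ℂ] E) (t : ℝ) :
    unitaryGroup A (-t) * unitaryGroup A t = 1 := by
  rw [← unitaryGroup_add, neg_add_cancel, unitaryGroup_zero]

theorem unitaryGroup_mul_neg (A : E →L[ℂ] E) (t : ℝ) :
    unitaryGroup A t * unitaryGroup A (-t) = 1 := by
  rw [← unitaryGroup_add, add_neg_cancel, unitaryGroup_zero]

theorem unitaryGroup_neg_apply_apply (A : E →L[ℂ] E) (t : ℝ) (x : E) :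
    unitaryGroup A (-t) (unitaryGroup A t x) = x := by
  simpa using congrArg (fun T : E →L[ℂ] E => T x) (unitaryGroup_neg_mul A t)

theorem unitaryGroup_apply_neg_apply (A : E →L[ℂ] E) (t : ℝ) (x : E) :
    unitaryGroup A t (unitaryGroup A (-t) x) = x := by
  simpa using congrArg (fun T : E →L[ℂ] E => T x) (unitaryGroup_mul_neg A t)

theorem _root_.Commute.unitaryGroup_right {T A : E →L[ℂ] E} (h : Commute T A) (t : ℝ) :
    Commute T (unitaryGroup A t) := by
  let : NormedAlgebra ℚ (E →L[ℂ] E) := .restrictScalars ℚ ℂ _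
  exact Commute.exp_right (h.smul_right _)

theorem star_unitaryGroup {A : E →L[ℂ] E} (hA : IsSelfAdjoint A) (t : ℝ) :
    star (unitaryGroup A t) = unitaryGroup A (-t) := by
  unfold unitaryGroup
  rw [NormedSpace.star_exp, star_smul, hA.star_eq]
  congr 2
  simp

theorem inner_unitaryGroup_left {A : E →L[ℂ] E} (hA : IsSelfAdjoint A) (t : ℝ) (x y : E) :
    ⟪unitaryGroup A t x, y⟫_ℂ = ⟪x, unitaryGroup A (-t) y⟫_ℂ := by
  rw [← star_unitaryGroup hA, ContinuousLinearMap.star_eq_adjoint,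
    ContinuousLinearMap.adjoint_inner_right]

theorem norm_unitaryGroup_apply {A : E →L[ℂ] E} (hA : IsSelfAdjoint A) (t : ℝ) (x : E) :
    ‖unitaryGroup A t x‖ = ‖x‖ := by
  have h : ⟪unitaryGroup A t x, unitaryGroup A t x⟫_ℂ = ⟪x, x⟫_ℂ := by
    rw [inner_unitaryGroup_left hA, unitaryGroup_neg_apply_apply]
  rw [@norm_eq_sqrt_re_inner ℂ, h, ← @norm_eq_sqrt_re_inner ℂ]

theorem norm_unitaryGroup_le {A : E →L[ℂ] E} (hA : IsSelfAdjoint A) (t : ℝ) :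
    ‖unitaryGroup A t‖ ≤ 1 :=
  ContinuousLinearMap.opNorm_le_bound _ zero_le_one fun x => by
    rw [norm_unitaryGroup_apply hA, one_mul]

theorem hasDerivAt_unitaryGroup (A : E →L[ℂ] E) (t : ℝ) :
    HasDerivAt (unitaryGroup A) (Complex.I • (A * unitaryGroup A t)) t := by
  have h : HasDerivAt (fun u : ℝ => NormedSpace.exp (u • (Complex.I • A)))
      ((Complex.I • A) * NormedSpace.exp (t • (Complex.I • A))) t :=
    hasDerivAt_exp_smul_const' (𝕂 := ℝ) (Complex.I • A) t
  have e : unitaryGroup A = fun u : ℝ => NormedSpace.exp (u • (Complex.I • A)) := by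
    funext u
    unfold unitaryGroup
    congr 1
    rw [← Complex.coe_smul, smul_smul, mul_comm]
  rw [e]
  refine h.congr_deriv ?_
  rw [smul_mul_assoc]

theorem hasDerivAt_unitaryGroup' (A : E →L[ℂ] E) (t : ℝ) :
    HasDerivAt (unitaryGroup A) (Complex.I • (unitaryGroup A t * A)) t := by
  rw [← ((Commute.refl A).unitaryGroup_right t).eq]
  exact hasDerivAt_unitaryGroup A t

theorem hasDerivAt_unitaryGroup_neg (A : E →L[ℂ] E) (t : ℝ) :
    HasDerivAt (fun t => unitaryGroup A (-t)) (-(Complex.I • (A * unitaryGroup A (-t)))) t := by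
  exact HasDerivAt.congr_deriv (f' := (-1 : ℝ) • (Complex.I • (A * unitaryGroup A (-t))))
    ((hasDerivAt_unitaryGroup A (-t)).scomp t (hasDerivAt_neg t)) (by simp)

@[fun_prop]
theorem continuous_unitaryGroup (A : E →L[ℂ] E) : Continuous (unitaryGroup A) :=
  continuous_iff_continuousAt.2 fun t => (hasDerivAt_unitaryGroup A t).continuousAt

/-- The curve e^{-isA} W e^{isB} x has derivative zero by the intertwining relation, so it keeps its
value W x at s = 0. -/
theorem unitaryGroup_intertwine {A : E →L[ℂ] E} {B : F →L[ℂ] F} {W : F →L[ℂ] E}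
    (h : A ∘L W = W ∘L B) (t : ℝ) (x : F) :
    unitaryGroup A t (W x) = W (unitaryGroup B t x) := by
  have key : ∀ s : ℝ, HasDerivAt
      (fun s => unitaryGroup A (-s) (W (unitaryGroup B s x))) 0 s := by
    intro s
    have h1 : HasDerivAt (fun s => W (unitaryGroup B s x))
        (W (Complex.I • (B * unitaryGroup B s) x)) s :=
      ((W.restrictScalars ℝ).hasFDerivAt.comp_hasDerivAt s
        (((ContinuousLinearMap.apply ℂ F x).restrictScalars ℝ).hasFDerivAt.comp_hasDerivAt s
          (hasDerivAt_unitaryGroup B s)))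
    have h2 := (isBoundedBilinearMap_apply (𝕜 := ℂ) (E := E) (F := E)).hasFDerivAt
      (unitaryGroup A (-s), W (unitaryGroup B s x))
    have h3 := (h2.restrictScalars ℝ).comp_hasDerivAt s
      ((hasDerivAt_unitaryGroup_neg A s).prodMk h1)
    refine h3.congr_deriv ?_
    have e : ∀ y, A (W y) = W (B y) := fun y => congrArg (fun T : F →L[ℂ] E => T y) h
    have c : ∀ y, A (unitaryGroup A (-s) y) = unitaryGroup A (-s) (A y) := fun y =>
      congrArg (fun T : E →L[ℂ] E => T y) ((Commute.refl A).unitaryGroup_right (-s)).eq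
    simp [c, e]
  have hc := is_const_of_deriv_eq_zero (fun s => (key s).differentiableAt)
    (fun s => (key s).deriv) t 0
  simp only [neg_zero, unitaryGroup_zero, one_apply_eq_self] at hc
  rw [← hc, unitaryGroup_apply_neg_apply]

end UnitaryGroup

/-! ### Limits at infinity -/

section Limits

variable {E F : Type*} [NormedAddCommGroup E] [InnerProductSpace ℂ E] [CompleteSpace E]
  [NormedAddCommGroup F] [InnerProductSpace ℂ F] [CompleteSpace F]

/-- If a function and its derivative both converge at infinity, the derivative tends to zero. -/
theorem eq_zero_of_tendsto_of_hasDerivAt {G : Type*} [NormedAddCommGroup G] [NormedSpace ℝ G]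
    {f f' : ℝ → G} {l c : G}
    (hd : ∀ t, 0 ≤ t → HasDerivAt f (f' t) t) (hf : Tendsto f atTop (𝓝 l))
    (hf' : Tendsto f' atTop (𝓝 c)) : c = 0 := by
  have h1 : Tendsto (fun t => f (t + 1) - f t) atTop (𝓝 0) := by
    simpa using (hf.comp (tendsto_atTop_add_const_right _ 1 tendsto_id)).sub hf
  -- The mean value inequality for f s - s • c on [t, t + 1] puts the unit increment of f within ε /
  -- 2 of c.
  have h2 : Tendsto (fun t => f (t + 1) - f t) atTop (𝓝 c) := by
    rw [Metric.tendsto_atTop] at hf' ⊢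
    intro ε hε
    obtain ⟨T, hT⟩ := hf' (ε / 2) (by positivity)
    refine ⟨max T 0, fun t ht => ?_⟩
    have ht0 : 0 ≤ t := le_trans (le_max_right _ _) ht
    have hb := (convex_Icc t (t + 1)).norm_image_sub_le_of_norm_hasDerivWithin_le
      (f := fun s => f s - s • c) (f' := fun s => f' s - c) (C := ε / 2) (x := t) (y := t + 1)
      (fun s hs => (((hd s (ht0.trans hs.1)).sub
        (by simpa using (hasDerivAt_id s).smul_const c))).hasDerivWithinAt)
      (fun s hs => by
        rw [← dist_eq_norm]
        exact (hT s ((le_max_left _ _).trans (ht.trans hs.1))).le) (by simp) (by simp)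
    rw [dist_eq_norm]
    refine lt_of_le_of_lt (le_trans (le_of_eq ?_) hb) (by simp; linarith)
    congr 1
    rw [add_smul, one_smul]
    abel
  exact tendsto_nhds_unique h2 h1

/-- A uniformly bounded family of operators which converges on the vectors of a dense set
converges strongly. -/
theorem exists_strongLimit_of_dense {T : ℝ → E →L[ℂ] F} {C : ℝ} (hT : ∀ t, 0 ≤ t → ‖T t‖ ≤ C)
    {s : Set E} (hs : Dense s) (h : ∀ x ∈ s, ∃ l, Tendsto (fun t => T t x) atTop (𝓝 l)) :
    ∃ L : E →L[ℂ] F, ∀ x, Tendsto (fun t => T t x) atTop (𝓝 (L x)) := by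
  have hC : 0 ≤ C := (norm_nonneg _).trans (hT 0 le_rfl)
  have hx : ∀ x, ∃ l, Tendsto (fun t => T t x) atTop (𝓝 l) := by
    intro x
    refine cauchySeq_tendsto_of_complete (Metric.cauchySeq_iff.2 fun ε hε => ?_)
    -- Using C + 1 in place of C keeps the radius meaningful when C = 0.
    obtain ⟨y, hy, hxy⟩ := Metric.dense_iff.1 hs x (ε / (3 * (C + 1))) (by positivity)
    obtain ⟨l, hl⟩ := h y hxy
    obtain ⟨N, hN⟩ := Metric.cauchySeq_iff.1 hl.cauchySeq (ε / 3) (by positivity)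
    have hyx : dist x y < ε / (3 * (C + 1)) := by rw [dist_comm]; exact hy
    have hb : ∀ t, 0 ≤ t → dist (T t x) (T t y) < ε / 3 := by
      intro t ht
      rw [dist_eq_norm, ← map_sub]
      calc ‖T t (x - y)‖ ≤ C * ‖x - y‖ := (T t).le_of_opNorm_le (hT t ht) _
        _ ≤ (C + 1) * ‖x - y‖ := by gcongr; linarith
        _ < (C + 1) * (ε / (3 * (C + 1))) := by
          rw [← dist_eq_norm]; gcongr
        _ = ε / 3 := by field_simp
    refine ⟨max N 0, fun m hm n hn => ?_⟩
    have h1 := hb m ((le_max_right _ _).trans hm)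
    have h2 := hb n ((le_max_right _ _).trans hn)
    have h3 := hN m ((le_max_left _ _).trans hm) n ((le_max_left _ _).trans hn)
    rw [dist_comm] at h2
    linarith [dist_triangle4 (T m x) (T m y) (T n y) (T n x)]
  choose L hL using hx
  refine ⟨LinearMap.mkContinuous
    { toFun := L
      map_add' := fun x y => tendsto_nhds_unique (hL (x + y)) (by simpa using (hL x).add (hL y))
      map_smul' := fun c x => tendsto_nhds_unique (hL (c • x))
        (by simpa using (hL x).const_smul c) } C ?_, hL⟩
  intro x
  refine le_of_tendsto (hL x).norm ?_
  filter_upwards [eventually_ge_atTop 0] with t ht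
  exact (T t).le_of_opNorm_le (hT t ht) _

/-- Strong convergence of a bounded family, applied to a convergent family of vectors. -/
theorem tendsto_apply_of_strong {T : ℝ → E →L[ℂ] F} {L : E →L[ℂ] F} {C : ℝ}
    (hT : ∀ t, 0 ≤ t → ‖T t‖ ≤ C) (h : ∀ x, Tendsto (fun t => T t x) atTop (𝓝 (L x)))
    {v : ℝ → E} {x : E} (hv : Tendsto v atTop (𝓝 x)) :
    Tendsto (fun t => T t (v t)) atTop (𝓝 (L x)) := by
  have h1 : Tendsto (fun t => T t (v t - x)) atTop (𝓝 0) := by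
    have h0 : Tendsto (fun t => C * ‖v t - x‖) atTop (𝓝 0) := by
      simpa using (tendsto_iff_norm_sub_tendsto_zero.1 hv).const_mul C
    refine squeeze_zero_norm' ?_ h0
    filter_upwards [eventually_ge_atTop 0] with t ht
    exact (T t).le_of_opNorm_le (hT t ht) _
  simpa using h1.add (h x)

/-- Cook's method: if `∫ ‖(A - B) e^{itB} x‖ dt < ∞`, then `e^{-itA} e^{itB} x` converges. -/
theorem cook_tendsto {A B : E →L[ℂ] E} (hA : IsSelfAdjoint A) {x : E}
    (h : IntegrableOn (fun t => (A - B) (unitaryGroup B t x)) (Set.Ioi 0)) :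
    ∃ l, Tendsto (fun t => (unitaryGroup A (-t) * unitaryGroup B t) x) atTop (𝓝 l) := by
  have hd : ∀ t ∈ Set.Ioi (0 : ℝ), HasDerivAt
      (fun t => (unitaryGroup A (-t) * unitaryGroup B t) x)
      (-(Complex.I • unitaryGroup A (-t) ((A - B) (unitaryGroup B t x)))) t := by
    intro t _
    have h1 := (hasDerivAt_unitaryGroup_neg A t).mul (hasDerivAt_unitaryGroup B t)
    have h2 := ((ContinuousLinearMap.apply ℂ E x).restrictScalars ℝ).hasFDerivAt.comp_hasDerivAt
      t h1
    refine h2.congr_deriv ?_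
    have c : ∀ y, A (unitaryGroup A (-t) y) = unitaryGroup A (-t) (A y) := fun y =>
      congrArg (fun T : E →L[ℂ] E => T y) ((Commute.refl A).unitaryGroup_right (-t)).eq
    simp [c, smul_sub]
    abel
  refine ⟨_, tendsto_limUnder_of_hasDerivAt_of_integrableOn_Ioi hd ?_⟩
  refine Integrable.mono' h.norm ?_ (Eventually.of_forall fun t => ?_)
  · refine Continuous.aestronglyMeasurable ?_
    fun_prop
  · rw [norm_neg, norm_smul, Complex.norm_I, one_mul, norm_unitaryGroup_apply hA]

end Limits

end HartreeNESS

namespace HartreeNESS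

/-! ### Functional calculus -/

section FunctionalCalculus

variable {E F : Type*} [NormedAddCommGroup E] [InnerProductSpace ℂ E] [CompleteSpace E]
  [NormedAddCommGroup F] [InnerProductSpace ℂ F] [CompleteSpace F]

theorem norm_aeval_sub_cfc_le {A : E →L[ℂ] E} (hA : IsSelfAdjoint A) {f : ℝ → ℝ}
    (hf : Continuous f) {p : Polynomial ℝ} {ε c : ℝ} (hε : 0 ≤ ε)
    (hc : spectrum ℝ A ⊆ Metric.closedBall 0 c)
    (hp : ∀ x ∈ Set.Icc (-c) c, |p.eval x - f x| ≤ ε) :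
    ‖Polynomial.aeval A p - cfc f A‖ ≤ ε := by
  rw [← cfc_polynomial p A hA, ← cfc_sub _ _ A p.continuous.continuousOn hf.continuousOn]
  refine norm_cfc_le hε fun x hx => ?_
  have hx' := hc hx
  rw [mem_closedBall_zero_iff, Real.norm_eq_abs, abs_le] at hx'
  exact hp x hx'

/-- Weierstrass on an interval containing both spectra. One common polynomial for A and B is what
makes intertwining relations pass to continuous functions. -/
theorem exists_polynomial_near_cfc {A : E →L[ℂ] E} {B : F →L[ℂ] F} (hA : IsSelfAdjoint A)
    (hB : IsSelfAdjoint B) {f : ℝ → ℝ} (hf : Continuous f) {ε : ℝ} (hε : 0 < ε) :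
    ∃ p : Polynomial ℝ, ‖Polynomial.aeval A p - cfc f A‖ ≤ ε ∧
      ‖Polynomial.aeval B p - cfc f B‖ ≤ ε := by
  obtain ⟨a, ha⟩ := (ContinuousFunctionalCalculus.isCompact_spectrum (R := ℝ)
    A).isBounded.subset_closedBall 0
  obtain ⟨b, hb⟩ := (ContinuousFunctionalCalculus.isCompact_spectrum (R := ℝ)
    B).isBounded.subset_closedBall 0
  obtain ⟨p, hp⟩ := exists_polynomial_near_of_continuousOn (-(max a b)) (max a b) f
    hf.continuousOn ε hε
  exact ⟨p, norm_aeval_sub_cfc_le hA hf hε.le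
      (ha.trans (Metric.closedBall_subset_closedBall (le_max_left a b))) fun x hx => (hp x hx).le,
    norm_aeval_sub_cfc_le hB hf hε.le
      (hb.trans (Metric.closedBall_subset_closedBall (le_max_right a b))) fun x hx => (hp x hx).le⟩

theorem aeval_intertwine {A : E →L[ℂ] E} {B : F →L[ℂ] F} {W : F →L[ℂ] E}
    (h : A ∘L W = W ∘L B) (p : Polynomial ℝ) :
    Polynomial.aeval A p ∘L W = W ∘L Polynomial.aeval B p := by
  induction p using Polynomial.induction_on' with
  | add p q hp hq =>
    rw [map_add, map_add, ContinuousLinearMap.add_comp, ContinuousLinearMap.comp_add, hp, hq]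
  | monomial n a =>
    have hn : ∀ n : ℕ, (A ^ n) ∘L W = W ∘L (B ^ n) := by
      intro n
      induction n with
      | zero => ext; simp
      | succ n ih =>
        rw [pow_succ', pow_succ', ContinuousLinearMap.mul_def, ContinuousLinearMap.mul_def,
          ContinuousLinearMap.comp_assoc, ih, ← ContinuousLinearMap.comp_assoc, h,
          ContinuousLinearMap.comp_assoc]
    rw [Polynomial.aeval_monomial, Polynomial.aeval_monomial, ← Algebra.smul_def,
      ← Algebra.smul_def]
    ext x
    have := congrArg (fun T : F →L[ℂ] E => T x) (hn n)
    simp only [ContinuousLinearMap.comp_apply] at this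
    simp [this]

theorem cfc_intertwine {A : E →L[ℂ] E} {B : F →L[ℂ] F} {W : F →L[ℂ] E}
    (hA : IsSelfAdjoint A) (hB : IsSelfAdjoint B)
    (h : A ∘L W = W ∘L B) {f : ℝ → ℝ} (hf : Continuous f) :
    cfc f A ∘L W = W ∘L cfc f B := by
  rw [← sub_eq_zero, ← norm_le_zero_iff]
  refine le_of_forall_pos_le_add fun ε hε => ?_
  obtain ⟨p, hpA, hpB⟩ := exists_polynomial_near_cfc hA hB hf
    (show 0 < ε / (2 * (‖W‖ + 1)) by positivity)
  have e : cfc f A ∘L W - W ∘L cfc f B =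
      W ∘L (Polynomial.aeval B p - cfc f B) - (Polynomial.aeval A p - cfc f A) ∘L W := by
    rw [ContinuousLinearMap.comp_sub, ContinuousLinearMap.sub_comp, aeval_intertwine h]
    abel
  rw [e, zero_add]
  calc _ ≤ ‖W‖ * ‖Polynomial.aeval B p - cfc f B‖ + ‖Polynomial.aeval A p - cfc f A‖ * ‖W‖ :=
        (norm_sub_le _ _).trans (add_le_add (ContinuousLinearMap.opNorm_comp_le _ _)
          (ContinuousLinearMap.opNorm_comp_le _ _))
    _ ≤ (‖W‖ + 1) * (ε / (2 * (‖W‖ + 1))) + (ε / (2 * (‖W‖ + 1))) * (‖W‖ + 1) := by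
        gcongr <;> linarith [norm_nonneg W]
    _ = ε := by field_simp; ring

theorem adjoint_intertwine {A : E →L[ℂ] E} {B : F →L[ℂ] F} {W : F →L[ℂ] E}
    (hA : IsSelfAdjoint A) (hB : IsSelfAdjoint B) (h : A ∘L W = W ∘L B) :
    B ∘L ContinuousLinearMap.adjoint W = ContinuousLinearMap.adjoint W ∘L A := by
  have := congrArg ContinuousLinearMap.adjoint h
  rw [ContinuousLinearMap.adjoint_comp, ContinuousLinearMap.adjoint_comp,
    ← ContinuousLinearMap.star_eq_adjoint A, ← ContinuousLinearMap.star_eq_adjoint B,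
    hA.star_eq, hB.star_eq] at this
  exact this.symm

/-- The indicator function is not continuous, so the projection is handled through its range, the
kernel of the positive part. W maps the kernel for B into the kernel for A, and W* maps the kernel
for A into that for B; by duality W also respects the orthogonal complements. -/
theorem spectralProjectionIic_intertwine {A : E →L[ℂ] E} {B : F →L[ℂ] F} {W : F →L[ℂ] E}
    (hA : IsSelfAdjoint A) (hB : IsSelfAdjoint B) (h : A ∘L W = W ∘L B) (μ : ℝ) :
    spectralProjectionIic μ A ∘L W = W ∘L spectralProjectionIic μ B := by
  have hg : Continuous fun x : ℝ => max (x - μ) 0 := by fun_prop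
  have h1 := cfc_intertwine hA hB h hg
  have h2 := cfc_intertwine hB hA (adjoint_intertwine hA hB h) hg
  unfold spectralProjectionIic
  ext x
  simp only [ContinuousLinearMap.comp_apply]
  refine Submodule.eq_starProjection_of_mem_of_inner_eq_zero ?_ fun w hw => ?_
  · have h3 := Submodule.starProjection_apply_mem (cfc (fun x : ℝ => max (x - μ) 0) B).ker x
    rw [LinearMap.mem_ker] at h3 ⊢
    have := congrArg (fun T : F →L[ℂ] E =>
      T ((cfc (fun x : ℝ => max (x - μ) 0) B).ker.starProjection x)) h1
    simp only [ContinuousLinearMap.comp_apply] at this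
    simp only [ContinuousLinearMap.coe_coe] at h3 ⊢
    rw [this, h3, map_zero]
  · rw [← map_sub, ← ContinuousLinearMap.adjoint_inner_right]
    refine Submodule.starProjection_inner_eq_zero _ _ ?_
    rw [LinearMap.mem_ker] at hw ⊢
    have := congrArg (fun T : E →L[ℂ] F => T w) h2
    simp only [ContinuousLinearMap.comp_apply] at this
    simp only [ContinuousLinearMap.coe_coe] at hw ⊢
    rw [this, hw, map_zero]

/-! ### Fermi–Dirac operators -/

theorem continuous_fermi (b μ : ℝ) :
    Continuous fun x : ℝ => 1 / (Real.exp (b * (x - μ)) + 1) :=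
  continuous_const.div (by fun_prop) fun x => by positivity

theorem fermiDirac_intertwine {A : E →L[ℂ] E} {B : F →L[ℂ] F} {W : F →L[ℂ] E}
    (hA : IsSelfAdjoint A) (hB : IsSelfAdjoint B) (h : A ∘L W = W ∘L B) (β : ℝ≥0∞) (μ : ℝ) :
    fermiDirac β μ A ∘L W = W ∘L fermiDirac β μ B := by
  unfold fermiDirac
  split_ifs
  · exact spectralProjectionIic_intertwine hA hB h μ
  · exact cfc_intertwine hA hB h (continuous_fermi _ _)

theorem commute_fermiDirac {A : E →L[ℂ] E} (hA : IsSelfAdjoint A) (β : ℝ≥0∞) (μ : ℝ) :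
    Commute A (fermiDirac β μ A) :=
  (fermiDirac_intertwine hA hA (W := A) rfl β μ).symm

theorem isPositive_fermiDirac (A : E →L[ℂ] E) (β : ℝ≥0∞) (μ : ℝ) :
    (fermiDirac β μ A).IsPositive := by
  unfold fermiDirac
  split_ifs
  · exact ContinuousLinearMap.IsPositive.of_isStarProjection isStarProjection_starProjection
  · rw [← ContinuousLinearMap.nonneg_iff_isPositive]
    exact cfc_nonneg fun x _ => by positivity

theorem norm_fermiDirac_le (A : E →L[ℂ] E) (β : ℝ≥0∞) (μ : ℝ) : ‖fermiDirac β μ A‖ ≤ 1 := by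
  unfold fermiDirac
  split_ifs
  · exact Submodule.starProjection_norm_le _
  · refine norm_cfc_le zero_le_one fun x _ => ?_
    rw [Real.norm_of_nonneg (by positivity), div_le_one (by positivity)]
    linarith [Real.exp_pos (β.toReal * (x - μ))]

/-- The spectral projection `χ_{(-∞, μ]}(A)` is a strong limit of continuous functions of `A`. -/
theorem exists_cfc_tendsto_spectralProjectionIic {A : E →L[ℂ] E} (hA : IsSelfAdjoint A) (μ : ℝ) :
    ∃ f : ℕ → ℝ → ℝ, (∀ n, Continuous (f n)) ∧
      ∀ u, Tendsto (fun n => cfc (f n) A u) atTop (𝓝 (spectralProjectionIic μ A u)) := by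
  set g : ℝ → ℝ := fun x => max (x - μ) 0 with hgdef
  have hg : Continuous g := by fun_prop
  have hg0 : ∀ x, 0 ≤ g x := fun x => le_max_right _ _
  -- The approximants 1 - k n * g equal 1 on (-∞, μ] and vanish once g ≥ 1 / (n + 1). The factor g
  -- makes them the identity on ker g(A), and their product with g is at most 1 / (n + 1), so they
  -- tend to zero on the range of g(A).
  set k : ℕ → ℝ → ℝ := fun n x => 1 / max (g x) (1 / (n + 1)) with hkdef
  have hpos : ∀ (n : ℕ) (x : ℝ), 0 < max (g x) (1 / ((n : ℝ) + 1)) := fun n x =>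
    lt_max_of_lt_right Nat.one_div_pos_of_nat
  have hk : ∀ n, Continuous (k n) := fun n =>
    continuous_const.div (by fun_prop) fun x => (hpos n x).ne'
  refine ⟨fun n x => 1 - k n x * g x, fun n => continuous_const.sub ((hk n).mul hg),
    fun u => ?_⟩
  have hkg : ∀ n x, 0 ≤ k n x * g x ∧ k n x * g x ≤ 1 := by
    intro n x
    simp only [hkdef]
    rw [div_mul_eq_mul_div, one_mul]
    exact ⟨div_nonneg (hg0 x) (hpos n x).le, (div_le_one (hpos n x)).2 (le_max_left _ _)⟩
  have e : ∀ n, cfc (fun x => 1 - k n x * g x) A = 1 - cfc (k n) A * cfc g A := by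
    intro n
    rw [cfc_sub (fun _ => 1) (fun x => k n x * g x) A continuousOn_const
      ((hk n).mul hg).continuousOn, cfc_const_one ℝ A,
      cfc_mul (k n) g A (hk n).continuousOn hg.continuousOn]
  have hker : ∀ v ∈ (cfc g A).ker, ∀ n, cfc (fun x => 1 - k n x * g x) A v = v := by
    intro v hv n
    rw [LinearMap.mem_ker, ContinuousLinearMap.coe_coe] at hv
    rw [e]
    simp [hv]
  have hnorm : ∀ n, ‖cfc (fun x => 1 - k n x * g x) A‖ ≤ 1 := fun n =>
    norm_cfc_le zero_le_one fun x _ => by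
      rw [Real.norm_eq_abs, abs_le]; constructor <;> linarith [(hkg n x).1, (hkg n x).2]
  have hrange : ∀ w, Tendsto (fun n => cfc (fun x => 1 - k n x * g x) A (cfc g A w)) atTop
      (𝓝 0) := by
    intro w
    have hb : ∀ n : ℕ, ‖cfc (fun x => 1 - k n x * g x) A * cfc g A‖ ≤ 1 / ((n : ℝ) + 1) := by
      intro n
      rw [← cfc_mul (fun x => 1 - k n x * g x) g A
        (continuous_const.sub ((hk n).mul hg)).continuousOn hg.continuousOn]
      refine norm_cfc_le (by positivity) fun x _ => ?_
      rw [Real.norm_of_nonneg (mul_nonneg (by linarith [(hkg n x).2]) (hg0 x))]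
      rcases le_total (g x) (1 / ((n : ℝ) + 1)) with h | h
      · calc _ ≤ 1 * g x := mul_le_mul_of_nonneg_right (by linarith [(hkg n x).1]) (hg0 x)
          _ ≤ _ := by linarith
      · have : k n x * g x = 1 := by
          simp only [hkdef]
          rw [max_eq_left h, one_div_mul_cancel]
          exact (lt_of_lt_of_le (by positivity) h).ne'
        rw [this, sub_self, zero_mul]; positivity
    have h0 : Tendsto (fun n : ℕ => 1 / ((n : ℝ) + 1) * ‖w‖) atTop (𝓝 0) := by
      simpa using tendsto_one_div_add_atTop_nhds_zero_nat.mul_const ‖w‖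
    exact squeeze_zero_norm (fun n => ContinuousLinearMap.le_of_opNorm_le _ (hb n) w) h0
  -- As g(A) is self-adjoint, the complement of its kernel is the closure of its range; the uniform
  -- bound `hnorm` extends the convergence to that closure.
  have hclos : ∀ w ∈ (cfc g A).kerᗮ,
      Tendsto (fun n => cfc (fun x => 1 - k n x * g x) A w) atTop (𝓝 0) := by
    intro w hw
    have hsa : ContinuousLinearMap.adjoint (cfc g A) = cfc g A := by
      rw [← ContinuousLinearMap.star_eq_adjoint]
      exact (cfc_predicate g A : IsSelfAdjoint _).star_eq
    have hw' : w ∈ closure ((cfc g A).range : Set E) := by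
      rw [← Submodule.topologicalClosure_coe]
      have := ContinuousLinearMap.orthogonal_ker (cfc g A)
      rw [hsa] at this
      rw [← this]; exact hw
    rw [Metric.tendsto_atTop]
    intro ε hε
    obtain ⟨_, ⟨z, rfl⟩, hz⟩ := Metric.mem_closure_iff.1 hw' (ε / 2) (by positivity)
    obtain ⟨M, hM⟩ := Metric.tendsto_atTop.1 (hrange z) (ε / 2) (by positivity)
    refine ⟨M, fun n hn => ?_⟩
    have h1 := hM n hn
    rw [dist_zero_right] at h1 ⊢
    rw [dist_eq_norm] at hz
    have h2 := ContinuousLinearMap.le_of_opNorm_le _ (hnorm n) (w - cfc g A z)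
    rw [map_sub] at h2
    have h3 := norm_sub_norm_le (cfc (fun x => 1 - k n x * g x) A w)
      (cfc (fun x => 1 - k n x * g x) A (cfc g A z))
    simp only [ContinuousLinearMap.coe_coe] at hz
    linarith
  have hsplit : ∀ n, cfc (fun x => 1 - k n x * g x) A u = spectralProjectionIic μ A u +
      cfc (fun x => 1 - k n x * g x) A (u - spectralProjectionIic μ A u) := by
    intro n
    rw [map_sub, hker (spectralProjectionIic μ A u) (Submodule.starProjection_apply_mem _ _)]
    abel
  simp_rw [hsplit]
  have h := (hclos _ (Submodule.sub_starProjection_mem_orthogonal u)).const_add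
    (spectralProjectionIic μ A u)
  rw [add_zero] at h
  exact h

end FunctionalCalculus

end HartreeNESS

namespace HartreeNESS

/-! ### Spectral measures and the absolutely continuous subspace -/

section SpectralMeasure

variable {E : Type*} [NormedAddCommGroup E] [InnerProductSpace ℂ E] [CompleteSpace E]

theorem inner_apply_self_eq_re {T : E →L[ℂ] E} (hT : IsSelfAdjoint T) (x : E) :
    ⟪x, T x⟫_ℂ = (((⟪x, T x⟫_ℂ).re : ℝ) : ℂ) := by
  refine (Complex.conj_eq_iff_re.1 ?_).symm
  rw [inner_conj_symm, ← ContinuousLinearMap.adjoint_inner_right,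
    ← ContinuousLinearMap.star_eq_adjoint, hT.star_eq]

/-- The positive functional `f ↦ ⟪ψ, f(A) ψ⟫` on continuous functions on the spectrum. -/
noncomputable def spectralFunctional {A : E →L[ℂ] E} (hA : IsSelfAdjoint A) (ψ : E) :
    CompactlySupportedContinuousMap (spectrum ℝ A) ℝ →ₚ[ℝ] ℝ :=
  PositiveLinearMap.mk₀
    { toFun := fun f => (⟪ψ, cfcHom (R := ℝ) hA f.toContinuousMap ψ⟫_ℂ).re
      map_add' := fun f g => by
        have : (f + g).toContinuousMap = f.toContinuousMap + g.toContinuousMap := rfl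
        rw [this, map_add, add_apply, inner_add_right, Complex.add_re]
      map_smul' := fun c f => by
        have : (c • f).toContinuousMap = c • f.toContinuousMap := rfl
        rw [this, map_smul]
        simp [← Complex.coe_smul] }
    (fun f hf => by
      have h1 : 0 ≤ cfcHom (R := ℝ) hA f.toContinuousMap :=
        (cfcHom_nonneg_iff hA).2 (fun x => hf x)
      rw [ContinuousLinearMap.nonneg_iff_isPositive] at h1
      exact (RCLike.nonneg_iff.1 (h1.inner_nonneg_right ψ)).1)

/-- Riesz–Markov–Kakutani on the compact spectrum, pushed forward to the line. -/
theorem exists_spectralMeasure {A : E →L[ℂ] E} (hA : IsSelfAdjoint A) (ψ : E) :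
    ∃ m : Measure ℝ, IsFiniteMeasure m ∧ ∀ f : ℝ → ℝ, Continuous f →
      Integrable f m ∧ ⟪ψ, cfc f A ψ⟫_ℂ = ((∫ x, f x ∂m : ℝ) : ℂ) := by
  have : CompactSpace (spectrum ℝ A) :=
    isCompact_iff_compactSpace.1 (ContinuousFunctionalCalculus.isCompact_spectrum (R := ℝ) A)
  refine ⟨(RealRMK.rieszMeasure (spectralFunctional hA ψ)).map Subtype.val,
    inferInstance, fun f hf => ?_⟩
  let g : CompactlySupportedContinuousMap (spectrum ℝ A) ℝ :=
    { toFun := fun x => f x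
      continuous_toFun := by fun_prop
      hasCompactSupport' := HasCompactSupport.of_compactSpace _ }
  have hme : MeasurableEmbedding (Subtype.val : spectrum ℝ A → ℝ) :=
    MeasurableEmbedding.subtype_coe
      (ContinuousFunctionalCalculus.isCompact_spectrum (R := ℝ) A).isClosed.measurableSet
  constructor
  · rw [hme.integrable_map_iff]
    exact CompactlySupportedContinuousMap.integrable g
  · rw [hme.integral_map]
    have h := RealRMK.integral_rieszMeasure (spectralFunctional hA ψ) g
    change ∫ x : spectrum ℝ A, f x ∂_ = _ at h
    rw [h, inner_apply_self_eq_re (cfc_predicate f A)]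
    congr 2
    rw [cfc_apply f A hA hf.continuousOn]
    rfl

/-- The exponential is split into real functions because the spectral measure is only tested against
real functions. -/
theorem unitaryGroup_eq_cfc {A : E →L[ℂ] E} (hA : IsSelfAdjoint A) (t : ℝ) :
    unitaryGroup A t =
      cfc (fun x : ℝ => Real.cos (t * x)) A + Complex.I • cfc (fun x : ℝ => Real.sin (t * x)) A := by
  have hn : IsStarNormal ((Complex.I * (t : ℂ)) • A) := by
    have := hA.isStarNormal
    infer_instance
  unfold unitaryGroup
  rw [← CFC.complex_exp_eq_normedSpace_exp hn,
    ← cfc_comp_const_mul (Complex.I * (t : ℂ)) Complex.exp A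
      Complex.continuous_exp.continuousOn hA.isStarNormal,
    cfc_real_eq_complex _ hA, cfc_real_eq_complex _ hA,
    ← cfc_const_mul Complex.I _ A (by fun_prop), ← cfc_add A _ _ (by fun_prop) (by fun_prop)]
  refine cfc_congr fun x hx => ?_
  have hx' : x = (x.re : ℂ) := IsSelfAdjoint.mem_spectrum_eq_re hA hx
  generalize x.re = r at hx'
  subst hx'
  push_cast [Complex.ofReal_re]
  rw [mul_comm Complex.I (Complex.sin _), ← Complex.exp_mul_I]
  congr 1
  ring

theorem inner_unitaryGroup_eq_integral {A : E →L[ℂ] E} (hA : IsSelfAdjoint A) {ψ : E}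
    {m : Measure ℝ} [IsFiniteMeasure m] (hm : ∀ f : ℝ → ℝ, Continuous f →
      Integrable f m ∧ ⟪ψ, cfc f A ψ⟫_ℂ = ((∫ x, f x ∂m : ℝ) : ℂ)) (t : ℝ) :
    ⟪ψ, unitaryGroup A t ψ⟫_ℂ = ∫ x, Complex.exp (t * x * Complex.I) ∂m := by
  have hc := hm (fun x => Real.cos (t * x)) (by fun_prop)
  have hs := hm (fun x => Real.sin (t * x)) (by fun_prop)
  rw [unitaryGroup_eq_cfc hA, add_apply, inner_add_right, hc.2,
    smul_apply, inner_smul_right, hs.2, ← integral_complex_ofReal,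
    ← integral_complex_ofReal, ← integral_const_mul, ← integral_add hc.1.ofReal
    (hs.1.ofReal.const_mul _)]
  refine integral_congr_ae (Eventually.of_forall fun x => ?_)
  simp only
  rw [Complex.exp_mul_I]
  push_cast
  ring

/-- A measure whose mass on every interval is at most a constant times its length is absolutely
continuous. -/
theorem absolutelyContinuous_of_Ioc_le {m : Measure ℝ} {C : ℝ≥0∞} (hC : C ≠ ∞)
    (h : ∀ a b, m (Set.Ioc a b) ≤ C * ENNReal.ofReal (b - a)) : m ≪ (volume : Measure ℝ) := by
  intro s hs
  rw [Real.volume_eq_stieltjes_id, StieltjesFunction.measure] at hs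
  have h0 : StieltjesFunction.id.outer s = 0 := hs
  have hC0 : C + 1 ≠ 0 := by simp
  have hCt : C + 1 ≠ ∞ := by simp [hC]
  -- Lebesgue outer measure is the largest outer measure bounded by interval length, so it is enough
  -- to compare on sets covered by one interval. The constant C + 1 is invertible even if C = 0.
  have hle : (C + 1)⁻¹ • m.toOuterMeasure ≤ StieltjesFunction.id.outer := by
    refine OuterMeasure.le_ofFunction.2 fun u => ?_
    rw [StieltjesFunction.length_eq]
    refine le_iInf fun a => le_iInf fun b => le_iInf fun hab => ?_
    have hbot : u ⊆ Set.Ioc a b := fun x hx =>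
      hab ⟨hx, fun hb : IsBot x => absurd (hb (x - 1)) (by simp)⟩
    change (C + 1)⁻¹ * m u ≤ _
    rw [ENNReal.inv_mul_le_iff hC0 hCt]
    refine (measure_mono hbot).trans ((h a b).trans ?_)
    exact mul_le_mul_left le_self_add _
  have h1 : (C + 1)⁻¹ * m s ≤ 0 := h0 ▸ hle s
  rw [ENNReal.inv_mul_le_iff hC0 hCt, mul_zero] at h1
  exact le_antisymm h1 bot_le

/-- A finite measure with integrable characteristic function is absolutely continuous. -/
theorem absolutelyContinuous_of_integrable_fourier {m : Measure ℝ} [IsFiniteMeasure m]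
    (h : Integrable fun t : ℝ => ∫ x, Complex.exp (t * x * Complex.I) ∂m) :
    m ≪ (volume : Measure ℝ) := by
  set φ : ℝ → ℂ := fun t => ∫ x, Complex.exp (t * x * Complex.I) ∂m with hφ
  set K : ℝ := ∫ t, ‖φ t‖ with hK
  have hK0 : 0 ≤ K := integral_nonneg fun _ => norm_nonneg _
  -- The Gaussian of width ε around a is, as a function of x - a, the characteristic function of a
  -- centred Gaussian of variance 1 / ε², whose density is at most ε. By Fubini its m-integral is an
  -- integral of the Fourier transform φ against that density, up to a phase.
  have key : ∀ (a : ℝ) (ε : ℝ), 0 < ε →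
      ∫ x, Real.exp (-((x - a) ^ 2 / (2 * ε ^ 2))) ∂m ≤ ε * K := by
    intro a ε hε
    set v : ℝ≥0 := ⟨(ε ^ 2)⁻¹, by positivity⟩ with hv
    have hv0 : v ≠ 0 := by
      rw [← NNReal.coe_ne_zero]
      change (ε ^ 2)⁻¹ ≠ 0
      positivity
    have hchar : ∀ x : ℝ, ((Real.exp (-((x - a) ^ 2 / (2 * ε ^ 2))) : ℝ) : ℂ) =
        ∫ t, Complex.exp ((x - a : ℝ) * t * Complex.I) ∂(ProbabilityTheory.gaussianReal 0 v) := by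
      intro x
      rw [← charFun_apply_real, ProbabilityTheory.charFun_gaussianReal]
      push_cast
      congr 1
      rw [show ((v : ℝ) : ℂ) = ((ε : ℂ) ^ 2)⁻¹ by rw [show (v : ℝ) = (ε ^ 2)⁻¹ from rfl]; push_cast; rfl]
      field_simp
      ring
    have hint : Integrable (Function.uncurry fun (x t : ℝ) =>
        Complex.exp ((x - a : ℝ) * t * Complex.I))
        (m.prod (ProbabilityTheory.gaussianReal 0 v)) := by
      refine Integrable.of_bound (C := 1) ?_ (Eventually.of_forall fun p => ?_)
      · refine Continuous.aestronglyMeasurable ?_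
        simp only [Function.uncurry_def]
        fun_prop
      · simp only [Function.uncurry_def]
        rw [← Complex.ofReal_mul, Complex.norm_exp_ofReal_mul_I]
    have hsw : ((∫ x, Real.exp (-((x - a) ^ 2 / (2 * ε ^ 2))) ∂m : ℝ) : ℂ) =
        ∫ t, Complex.exp (-(a * t * Complex.I)) * φ t ∂(ProbabilityTheory.gaussianReal 0 v) := by
      rw [← integral_complex_ofReal]
      simp_rw [hchar]
      rw [integral_integral_swap hint]
      refine integral_congr_ae (Eventually.of_forall fun t => ?_)
      simp only [hφ]
      rw [← integral_const_mul]
      refine integral_congr_ae (Eventually.of_forall fun x => ?_)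
      simp only
      rw [← Complex.exp_add]
      congr 1
      push_cast
      ring
    have hnn : 0 ≤ ∫ x, Real.exp (-((x - a) ^ 2 / (2 * ε ^ 2))) ∂m :=
      integral_nonneg fun _ => (Real.exp_pos _).le
    have hnorm := congrArg norm hsw
    rw [Complex.norm_real, Real.norm_of_nonneg hnn] at hnorm
    rw [hnorm, ProbabilityTheory.integral_gaussianReal_eq_integral_smul hv0]
    calc _ ≤ ∫ t, ‖ProbabilityTheory.gaussianPDFReal 0 v t •
          (Complex.exp (-(a * t * Complex.I)) * φ t)‖ := norm_integral_le_integral_norm _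
      _ ≤ ∫ t, ε * ‖φ t‖ := by
        refine integral_mono_of_nonneg (Eventually.of_forall fun _ => norm_nonneg _)
          (h.norm.const_mul _) (Eventually.of_forall fun t => ?_)
        simp only
        rw [norm_smul, norm_mul]
        have e1 : ‖Complex.exp (-(a * t * Complex.I))‖ = 1 := by
          rw [← neg_mul, ← Complex.ofReal_mul, ← Complex.ofReal_neg, Complex.norm_exp_ofReal_mul_I]
        rw [e1, one_mul]
        refine mul_le_mul_of_nonneg_right ?_ (norm_nonneg _)
        rw [Real.norm_of_nonneg (ProbabilityTheory.gaussianPDFReal_nonneg 0 v t),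
          ProbabilityTheory.gaussianPDFReal]
        have e2 : (√(2 * Real.pi * v))⁻¹ ≤ ε := by
          rw [inv_le_comm₀ (by positivity) hε]
          refine Real.le_sqrt_of_sq_le ?_
          rw [show (v : ℝ) = (ε ^ 2)⁻¹ from rfl, inv_pow]
          have : 0 < (ε ^ 2)⁻¹ := by positivity
          nlinarith [Real.pi_gt_three]
        calc _ ≤ (√(2 * Real.pi * v))⁻¹ * 1 := by
              gcongr
              rw [Real.exp_le_one_iff, neg_div]
              exact neg_nonpos.2 (by positivity)
          _ ≤ ε := by rw [mul_one]; exact e2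
      _ = ε * K := integral_const_mul _ _
  refine absolutelyContinuous_of_Ioc_le (C := ENNReal.ofReal (Real.exp (1 / 2) * K))
    ENNReal.ofReal_ne_top fun a b => ?_
  rcases le_or_gt b a with hab | hab
  · simp [Set.Ioc_eq_empty_of_le hab]
  have hε : 0 < b - a := sub_pos.2 hab
  have hb := key a (b - a) hε
  have hi : Integrable (fun x => Real.exp (-((x - a) ^ 2 / (2 * (b - a) ^ 2)))) m := by
    refine Integrable.of_bound (C := 1) (Continuous.aestronglyMeasurable (by fun_prop))
      (Eventually.of_forall fun x => ?_)
    rw [Real.norm_of_nonneg (Real.exp_pos _).le, Real.exp_le_one_iff]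
    exact neg_nonpos.2 (by positivity)
  -- With ε = b - a the Gaussian is at least e^{-1/2} on (a, b], so the bound above controls the
  -- mass of the interval by its length.
  have hm : m.real (Set.Ioc a b) * Real.exp (-(1 / 2)) ≤ (b - a) * K := by
    refine le_trans ?_ hb
    calc m.real (Set.Ioc a b) * Real.exp (-(1 / 2))
        = ∫ x in Set.Ioc a b, Real.exp (-(1 / 2)) ∂m := by simp
      _ ≤ ∫ x in Set.Ioc a b, Real.exp (-((x - a) ^ 2 / (2 * (b - a) ^ 2))) ∂m := by
        refine setIntegral_mono_on (integrable_const _).integrableOn hi.integrableOn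
          measurableSet_Ioc fun x hx => ?_
        refine Real.exp_le_exp.2 (neg_le_neg ?_)
        rw [div_le_iff₀ (by positivity)]
        nlinarith [hx.1, hx.2]
      _ ≤ _ := setIntegral_le_integral hi (Eventually.of_forall fun _ => (Real.exp_pos _).le)
  have hm' : m.real (Set.Ioc a b) ≤ Real.exp (1 / 2) * K * (b - a) := by
    have := mul_le_mul_of_nonneg_right hm (Real.exp_pos (1 / 2)).le
    rw [mul_assoc, ← Real.exp_add, neg_add_cancel, Real.exp_zero, mul_one] at this
    linarith
  rw [← ENNReal.ofReal_mul (by positivity), ← ofReal_measureReal]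
  exact ENNReal.ofReal_le_ofReal hm'

/-- The return amplitude is the Fourier transform of the spectral measure. -/
theorem mem_acVectors_of_integrable {A : E →L[ℂ] E} (hA : IsSelfAdjoint A) {ψ : E}
    (h : Integrable fun t : ℝ => ⟪ψ, unitaryGroup A t ψ⟫_ℂ) : ψ ∈ acVectors A := by
  obtain ⟨m, hfin, hm⟩ := exists_spectralMeasure hA ψ
  refine ⟨m, hfin, absolutelyContinuous_of_integrable_fourier ?_, fun f => (hm f f.continuous).2⟩
  simpa only [← inner_unitaryGroup_eq_integral hA hm] using h

/-- Absolutely continuous vectors are orthogonal to eigenvectors. -/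
theorem inner_eq_zero_of_mem_acVectors {A : E →L[ℂ] E} (hA : IsSelfAdjoint A) {ψ : E}
    (h : ψ ∈ acVectors A) {v : E} (hv : A v = 0) : ⟪v, ψ⟫_ℂ = 0 := by
  obtain ⟨m, hfin, hac, hm⟩ := h
  have hm0 : m {0} = 0 := hac (by simp)
  -- These Gaussians equal 1 at 0, so g n (A) fixes v, and they decrease to the indicator of {0},
  -- which is null for the spectral measure of ψ. Hence ⟪v, ψ⟫ = ⟪v, g n (A) ψ⟫ is bounded by
  -- quantities tending to zero.
  set g : ℕ → ℝ → ℝ := fun n x => Real.exp (-(n * x ^ 2)) with hg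
  have hgc : ∀ n, Continuous (g n) := fun n => by fun_prop
  have hg1 : ∀ n x, g n x ≤ 1 := fun n x =>
    Real.exp_le_one_iff.2 (neg_nonpos.2 (by positivity))
  have hg0 : ∀ n x, 0 ≤ g n x := fun n x => (Real.exp_pos _).le
  have hv' : ∀ n, cfc (g n) A v = v := by
    intro n
    -- The equation A v = 0 is read as an intertwining of A with the zero operator on ℂ through c ↦
    -- c • v.
    have h1 := cfc_intertwine hA (IsSelfAdjoint.zero (ℂ →L[ℂ] ℂ))
      (W := ContinuousLinearMap.toSpanSingleton ℂ v) (by ext; simp [hv]) (hgc n)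
    have h2 := congrArg (fun T : ℂ →L[ℂ] E => T 1) h1
    simpa [cfc_apply_zero, hg] using h2
  have hsa : ∀ n, IsSelfAdjoint (cfc (g n) A) := fun n => cfc_predicate (g n) A
  have hbd : ∀ n, ‖⟪v, ψ⟫_ℂ‖ ^ 2 ≤ ‖v‖ ^ 2 * ∫ x, g n x ^ 2 ∂m := by
    intro n
    have h1 : ⟪v, ψ⟫_ℂ = ⟪v, cfc (g n) A ψ⟫_ℂ := by
      rw [← ContinuousLinearMap.adjoint_inner_left, ← ContinuousLinearMap.star_eq_adjoint,
        (hsa n).star_eq, hv']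
    let F : BoundedContinuousFunction ℝ ℝ := BoundedContinuousFunction.ofNormedAddCommGroup
      (fun x => g n x ^ 2) ((hgc n).pow 2) 1 fun x => by
        rw [Real.norm_of_nonneg (by positivity)]
        exact pow_le_one₀ (hg0 n x) (hg1 n x)
    have h2 := hm F
    have h3 : cfc (fun x => F x) A = cfc (g n) A * cfc (g n) A := by
      rw [← cfc_mul (g n) (g n) A (hgc n).continuousOn (hgc n).continuousOn]
      congr 1
      funext x
      exact sq _
    have h4 : ((‖cfc (g n) A ψ‖ ^ 2 : ℝ) : ℂ) = ((∫ x, g n x ^ 2 ∂m : ℝ) : ℂ) := by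
      rw [h3, mul_apply_eq_comp, ← ContinuousLinearMap.adjoint_inner_left,
        ← ContinuousLinearMap.star_eq_adjoint, (hsa n).star_eq, inner_self_eq_norm_sq_to_K] at h2
      rw [Complex.ofReal_pow]
      exact h2
    rw [← Complex.ofReal_injective h4, h1, ← mul_pow]
    exact pow_le_pow_left₀ (norm_nonneg _) (norm_inner_le_norm _ _) 2
  have hlim : Tendsto (fun n => ∫ x, g n x ^ 2 ∂m) atTop (𝓝 (∫ x, (0 : ℝ) ∂m)) := by
    refine tendsto_integral_of_dominated_convergence (fun _ => 1)
      (fun n => ((hgc n).pow 2).aestronglyMeasurable) (integrable_const _)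
      (fun n => Eventually.of_forall fun x => ?_) ?_
    · rw [Real.norm_of_nonneg (by positivity)]
      exact pow_le_one₀ (hg0 n x) (hg1 n x)
    · have hne : ∀ᵐ x ∂m, x ≠ 0 := by
        rw [ae_iff]; simpa using hm0
      filter_upwards [hne] with x hx
      have h1 : Tendsto (fun n : ℕ => (n : ℝ) * x ^ 2) atTop atTop :=
        tendsto_natCast_atTop_atTop.atTop_mul_const (by positivity)
      simpa using ((Real.tendsto_exp_atBot.comp (tendsto_neg_atTop_atBot.comp h1)).pow 2)
  have h0 := ge_of_tendsto' (hlim.const_mul (‖v‖ ^ 2)) hbd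
  simp only [integral_zero, mul_zero] at h0
  have := pow_eq_zero_iff (two_ne_zero) |>.1 (le_antisymm h0 (by positivity))
  exact norm_eq_zero.1 this

end SpectralMeasure

end HartreeNESS

namespace HartreeNESS

/-! ### The free dynamics on a lead -/

section FreeLead

open Polynomial

/-- The discrete Laplacian on the half-line with unit hopping constant. -/
noncomputable def halfLineLaplacian : Lead →L[ℂ] Lead := leftShift + rightShift

/-- The standard basis of `ℓ²(ℕ)`. -/
noncomputable def siteVec (n : ℕ) : Lead := lp.single 2 n (1 : ℂ)

theorem dirichletLaplacian_eq (tc : ℝ) :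
    dirichletLaplacian tc = (tc : ℂ) • halfLineLaplacian := rfl

theorem halfLineLaplacian_apply_succ (ψ : Lead) (n : ℕ) :
    halfLineLaplacian ψ (n + 1) = ψ (n + 2) + ψ n := by
  have := dirichletLaplacian_apply_succ 1 ψ n
  simpa [dirichletLaplacian_eq] using this

theorem halfLineLaplacian_apply_zero (ψ : Lead) : halfLineLaplacian ψ 0 = ψ 1 := by
  have := dirichletLaplacian_apply_zero 1 ψ
  simpa [dirichletLaplacian_eq] using this

theorem siteVec_apply (n m : ℕ) : siteVec n m = if m = n then 1 else 0 := by
  simp [siteVec, lp.single_apply, Pi.single_apply]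

theorem inner_siteVec_left (n : ℕ) (ψ : Lead) : ⟪siteVec n, ψ⟫_ℂ = ψ n := by
  simp [siteVec, lp.inner_single_left]

theorem leftShift_apply (ψ : Lead) (n : ℕ) : leftShift ψ n = ψ (n + 1) := rfl

theorem rightShift_apply (ψ : Lead) (n : ℕ) :
    rightShift ψ n = if n = 0 then 0 else ψ (n - 1) := rfl

theorem inner_leftShift (x y : Lead) : ⟪leftShift x, y⟫_ℂ = ⟪x, rightShift y⟫_ℂ := by
  rw [lp.inner_eq_tsum, lp.inner_eq_tsum, 
    (lp.summable_inner (𝕜 := ℂ) (G := fun _ : ℕ => ℂ) x (rightShift y)).tsum_eq_zero_add]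
  simp [leftShift_apply, rightShift_apply]

theorem isSelfAdjoint_halfLineLaplacian : IsSelfAdjoint halfLineLaplacian := by
  rw [ContinuousLinearMap.isSelfAdjoint_iff_isSymmetric]
  intro x y
  simp only [halfLineLaplacian, ContinuousLinearMap.coe_coe, add_apply,
    inner_add_left, inner_add_right]
  have h : ⟪rightShift x, y⟫_ℂ = ⟪x, leftShift y⟫_ℂ := by
    rw [← inner_conj_symm, ← inner_leftShift, inner_conj_symm]
  rw [inner_leftShift, h, add_comm (G := ℂ)]

theorem isSelfAdjoint_dirichletLaplacian (tc : ℝ) : IsSelfAdjoint (dirichletLaplacian tc) := by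
  rw [dirichletLaplacian_eq]
  exact IsSelfAdjoint.smul (by rw [isSelfAdjoint_iff]; simp) isSelfAdjoint_halfLineLaplacian

theorem halfLineLaplacian_siteVec_zero : halfLineLaplacian (siteVec 0) = siteVec 1 := by
  ext n
  cases n with
  | zero => simp [halfLineLaplacian_apply_zero, siteVec_apply]
  | succ n => simp [halfLineLaplacian_apply_succ, siteVec_apply]

theorem halfLineLaplacian_siteVec_succ (m : ℕ) :
    halfLineLaplacian (siteVec (m + 1)) = siteVec (m + 2) + siteVec m := by
  ext n
  cases n with
  | zero => simp [halfLineLaplacian_apply_zero, siteVec_apply, eq_comm]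
  | succ n =>
    rw [halfLineLaplacian_apply_succ, lp.coeFn_add, Pi.add_apply]
    simp only [siteVec_apply, add_left_inj, add_comm]
    congr 1
    exact if_congr (by omega) rfl rfl

/-- The rescaled Chebyshev recursion S_{n+2} = X S_{n+1} - S_n is exactly the action of the
half-line Laplacian on sites. So δ₀ is cyclic, and the S_n are orthonormal for its spectral measure,
the semicircle law. -/
theorem aeval_S_siteVec (n : ℕ) :
    aeval halfLineLaplacian (Chebyshev.S ℂ n) (siteVec 0) = siteVec n := by
  induction n using Nat.twoStepInduction with
  | zero => simp
  | one => simpa using halfLineLaplacian_siteVec_zero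
  | more n h0 h1 =>
    push_cast at h1 ⊢
    rw [Chebyshev.S_add_two, map_sub, map_mul, aeval_X, sub_apply, mul_apply_eq_comp, h1, h0,
      halfLineLaplacian_siteVec_succ, add_sub_cancel_right]

theorem S_mem_span (q : ℂ[X]) :
    q ∈ Submodule.span ℂ (Set.range fun n : ℕ => Chebyshev.S ℂ n) := by
  have hX : ∀ p ∈ Submodule.span ℂ (Set.range fun n : ℕ => Chebyshev.S ℂ (n : ℤ)),
      X * p ∈ Submodule.span ℂ (Set.range fun n : ℕ => Chebyshev.S ℂ (n : ℤ)) := by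
    intro p hp
    induction hp using Submodule.span_induction with
    | mem p hp =>
      obtain ⟨n, rfl⟩ := hp
      cases n with
      | zero =>
        refine Submodule.subset_span ⟨1, by simp⟩
      | succ n =>
        have : X * Chebyshev.S ℂ ((n + 1 : ℕ) : ℤ) =
            Chebyshev.S ℂ ((n + 2 : ℕ) : ℤ) + Chebyshev.S ℂ (n : ℤ) := by
          push_cast
          rw [Chebyshev.S_add_two]; ring
        simp only
        rw [this]
        exact add_mem (Submodule.subset_span ⟨n + 2, rfl⟩) (Submodule.subset_span ⟨n, rfl⟩)
    | zero => simp
    | add p q _ _ hp hq => rw [mul_add]; exact add_mem hp hq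
    | smul c p _ hp => rw [mul_smul_comm]; exact Submodule.smul_mem _ c hp
  induction q using Polynomial.induction_on with
  | C a =>
    have : (C a : ℂ[X]) = a • Chebyshev.S ℂ ((0 : ℕ) : ℤ) := by simp [smul_eq_C_mul]
    rw [this]
    exact Submodule.smul_mem _ _ (Submodule.subset_span ⟨0, rfl⟩)
  | add p q hp hq => exact add_mem hp hq
  | monomial n a h =>
    have : (C a * X ^ (n + 1) : ℂ[X]) = X * (C a * X ^ n) := by ring
    rw [this]
    exact hX _ h

/-- With X = 2 cos θ and S_n = sin((n+1)θ) / sin θ this is a trigonometric identity; here it follows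
from the three-term recursion. It lets integration by parts be checked purely algebraically. -/
theorem four_sub_sq_mul_derivative_S (n : ℕ) :
    (4 - X ^ 2) * derivative (Chebyshev.S ℂ n) =
      ((n : ℂ[X]) + 2) * Chebyshev.S ℂ (n - 1) - (n : ℂ[X]) * Chebyshev.S ℂ (n + 1) := by
  induction n using Nat.twoStepInduction with
  | zero => simp
  | one =>
    push_cast
    rw [Chebyshev.S_two,
      Chebyshev.S_zero, Chebyshev.S_one]
    simp
    ring
  | more n h0 h1 =>
    have e1 := Chebyshev.S_add_two ℂ ((n : ℤ) + 1)
    have e2 := Chebyshev.S_add_two ℂ (n : ℤ)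
    have e3 := Chebyshev.S_add_one ℂ (n : ℤ)
    push_cast at h0 h1 ⊢
    rw [show (n : ℤ) + 1 + 2 = n + 2 + 1 by ring, show (n : ℤ) + 1 + 1 = n + 2 by ring] at e1
    rw [show (n : ℤ) + 1 + 1 = n + 2 by ring, show (n : ℤ) + 1 - 1 = n by ring] at h1
    rw [show (n : ℤ) + 2 - 1 = n + 1 by ring]
    rw [Chebyshev.S_add_two, derivative_sub, derivative_mul, derivative_X]
    linear_combination X * h1 - h0 + ((n : ℂ[X]) + 2) * e1 + X * e2 - ((n : ℂ[X]) + 2) * e3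

/-- The functional `q ↦ ⟪δ₀, q(h) δ₀⟫`. -/
noncomputable def vacuum : ℂ[X] →ₗ[ℂ] ℂ where
  toFun q := ⟪siteVec 0, aeval halfLineLaplacian q (siteVec 0)⟫_ℂ
  map_add' p q := by simp
  map_smul' c q := by simp

theorem vacuum_S (n : ℕ) : vacuum (Chebyshev.S ℂ n) = if n = 0 then 1 else 0 := by
  change ⟪siteVec 0, aeval halfLineLaplacian (Chebyshev.S ℂ n) (siteVec 0)⟫_ℂ = _
  rw [aeval_S_siteVec, inner_siteVec_left, siteVec_apply]
  simp [eq_comm]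

/-- Integration by parts for the semicircle law. -/
theorem vacuum_four_sub_sq_mul_derivative (q : ℂ[X]) :
    vacuum ((4 - X ^ 2) * derivative q) = vacuum (3 * X * q) := by
  let T : ℂ[X] →ₗ[ℂ] ℂ := vacuum ∘ₗ
    (LinearMap.mulLeft ℂ (4 - X ^ 2) ∘ₗ derivative - LinearMap.mulLeft ℂ (3 * X))
  suffices h : T q = 0 by
    have : T q = vacuum ((4 - X ^ 2) * derivative q) - vacuum (3 * X * q) := by simp [T, mul_assoc]
    rw [this] at h
    exact sub_eq_zero.1 h
  induction S_mem_span q using Submodule.span_induction with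
  | mem p hp =>
    obtain ⟨n, rfl⟩ := hp
    have : T (Chebyshev.S ℂ n) = vacuum ((4 - X ^ 2) * derivative (Chebyshev.S ℂ n) -
      3 * X * Chebyshev.S ℂ n) := by simp [T, mul_assoc]
    simp only
    rw [this, four_sub_sq_mul_derivative_S]
    cases n with
    | zero =>
      have h1 := vacuum_S 1
      have e : (3 : ℂ[X]) * X * 1 = (3 : ℂ) • X := by
        rw [smul_eq_C_mul, mul_one, map_ofNat]
      simp at h1
      simp [e, h1]
    | succ n =>
      have h1 := vacuum_S (n + 2)
      have h2 := vacuum_S n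
      -- Inserting X S_{n+1} = S_{n+2} + S_n leaves n S_n - (n + 4) S_{n+2}. Only S_0 has nonzero
      -- vacuum value, and its coefficient is then n = 0.
      have e : (((n + 1 : ℕ) : ℂ[X]) + 2) * Chebyshev.S ℂ (((n + 1 : ℕ) : ℤ) - 1) -
          ((n + 1 : ℕ) : ℂ[X]) * Chebyshev.S ℂ (((n + 1 : ℕ) : ℤ) + 1) -
          3 * X * Chebyshev.S ℂ ((n + 1 : ℕ) : ℤ) =
          (n : ℂ) • Chebyshev.S ℂ (n : ℤ) - ((n : ℂ) + 4) • Chebyshev.S ℂ ((n + 2 : ℕ) : ℤ) := by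
        push_cast
        rw [show (n : ℤ) + 1 - 1 = n by ring, show (n : ℤ) + 1 + 1 = n + 2 by ring,
          Chebyshev.S_add_two]
        simp only [smul_eq_C_mul, map_add, map_natCast, map_ofNat]
        ring
      rw [e, map_sub, map_smul, map_smul, h1, h2]
      rcases Nat.eq_zero_or_pos n with rfl | hn
      · simp
      · simp [hn.ne']
  | zero => simp
  | add p q _ _ hp hq => rw [map_add, hp, hq, add_zero]
  | smul c p _ hp => rw [map_smul, hp, smul_zero]

/-- `⟪δ₀, e^{ith} q(h) δ₀⟫`. -/
noncomputable def returnAmplitude (q : ℂ[X]) (t : ℝ) : ℂ :=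
  ⟪siteVec 0, unitaryGroup halfLineLaplacian t (aeval halfLineLaplacian q (siteVec 0))⟫_ℂ

theorem hasSum_returnAmplitude (q : ℂ[X]) (t : ℝ) :
    HasSum (fun n : ℕ => ((n.factorial : ℂ)⁻¹ * (Complex.I * t) ^ n) * vacuum (X ^ n * q))
      (returnAmplitude q t) := by
  have h := NormedSpace.exp_series_hasSum_exp' (𝕂 := ℂ) ((Complex.I * (t : ℂ)) • halfLineLaplacian)
  have h2 := h.mapL ((innerSL ℂ (siteVec 0)) ∘L
    (ContinuousLinearMap.apply ℂ Lead (aeval halfLineLaplacian q (siteVec 0))))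
  refine h2.congr_fun fun n => ?_
  change _ * ⟪siteVec 0, aeval halfLineLaplacian (X ^ n * q) (siteVec 0)⟫_ℂ = _
  change _ = ⟪siteVec 0, ((n.factorial : ℂ)⁻¹ • ((Complex.I * (t : ℂ)) • halfLineLaplacian) ^ n)
    (aeval halfLineLaplacian q (siteVec 0))⟫_ℂ
  rw [_root_.smul_pow, smul_apply, smul_apply, inner_smul_right, inner_smul_right, map_mul,
    map_pow, aeval_X, mul_apply_eq_comp, mul_assoc]

/-- Integration by parts against the semicircle law applied to e^{itx} q(x): the factor it is the
derivative of the exponential. The identity is verified coefficientwise on the power series in t. -/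
theorem I_mul_returnAmplitude (q : ℂ[X]) (t : ℝ) :
    (Complex.I * t) * returnAmplitude ((4 - X ^ 2) * q) t =
      returnAmplitude (3 * X * q - (4 - X ^ 2) * derivative q) t := by
  have h1 := (hasSum_returnAmplitude ((4 - X ^ 2) * q) t).mul_left (Complex.I * t)
  have h2 := hasSum_returnAmplitude (3 * X * q - (4 - X ^ 2) * derivative q) t
  -- The factor it shifts the index by one; the constant term on the right vanishes by the
  -- integration by parts formula.
  rw [← hasSum_nat_add_iff' 1] at h2
  have h0 : vacuum (3 * X * q - (4 - X ^ 2) * derivative q) = 0 := by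
    rw [map_sub, vacuum_four_sub_sq_mul_derivative, sub_self]
  simp only [Finset.range_one, Finset.sum_singleton, pow_zero, one_mul, h0, mul_zero,
    sub_zero] at h2
  refine h1.unique (h2.congr_fun fun n => ?_)
  have e : vacuum (X ^ (n + 1) * (3 * X * q - (4 - X ^ 2) * derivative q)) =
      (n + 1 : ℂ) * vacuum (X ^ n * ((4 - X ^ 2) * q)) := by
    have h3 := vacuum_four_sub_sq_mul_derivative (X ^ (n + 1) * q)
    have e1 : X ^ (n + 1) * (3 * X * q - (4 - X ^ 2) * derivative q) =
        3 * X * (X ^ (n + 1) * q) - (4 - X ^ 2) * derivative (X ^ (n + 1) * q) +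
        (n + 1 : ℂ) • (X ^ n * ((4 - X ^ 2) * q)) := by
      rw [derivative_mul, derivative_X_pow, smul_eq_C_mul]
      simp
      ring
    rw [e1, map_add, map_sub, h3, sub_self, zero_add, map_smul, smul_eq_mul]
  rw [e, Nat.factorial_succ]
  have : (n.factorial : ℂ) ≠ 0 := by exact_mod_cast n.factorial_ne_zero
  have : (n + 1 : ℂ) ≠ 0 := by exact_mod_cast n.succ_ne_zero
  push_cast
  field_simp
  ring

theorem norm_returnAmplitude_le (q : ℂ[X]) (t : ℝ) :
    ‖returnAmplitude q t‖ ≤ ‖siteVec 0‖ * ‖aeval halfLineLaplacian q (siteVec 0)‖ := by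
  refine (norm_inner_le_norm _ _).trans ?_
  rw [norm_unitaryGroup_apply isSelfAdjoint_halfLineLaplacian]

/-- Each integration by parts consumes one factor 4 - X², which cancels the singularity at the
spectral edges, and gains one power of t. Two factors give decay t⁻², hence integrability. -/
theorem integrable_returnAmplitude (r : ℂ[X]) :
    Integrable (returnAmplitude ((4 - X ^ 2) ^ 2 * r)) := by
  -- After the first integration a factor 4 - X² survives, so a second one is possible.
  obtain ⟨r', hr'⟩ : ∃ r', 3 * X * ((4 - X ^ 2) * r) - (4 - X ^ 2) * derivative ((4 - X ^ 2) * r) =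
      (4 - X ^ 2) * r' := by
    refine ⟨3 * X * r - derivative ((4 - X ^ 2) * r), by ring⟩
  have h1 : ∀ t : ℝ, (Complex.I * t) * ((Complex.I * t) *
      returnAmplitude ((4 - X ^ 2) ^ 2 * r) t) =
      returnAmplitude (3 * X * r' - (4 - X ^ 2) * derivative r') t := by
    intro t
    rw [sq, mul_assoc (4 - X ^ 2 : ℂ[X]), I_mul_returnAmplitude, hr', I_mul_returnAmplitude]
  set C₁ := ‖siteVec 0‖ * ‖aeval halfLineLaplacian ((4 - X ^ 2) ^ 2 * r) (siteVec 0)‖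
  set C₂ := ‖siteVec 0‖ *
    ‖aeval halfLineLaplacian (3 * X * r' - (4 - X ^ 2) * derivative r') (siteVec 0)‖
  refine Integrable.mono' (integrable_inv_one_add_sq.const_mul (C₁ + C₂)) ?_
    (Eventually.of_forall fun t => ?_)
  · refine Continuous.aestronglyMeasurable ?_
    unfold returnAmplitude
    fun_prop
  · have h2 := norm_returnAmplitude_le ((4 - X ^ 2) ^ 2 * r) t
    have h3 := norm_returnAmplitude_le (3 * X * r' - (4 - X ^ 2) * derivative r') t
    rw [← h1] at h3
    simp only [norm_mul, Complex.norm_I, one_mul, Complex.norm_real, Real.norm_eq_abs] at h3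
    rw [← mul_assoc, abs_mul_abs_self] at h3
    rw [← div_eq_mul_inv, le_div_iff₀ (by positivity)]
    nlinarith

theorem star_aeval_halfLineLaplacian (p : ℂ[X]) :
    ContinuousLinearMap.adjoint (aeval halfLineLaplacian p) =
      aeval halfLineLaplacian (p.map (starRingEnd ℂ)) := by
  rw [← ContinuousLinearMap.star_eq_adjoint]
  induction p using Polynomial.induction_on' with
  | add p q hp hq => rw [map_add, star_add, hp, hq, Polynomial.map_add, map_add]
  | monomial n a =>
    rw [aeval_monomial, Polynomial.map_monomial, aeval_monomial, star_mul, star_pow,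
      isSelfAdjoint_halfLineLaplacian.star_eq, ← algebraMap_star_comm]
    exact (Algebra.commutes _ _).symm

theorem integrable_inner_unitaryGroup_halfLine (p r : ℂ[X]) :
    Integrable fun t : ℝ => ⟪aeval halfLineLaplacian p (siteVec 0),
      unitaryGroup halfLineLaplacian t
        (aeval halfLineLaplacian ((4 - X ^ 2) ^ 2 * r) (siteVec 0))⟫_ℂ := by
  have h := integrable_returnAmplitude (p.map (starRingEnd ℂ) * r)
  refine h.congr (Eventually.of_forall fun t => ?_)
  simp only [returnAmplitude]
  rw [← ContinuousLinearMap.adjoint_inner_right (aeval halfLineLaplacian p),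
    star_aeval_halfLineLaplacian, mul_left_comm, map_mul, mul_apply_eq_comp]
  have hc : Commute (aeval halfLineLaplacian (p.map (starRingEnd ℂ))) halfLineLaplacian := by
    simpa using (Commute.all (p.map (starRingEnd ℂ)) X).map (aeval halfLineLaplacian)
  have := congrArg (fun T : Lead →L[ℂ] Lead => T
    (aeval halfLineLaplacian ((4 - X ^ 2) ^ 2 * r) (siteVec 0))) (hc.unitaryGroup_right t).eq
  simp only [mul_apply_eq_comp] at this
  rw [← this]

theorem exists_aeval_of_finite_support {f : Lead} (hf : {n : ℕ | f n ≠ 0}.Finite) :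
    ∃ p : ℂ[X], f = aeval halfLineLaplacian p (siteVec 0) := by
  refine ⟨∑ n ∈ hf.toFinset, C (f n) * Chebyshev.S ℂ n, ?_⟩
  rw [map_sum, sum_apply]
  have : ∀ n : ℕ, aeval halfLineLaplacian (C (f n) * Chebyshev.S ℂ n) (siteVec 0) =
      f n • siteVec n := by
    intro n
    rw [map_mul, aeval_C, mul_apply_eq_comp, aeval_S_siteVec]
    simp [Algebra.algebraMap_eq_smul_one]
  simp_rw [this]
  ext m
  rw [lp.coeFn_sum, Finset.sum_apply]
  simp only [lp.coeFn_smul, Pi.smul_apply, siteVec_apply, smul_eq_mul, mul_ite, mul_one, mul_zero,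
    Finset.sum_ite_eq, Set.Finite.mem_toFinset, Set.mem_ofPred_eq, ne_eq, ite_not]
  split_ifs with h <;> simp [h]

theorem finite_support_aeval (p : ℂ[X]) :
    {n : ℕ | aeval halfLineLaplacian p (siteVec 0) n ≠ 0}.Finite := by
  induction S_mem_span p using Submodule.span_induction with
  | mem p hp =>
    obtain ⟨n, rfl⟩ := hp
    refine (Set.finite_singleton n).subset fun m hm => ?_
    simp only [aeval_S_siteVec, siteVec_apply, Set.mem_ofPred_eq] at hm
    by_contra h
    exact hm (if_neg h)
  | zero => simp
  | add p q _ _ hp hq =>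
    refine (hp.union hq).subset fun m hm => ?_
    by_contra h
    simp only [Set.mem_union, Set.mem_ofPred_eq, not_or, not_not] at h
    refine hm ?_
    rw [map_add, add_apply, lp.coeFn_add, Pi.add_apply, h.1, h.2, add_zero]
  | smul c p _ hp =>
    refine hp.subset fun m hm => ?_
    contrapose! hm
    simp only [Set.mem_ofPred_eq, not_not, ne_eq] at hm ⊢
    rw [map_smul, smul_apply, lp.coeFn_smul, Pi.smul_apply, hm, smul_zero]

/-- The band edges ±2 are not eigenvalues: the recursion forces |x n| = (n + 1) |x 0|, which is
unbounded unless x = 0. -/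
theorem eq_zero_of_halfLineLaplacian_eq {c : ℂ} (hc : c ^ 2 = 4) {x : Lead}
    (hx : halfLineLaplacian x = c • x) : x = 0 := by
  have hn : ∀ n : ℕ, x n = (c / 2) ^ n * (n + 1) * x 0 := by
    intro n
    induction n using Nat.twoStepInduction with
    | zero => simp
    | one =>
      have := halfLineLaplacian_apply_zero x
      rw [hx, lp.coeFn_smul, Pi.smul_apply, smul_eq_mul] at this
      rw [← this]; push_cast; ring
    | more n h0 h1 =>
      have := halfLineLaplacian_apply_succ x n
      rw [hx, lp.coeFn_smul, Pi.smul_apply, smul_eq_mul] at this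
      rw [eq_sub_of_add_eq this.symm, h0, h1]
      push_cast
      have h4 : (c / 2) ^ 2 = 1 := by rw [div_pow, hc]; norm_num
      rw [show (c / 2) ^ (n + 2) = (c / 2) ^ n by rw [pow_add, h4, mul_one]]
      have h5 : c * (c / 2) ^ (n + 1) = 2 * (c / 2) ^ n := by
        rw [pow_succ]; linear_combination (2 * (c / 2) ^ n) * h4
      linear_combination ((n : ℂ) + 1 + 1) * x 0 * h5
  have hc1 : ‖c / 2‖ = 1 := by
    have : ‖c / 2‖ ^ 2 = 1 := by rw [← norm_pow, div_pow, hc]; norm_num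
    exact (pow_eq_one_iff_of_nonneg (norm_nonneg _) two_ne_zero).1 this
  have hb : ∀ n : ℕ, ((n : ℝ) + 1) * ‖x 0‖ ≤ ‖x‖ := by
    intro n
    have h1 := lp.norm_apply_le_norm (p := 2) (by norm_num) x n
    rw [hn, norm_mul, norm_mul, norm_pow, hc1, one_pow, one_mul] at h1
    have : ‖(n : ℂ) + 1‖ = (n : ℝ) + 1 := by
      rw [← Nat.cast_succ, Complex.norm_natCast]; push_cast; rfl
    rwa [this] at h1
  have h0 : x 0 = 0 := by
    by_contra h
    have hpos : 0 < ‖x 0‖ := norm_pos_iff.2 h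
    obtain ⟨n, hn⟩ := exists_nat_gt (‖x‖ / ‖x 0‖)
    have := hb n
    rw [div_lt_iff₀ hpos] at hn
    nlinarith
  ext n
  rw [hn, h0]; simp

/-- A vector orthogonal to the range is killed by (4 - h²)², as testing with S_n reads off its n-th
component; this operator is injective because ±2 are not eigenvalues. -/
theorem dense_range_aeval_four_sub_sq :
    Dense (Set.range fun r : ℂ[X] =>
      aeval halfLineLaplacian ((4 - X ^ 2) ^ 2 * r) (siteVec 0)) := by
  let D : ℂ[X] →ₗ[ℂ] Lead :=
    { toFun := fun r => aeval halfLineLaplacian ((4 - X ^ 2) ^ 2 * r) (siteVec 0)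
      map_add' := fun p q => by simp [mul_add]
      map_smul' := fun c q => by rw [mul_smul_comm, map_smul]; rfl }
  change Dense (LinearMap.range D : Set Lead)
  rw [Submodule.dense_iff_topologicalClosure_eq_top, Submodule.topologicalClosure_eq_top_iff,
    Submodule.eq_bot_iff]
  intro x hx
  have h1 : aeval halfLineLaplacian ((4 - X ^ 2) ^ 2 : ℂ[X]) x = 0 := by
    ext n
    have h2 := hx (D (Chebyshev.S ℂ n)) ⟨_, rfl⟩
    change ⟪aeval halfLineLaplacian ((4 - X ^ 2) ^ 2 * Chebyshev.S ℂ n) (siteVec 0), x⟫_ℂ = 0 at h2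
    rw [map_mul, mul_apply_eq_comp, aeval_S_siteVec, ← ContinuousLinearMap.adjoint_inner_right,
      star_aeval_halfLineLaplacian, inner_siteVec_left] at h2
    simpa using h2
  have h3 : ∀ y, aeval halfLineLaplacian (4 - X ^ 2 : ℂ[X]) y = 0 → y = 0 := by
    intro y hy
    have e : (4 - X ^ 2 : ℂ[X]) = (C 2 - X) * (X - C (-2)) := by
      simp only [map_neg, map_ofNat]; ring
    rw [e, map_mul, mul_apply_eq_comp] at hy
    have hz := eq_zero_of_halfLineLaplacian_eq (c := 2) (by norm_num)
      (x := aeval halfLineLaplacian (X - C (-2) : ℂ[X]) y) (by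
        rw [map_sub, sub_apply, aeval_X, aeval_C, Algebra.algebraMap_eq_smul_one] at hy
        exact (sub_eq_zero.1 hy).symm)
    refine eq_zero_of_halfLineLaplacian_eq (c := -2) (by norm_num) ?_
    rw [map_sub, sub_apply, aeval_X, aeval_C, Algebra.algebraMap_eq_smul_one] at hz
    exact sub_eq_zero.1 hz
  rw [sq, map_mul, mul_apply_eq_comp] at h1
  exact h3 _ (h3 _ h1)

theorem unitaryGroup_dirichletLaplacian (tc t : ℝ) :
    unitaryGroup (dirichletLaplacian tc) t = unitaryGroup halfLineLaplacian (tc * t) := by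
  unfold unitaryGroup
  rw [dirichletLaplacian_eq, smul_smul]
  congr 2
  push_cast
  ring

/-- Dispersive estimate for the free lead: on a dense set of finitely supported vectors all
transition amplitudes to finitely supported vectors are integrable. -/
theorem exists_dense_integrable_dirichletLaplacian {tc : ℝ} (htc : 0 < tc) :
    ∃ s : Set Lead, Dense s ∧ (∀ g ∈ s, {n : ℕ | g n ≠ 0}.Finite) ∧
      ∀ g ∈ s, ∀ f : Lead, {n : ℕ | f n ≠ 0}.Finite →
        Integrable fun t : ℝ => ⟪f, unitaryGroup (dirichletLaplacian tc) t g⟫_ℂ := by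
  refine ⟨_, dense_range_aeval_four_sub_sq, ?_, ?_⟩
  · rintro _ ⟨r, rfl⟩
    exact finite_support_aeval _
  · rintro _ ⟨r, rfl⟩ f hf
    obtain ⟨p, rfl⟩ := exists_aeval_of_finite_support hf
    simp_rw [unitaryGroup_dirichletLaplacian]
    exact (integrable_inner_unitaryGroup_halfLine p r).comp_mul_left' htc.ne'

end FreeLead

end HartreeNESS

namespace HartreeNESS

/-! ### The structure of the one-particle space -/

section SelfAdjoint

variable {E : Type*} [NormedAddCommGroup E] [InnerProductSpace ℂ E] [CompleteSpace E]

theorem isSelfAdjoint_clm_add {A B : E →L[ℂ] E} (hA : IsSelfAdjoint A) (hB : IsSelfAdjoint B) :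
    IsSelfAdjoint (A + B) := hA.add hB

theorem isSelfAdjoint_clm_smul (c : ℝ) {A : E →L[ℂ] E} (hA : IsSelfAdjoint A) :
    IsSelfAdjoint ((c : ℂ) • A) :=
  IsSelfAdjoint.smul (by rw [isSelfAdjoint_iff]; simp) hA

theorem isSelfAdjoint_rankOne_add (u v : E) :
    IsSelfAdjoint (InnerProductSpace.rankOne ℂ u v + InnerProductSpace.rankOne ℂ v u) := by
  rw [isSelfAdjoint_iff, star_add, ContinuousLinearMap.star_eq_adjoint,
    ContinuousLinearMap.star_eq_adjoint, InnerProductSpace.adjoint_rankOne,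
    InnerProductSpace.adjoint_rankOne, add_comm]

end SelfAdjoint

section HilbStructure

variable {N : ℕ}

theorem inner_hilb (x y : Hilb N) :
    ⟪x, y⟫_ℂ = ∑ j : Fin 2, ⟪x.fst j, y.fst j⟫_ℂ + ⟪x.snd, y.snd⟫_ℂ := by
  rw [WithLp.prod_inner_apply, PiLp.inner_apply]
  rfl

theorem inner_leadEmb_left (j : Fin 2) (u : Lead) (x : Hilb N) :
    ⟪leadEmb N j u, x⟫_ℂ = ⟪u, x.fst j⟫_ℂ := by
  rw [inner_hilb, leadEmb_apply]
  fin_cases j <;> simp [Fin.sum_univ_two]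

theorem inner_sampleEmb_left (v : Sample N) (x : Hilb N) :
    ⟪sampleEmb N v, x⟫_ℂ = ⟪v, x.snd⟫_ℂ := by
  rw [inner_hilb, sampleEmb_apply]
  simp

theorem adjoint_leadEmb_apply (j : Fin 2) (x : Hilb N) :
    ContinuousLinearMap.adjoint (leadEmb N j) x = x.fst j := by
  refine ext_inner_left ℂ fun u => ?_
  rw [ContinuousLinearMap.adjoint_inner_right, inner_leadEmb_left]

theorem adjoint_sampleEmb_apply (x : Hilb N) :
    ContinuousLinearMap.adjoint (sampleEmb N) x = x.snd := by
  refine ext_inner_left ℂ fun u => ?_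
  rw [ContinuousLinearMap.adjoint_inner_right, inner_sampleEmb_left]

theorem leadEmb_fst (j k : Fin 2) (u : Lead) :
    (leadEmb N j u).fst k = if k = j then u else 0 := by
  rw [leadEmb_apply]
  simp

theorem leadEmb_snd (j : Fin 2) (u : Lead) : (leadEmb N j u).snd = 0 := rfl

theorem sampleEmb_fst (k : Fin 2) (v : Sample N) : (sampleEmb N v).fst k = 0 := rfl

theorem sampleEmb_snd (v : Sample N) : (sampleEmb N v).snd = v := rfl

theorem hilb_decomp (x : Hilb N) :
    x = ∑ j : Fin 2, leadEmb N j (x.fst j) + sampleEmb N x.snd := by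
  refine ext_inner_right ℂ fun y => ?_
  rw [inner_hilb, inner_add_left, sum_inner, inner_sampleEmb_left]
  simp_rw [inner_leadEmb_left]

theorem norm_leadEmb (j : Fin 2) (u : Lead) : ‖leadEmb N j u‖ = ‖u‖ := by
  have : ⟪leadEmb N j u, leadEmb N j u⟫_ℂ = ⟪u, u⟫_ℂ := by
    rw [inner_leadEmb_left, leadEmb_fst, if_pos rfl]
  rw [@norm_eq_sqrt_re_inner ℂ, this, ← @norm_eq_sqrt_re_inner ℂ]

theorem norm_sampleEmb (v : Sample N) : ‖sampleEmb N v‖ = ‖v‖ := by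
  have : ⟪sampleEmb N v, sampleEmb N v⟫_ℂ = ⟪v, v⟫_ℂ := by
    rw [inner_sampleEmb_left, sampleEmb_snd]
  rw [@norm_eq_sqrt_re_inner ℂ, this, ← @norm_eq_sqrt_re_inner ℂ]

theorem norm_sq_hilb (x : Hilb N) :
    ‖x‖ ^ 2 = ∑ j : Fin 2, ‖x.fst j‖ ^ 2 + ‖x.snd‖ ^ 2 := by
  have h := inner_hilb x x
  simp only [inner_self_eq_norm_sq_to_K] at h
  exact_mod_cast h

theorem norm_zeta (k : Fin N) : ‖(zeta k : Hilb N)‖ = 1 := by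
  rw [zeta, norm_sampleEmb, sampleBasis, PiLp.norm_single, norm_one]

theorem onLead_apply (j : Fin 2) (A : Lead →L[ℂ] Lead) (x : Hilb N) :
    onLead N j A x = leadEmb N j (A (x.fst j)) := by
  rw [← adjoint_leadEmb_apply]; rfl

theorem onSample_apply (A : Sample N →L[ℂ] Sample N) (x : Hilb N) :
    onSample A x = sampleEmb N (A x.snd) := by
  rw [← adjoint_sampleEmb_apply]; rfl

theorem leadHam_leadEmb (tc : ℝ) (j : Fin 2) :
    leadHam N tc ∘L leadEmb N j = leadEmb N j ∘L dirichletLaplacian tc := by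
  ext u : 1
  rw [ContinuousLinearMap.comp_apply, ContinuousLinearMap.comp_apply, leadHam, sum_apply,
    Finset.sum_eq_single j]
  · rw [onLead_apply, leadEmb_fst, if_pos rfl]
  · intro k _ hk
    rw [onLead_apply, leadEmb_fst, if_neg hk, map_zero, map_zero]
  · simp

theorem leadHam_sampleEmb_apply (tc : ℝ) (v : Sample N) : leadHam N tc (sampleEmb N v) = 0 := by
  rw [leadHam, sum_apply]
  refine Finset.sum_eq_zero fun k _ => ?_
  rw [onLead_apply, sampleEmb_fst, map_zero, map_zero]

theorem isSelfAdjoint_onLead (j : Fin 2) {A : Lead →L[ℂ] Lead} (hA : IsSelfAdjoint A) :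
    IsSelfAdjoint (onLead N j A) :=
  hA.conj_adjoint (leadEmb N j)

theorem isSelfAdjoint_onSample {A : Sample N →L[ℂ] Sample N} (hA : IsSelfAdjoint A) :
    IsSelfAdjoint (onSample A) :=
  hA.conj_adjoint (sampleEmb N)

theorem isSelfAdjoint_leadHam (tc : ℝ) : IsSelfAdjoint (leadHam N tc) := by
  rw [leadHam, Fin.sum_univ_two]
  exact isSelfAdjoint_clm_add (isSelfAdjoint_onLead 0 (isSelfAdjoint_dirichletLaplacian tc))
    (isSelfAdjoint_onLead 1 (isSelfAdjoint_dirichletLaplacian tc))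

theorem isSelfAdjoint_tunnelHam (τ : ℝ) (L : Fin 2 → Lead) (S : Fin 2 → Sample N) :
    IsSelfAdjoint (tunnelHam τ L S) := by
  rw [tunnelHam, Fin.sum_univ_two]
  exact isSelfAdjoint_clm_smul τ (isSelfAdjoint_clm_add (isSelfAdjoint_rankOne_add _ _)
    (isSelfAdjoint_rankOne_add _ _))

theorem isSelfAdjoint_coupledHam (tc : ℝ) {hs : Sample N →L[ℂ] Sample N}
    (hhs : IsSelfAdjoint hs) (τ : ℝ) (L : Fin 2 → Lead) (S : Fin 2 → Sample N) :
    IsSelfAdjoint (coupledHam tc hs τ L S) :=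
  isSelfAdjoint_clm_add (isSelfAdjoint_clm_add (isSelfAdjoint_leadHam tc)
    (isSelfAdjoint_onSample hhs)) (isSelfAdjoint_tunnelHam τ L S)

/-! ### Finitely supported vectors -/

theorem isCompactlySupported_sampleEmb (v : Sample N) : IsCompactlySupported (sampleEmb N v) := by
  intro j
  simp [sampleEmb_fst]

theorem isCompactlySupported_zeta (k : Fin N) : IsCompactlySupported (zeta k) :=
  isCompactlySupported_sampleEmb _

theorem isCompactlySupported_leadEmb (j : Fin 2) {u : Lead} (hu : {n : ℕ | u n ≠ 0}.Finite) :
    IsCompactlySupported (leadEmb N j u) := by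
  intro k
  rw [leadEmb_fst]
  split_ifs
  · exact hu
  · simp

/-- The set of vectors whose lead components lie in `s` is dense if `s` is. -/
theorem dense_hilb_of_dense_lead {s : Set Lead} (hs : Dense s) :
    Dense {x : Hilb N | ∀ j, x.fst j ∈ s} := by
  intro x
  rw [Metric.mem_closure_iff]
  intro ε hε
  have h := fun j => Metric.mem_closure_iff.1 (hs (x.fst j)) (ε / 2) (by positivity)
  choose y hy hxy using h
  refine ⟨∑ j : Fin 2, leadEmb N j (y j) + sampleEmb N x.snd, ?_, ?_⟩
  · intro j
    have : (∑ j : Fin 2, leadEmb N j (y j) + sampleEmb N x.snd).fst j = y j := by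
      rw [← adjoint_leadEmb_apply, map_add, map_sum]
      simp_rw [adjoint_leadEmb_apply, leadEmb_fst, sampleEmb_fst]
      simp
    rw [this]; exact hy j
  · have e : dist x (∑ j : Fin 2, leadEmb N j (y j) + sampleEmb N x.snd) =
        dist (∑ j : Fin 2, leadEmb N j (x.fst j) + sampleEmb N x.snd)
          (∑ j : Fin 2, leadEmb N j (y j) + sampleEmb N x.snd) := by rw [← hilb_decomp x]
    rw [e, dist_add_right, dist_eq_norm, ← Finset.sum_sub_distrib]
    refine lt_of_le_of_lt (norm_sum_le _ _) ?_
    simp_rw [← map_sub, norm_leadEmb, ← dist_eq_norm]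
    rw [Fin.sum_univ_two]
    linarith [hxy 0, hxy 1]

theorem dense_isCompactlySupported : Dense {x : Hilb N | IsCompactlySupported x} := by
  refine (dense_hilb_of_dense_lead dense_range_aeval_four_sub_sq).mono fun x hx j => ?_
  obtain ⟨r, hr⟩ := hx j
  rw [← hr]
  exact finite_support_aeval _

/-! ### The standard basis -/

theorem inner_stdVec_inl (j : Fin 2) (n : ℕ) (x : Hilb N) :
    ⟪stdVec (Sum.inl (j, n)), x⟫_ℂ = x.fst j n := by
  change ⟪leadEmb N j (siteVec n), x⟫_ℂ = _
  rw [inner_leadEmb_left, inner_siteVec_left]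

theorem inner_stdVec_inr (k : Fin N) (x : Hilb N) :
    ⟪stdVec (Sum.inr k), x⟫_ℂ = x.snd k := by
  change ⟪sampleEmb N (sampleBasis k), x⟫_ℂ = _
  rw [inner_sampleEmb_left, sampleBasis, EuclideanSpace.inner_single_left]
  simp

theorem orthonormal_stdVec : Orthonormal ℂ (stdVec : (Fin 2 × ℕ) ⊕ Fin N → Hilb N) := by
  rw [orthonormal_iff_ite]
  rintro (⟨j, n⟩ | k) (⟨j', n'⟩ | k')
  · rw [inner_stdVec_inl]
    change (leadEmb N j' (siteVec n')).fst j n = _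
    rw [leadEmb_fst]
    by_cases h : j = j'
    · simp [h, siteVec_apply]
    · simp [h]
  · rw [inner_stdVec_inl]
    simp [stdVec, zeta, sampleEmb_fst]
  · rw [inner_stdVec_inr]
    simp [stdVec, leadEmb_snd]
  · rw [inner_stdVec_inr]
    simp [stdVec, zeta, sampleEmb_snd, sampleBasis]

/-- The standard basis as a Hilbert basis. -/
noncomputable def stdBasis (N : ℕ) : HilbertBasis ((Fin 2 × ℕ) ⊕ Fin N) ℂ (Hilb N) :=
  HilbertBasis.mkOfOrthogonalEqBot orthonormal_stdVec (by
    rw [Submodule.eq_bot_iff]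
    intro x hx
    have h : ∀ i, ⟪stdVec i, x⟫_ℂ = 0 := fun i => hx _ (Submodule.subset_span ⟨i, rfl⟩)
    rw [hilb_decomp x]
    have h1 : ∀ j, x.fst j = 0 := by
      intro j
      ext n
      rw [← inner_stdVec_inl, h]; rfl
    have h2 : x.snd = 0 := by
      ext k
      rw [← inner_stdVec_inr, h]; rfl
    simp [h1, h2])

theorem coe_stdBasis : ⇑(stdBasis N) = stdVec :=
  HilbertBasis.coe_mkOfOrthogonalEqBot _ _

theorem leadProj_stdVec (k : Fin 2) (i : (Fin 2 × ℕ) ⊕ Fin N) :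
    leadProj N k (stdVec i) = stdVec i ∨ leadProj N k (stdVec i) = 0 := by
  rw [leadProj, onLead_apply]
  rcases i with ⟨j, n⟩ | m
  · change leadEmb N k ((leadEmb N j (siteVec n)).fst k) = leadEmb N j (siteVec n) ∨ _
    rw [leadEmb_fst]
    by_cases h : k = j
    · left; simp [h]
    · right; simp [stdVec, leadEmb_fst, h]
  · right
    simp [stdVec, zeta, sampleEmb_fst]

theorem isSelfAdjoint_leadProj (k : Fin 2) : IsSelfAdjoint (leadProj N k) :=
  isSelfAdjoint_onLead k (IsSelfAdjoint.one _)

theorem commute_leadHam_leadProj (tc : ℝ) (k : Fin 2) :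
    Commute (leadHam N tc) (leadProj N k) := by
  refine ContinuousLinearMap.ext fun x => ?_
  have h1 : ∀ j (y : Hilb N), (leadHam N tc y).fst j = dirichletLaplacian tc (y.fst j) := by
    intro j y
    have := congrArg (fun T : Hilb N →L[ℂ] Lead => T y) (adjoint_intertwine
      (isSelfAdjoint_leadHam tc) (isSelfAdjoint_dirichletLaplacian tc) (leadHam_leadEmb (N := N) tc j))
    simp only [ContinuousLinearMap.comp_apply, adjoint_leadEmb_apply] at this
    exact this.symm
  have h2 := congrArg (fun T : Lead →L[ℂ] Hilb N => T (x.fst k)) (leadHam_leadEmb (N := N) tc k)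
  simp only [ContinuousLinearMap.comp_apply] at h2
  rw [mul_apply_eq_comp, mul_apply_eq_comp, leadProj, onLead_apply, onLead_apply, h1]
  exact h2

/-! ### The initial state -/

section InitialState

variable (tc : ℝ) (β : Fin 2 → ℝ≥0∞) (μ : Fin 2 → ℝ) (ρs : Sample N →L[ℂ] Sample N)

theorem initialState_apply (x : Hilb N) :
    initialState tc β μ ρs x =
      ∑ j : Fin 2, leadEmb N j (fermiDirac (β j) (μ j) (dirichletLaplacian tc) (x.fst j)) +
        sampleEmb N (ρs x.snd) := by
  rw [initialState, add_apply, sum_apply, onSample_apply]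
  simp_rw [onLead_apply]

theorem initialState_leadEmb (j : Fin 2) (u : Lead) :
    initialState tc β μ ρs (leadEmb N j u) =
      leadEmb N j (fermiDirac (β j) (μ j) (dirichletLaplacian tc) u) := by
  rw [initialState_apply, leadEmb_snd, map_zero, map_zero, add_zero, Finset.sum_eq_single j]
  · rw [leadEmb_fst, if_pos rfl]
  · intro k _ hk
    rw [leadEmb_fst, if_neg hk, map_zero, map_zero]
  · simp

theorem initialState_sampleEmb (v : Sample N) :
    initialState tc β μ ρs (sampleEmb N v) = sampleEmb N (ρs v) := by
  rw [initialState_apply]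
  simp [sampleEmb_fst, sampleEmb_snd]

variable {ρs}

theorem isPositive_initialState (hρ : ρs.IsPositive) : (initialState tc β μ ρs).IsPositive := by
  rw [← ContinuousLinearMap.nonneg_iff_isPositive]
  refine add_nonneg (Finset.sum_nonneg fun j _ => ?_) ?_
  · rw [ContinuousLinearMap.nonneg_iff_isPositive]
    exact (isPositive_fermiDirac _ _ _).conj_adjoint _
  · rw [ContinuousLinearMap.nonneg_iff_isPositive]
    exact hρ.conj_adjoint _

theorem norm_initialState_le (hρ : ‖ρs‖ ≤ 1) : ‖initialState tc β μ ρs‖ ≤ 1 := by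
  refine ContinuousLinearMap.opNorm_le_bound _ zero_le_one fun x => ?_
  rw [one_mul]
  refine (pow_le_pow_iff_left₀ (norm_nonneg _) (norm_nonneg _) two_ne_zero).1 ?_
  rw [norm_sq_hilb, norm_sq_hilb x]
  have h1 : ∀ j, (initialState tc β μ ρs x).fst j =
      fermiDirac (β j) (μ j) (dirichletLaplacian tc) (x.fst j) := by
    intro j
    rw [← adjoint_leadEmb_apply, initialState_apply, map_add, map_sum]
    simp_rw [adjoint_leadEmb_apply, leadEmb_fst, sampleEmb_fst]
    simp
  have h2 : (initialState tc β μ ρs x).snd = ρs x.snd := by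
    rw [← adjoint_sampleEmb_apply, initialState_apply, map_add, map_sum]
    simp_rw [adjoint_sampleEmb_apply, leadEmb_snd, sampleEmb_snd]
    simp
  rw [h2]
  simp_rw [h1]
  gcongr with j
  · simpa using ContinuousLinearMap.le_of_opNorm_le _ (norm_fermiDirac_le _ _ _) (x.fst j)
  · simpa using ContinuousLinearMap.le_of_opNorm_le _ hρ x.snd

theorem commute_leadHam_initialState : Commute (leadHam N tc) (initialState tc β μ ρs) := by
  refine ContinuousLinearMap.ext fun x => ?_
  have h : ∀ j u, leadHam N tc (leadEmb N j u) = leadEmb N j (dirichletLaplacian tc u) :=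
    fun j u => congrArg (fun T : Lead →L[ℂ] Hilb N => T u) (leadHam_leadEmb tc j)
  have hc : ∀ j u, dirichletLaplacian tc (fermiDirac (β j) (μ j) (dirichletLaplacian tc) u) =
      fermiDirac (β j) (μ j) (dirichletLaplacian tc) (dirichletLaplacian tc u) := fun j u =>
    congrArg (fun T : Lead →L[ℂ] Lead => T u)
      (commute_fermiDirac (isSelfAdjoint_dirichletLaplacian tc) (β j) (μ j)).eq
  rw [mul_apply_eq_comp, mul_apply_eq_comp]
  conv_lhs => rw [hilb_decomp x]
  conv_rhs => rw [hilb_decomp x]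
  simp only [map_add, map_sum, initialState_leadEmb, initialState_sampleEmb, h,
    leadHam_sampleEmb_apply, hc]
  simp

end InitialState

end HilbStructure

end HartreeNESS

namespace HartreeNESS

/-! ### Wave operators -/

section WaveOperators

variable {N : ℕ}

/-- Every finitely supported vector has an integrable return amplitude, hence is absolutely
continuous, and these vectors are dense. -/
theorem acProjection_eq_one_of_dispersive {H : Hilb N →L[ℂ] Hilb N} (hH : IsSelfAdjoint H)
    (hd : Dispersive H) : acProjection H = 1 := by
  have h : (Submodule.span ℂ (acVectors H)).topologicalClosure = ⊤ := by
    rw [← Submodule.dense_iff_topologicalClosure_eq_top]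
    exact dense_isCompactlySupported.mono fun x hx =>
      Submodule.subset_span (mem_acVectors_of_integrable hH (hd x x hx hx))
  unfold acProjection
  ext x : 1
  rw [one_apply_eq_self]
  exact Submodule.starProjection_eq_self_iff.2 (h ▸ Submodule.mem_top)

theorem unitaryGroup_leadHam_leadEmb (tc : ℝ) (j : Fin 2) (t : ℝ) (u : Lead) :
    unitaryGroup (leadHam N tc) t (leadEmb N j u) =
      leadEmb N j (unitaryGroup (dirichletLaplacian tc) t u) :=
  unitaryGroup_intertwine (leadHam_leadEmb tc j) t u

theorem unitaryGroup_leadHam_sampleEmb (tc : ℝ) (t : ℝ) (v : Sample N) :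
    unitaryGroup (leadHam N tc) t (sampleEmb N v) = sampleEmb N v := by
  rw [unitaryGroup_intertwine (B := 0) (W := sampleEmb N)
    (by ext v : 1; simp [leadHam_sampleEmb_apply])]
  simp [unitaryGroup]

/-- Lead vectors with integrable return amplitude are dense in the leads, while the sample lies in
the kernel of H_L and is therefore orthogonal to all absolutely continuous vectors. -/
theorem acProjection_leadHam_apply {tc : ℝ} (htc : 0 < tc) (x : Hilb N) :
    acProjection (leadHam N tc) x = ∑ j : Fin 2, leadEmb N j (x.fst j) := by
  refine Submodule.eq_starProjection_of_mem_of_inner_eq_zero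
    (K := (Submodule.span ℂ (acVectors (leadHam N tc))).topologicalClosure) ?_
    fun w hw => ?_
  · refine sum_mem fun j _ => ?_
    obtain ⟨s, hs, hfin, hint⟩ := exists_dense_integrable_dirichletLaplacian htc
    have h1 : ∀ g ∈ s, leadEmb N j g ∈ Submodule.span ℂ (acVectors (leadHam N tc)) := by
      intro g hg
      refine Submodule.subset_span (mem_acVectors_of_integrable (isSelfAdjoint_leadHam tc) ?_)
      refine (hint g hg g (hfin g hg)).congr (Eventually.of_forall fun t => ?_)
      simp only
      rw [unitaryGroup_leadHam_leadEmb, inner_leadEmb_left, leadEmb_fst, if_pos rfl]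
    exact map_mem_closure (leadEmb N j).continuous (hs (x.fst j)) h1
  · have e : x - ∑ j : Fin 2, leadEmb N j (x.fst j) = sampleEmb N x.snd :=
      sub_eq_iff_eq_add'.2 (hilb_decomp x)
    rw [e]
    have hle : (Submodule.span ℂ (acVectors (leadHam N tc))).topologicalClosure ≤
        (innerSL ℂ (sampleEmb N x.snd)).ker := by
      refine Submodule.topologicalClosure_minimal _ (Submodule.span_le.2 fun w hw => ?_)
        (innerSL ℂ (sampleEmb N x.snd)).isClosed_ker
      exact inner_eq_zero_of_mem_acVectors (isSelfAdjoint_leadHam tc) hw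
        (leadHam_sampleEmb_apply tc _)
    exact hle hw

variable (tc : ℝ) (hs : Sample N →L[ℂ] Sample N) (τ : ℝ) (L : Fin 2 → Lead) (S : Fin 2 → Sample N)

theorem coupledHam_sub_leadHam_apply (x : Hilb N) :
    (coupledHam tc hs τ L S - leadHam N tc) x =
      ∑ k : Fin N, ⟪(zeta k : Hilb N), x⟫_ℂ • sampleEmb N (hs (sampleBasis k)) +
      (τ : ℂ) • ∑ j : Fin 2, (⟪leadEmb N j (L j), x⟫_ℂ • sampleEmb N (S j) +
        ⟪sampleEmb N (S j), x⟫_ℂ • leadEmb N j (L j)) := by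
  have h1 : onSample hs x =
      ∑ k : Fin N, ⟪(zeta k : Hilb N), x⟫_ℂ • sampleEmb N (hs (sampleBasis k)) := by
    rw [onSample_apply]
    have : x.snd = ∑ k, ⟪(zeta k : Hilb N), x⟫_ℂ • sampleBasis k := by
      ext m
      have h2 : ∀ k, ⟪(zeta k : Hilb N), x⟫_ℂ = x.snd k := fun k => inner_stdVec_inr k x
      simp [h2, sampleBasis, Pi.single_apply]
    conv_lhs => rw [this]
    simp only [map_sum, map_smul]
  rw [coupledHam, sub_apply, add_apply, add_apply, h1, tunnelHam, smul_apply, sum_apply]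
  simp only [add_apply, InnerProductSpace.rankOne_apply]
  abel

/-- The hypothesis of Cook's method: the perturbation has finite rank, so only amplitudes against
finitely supported vectors appear. -/
theorem integrable_coupledHam_sub {B : Hilb N →L[ℂ] Hilb N} (hL : ∀ j, {n : ℕ | L j n ≠ 0}.Finite)
    {x : Hilb N} (h : ∀ b : Hilb N, IsCompactlySupported b →
      Integrable fun t : ℝ => ⟪b, unitaryGroup B t x⟫_ℂ) :
    Integrable fun t => (coupledHam tc hs τ L S - leadHam N tc) (unitaryGroup B t x) := by
  simp only [coupledHam_sub_leadHam_apply]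
  refine Integrable.add (integrable_finsetSum _ fun k _ =>
    (h _ (isCompactlySupported_zeta k)).smul_const _) ?_
  refine Integrable.fun_smul (τ : ℂ) (integrable_finsetSum _ fun j _ => ?_)
  exact ((h _ (isCompactlySupported_leadEmb j (hL j))).smul_const _).add
    ((h _ (isCompactlySupported_sampleEmb (S j))).smul_const _)

variable {tc hs L}

theorem exists_waveOperator_leadHam (htc : 0 < tc) (hhs : IsSelfAdjoint hs)
    (hL : ∀ j, {n : ℕ | L j n ≠ 0}.Finite) :
    ∃ W, IsWaveOperator (coupledHam tc hs τ L S) (leadHam N tc) W := by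
  have hH := isSelfAdjoint_coupledHam tc hhs τ L S
  have hA := isSelfAdjoint_leadHam (N := N) tc
  obtain ⟨s, hs', hfin, hint⟩ := exists_dense_integrable_dirichletLaplacian htc
  refine exists_strongLimit_of_dense (C := 1) (fun t _ => ?_) (dense_hilb_of_dense_lead hs')
    fun x hx => ?_
  · refine (norm_mul_le _ _).trans (mul_le_one₀ ((norm_mul_le _ _).trans (mul_le_one₀
      (norm_unitaryGroup_le hH _) (norm_nonneg _) (norm_unitaryGroup_le hA _))) (norm_nonneg _) ?_)
    exact Submodule.starProjection_norm_le _
  · have hj : ∀ j : Fin 2, ∃ l, Tendsto (fun t => (unitaryGroup (coupledHam tc hs τ L S) (-t) *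
        unitaryGroup (leadHam N tc) t) (leadEmb N j (x.fst j))) atTop (𝓝 l) := by
      intro j
      refine cook_tendsto hH (Integrable.integrableOn ?_)
      refine integrable_coupledHam_sub tc hs τ L S hL fun b hb => ?_
      have h1 := hint (x.fst j) (hx j) (b.fst j) (hb j)
      refine h1.congr (Eventually.of_forall fun t => ?_)
      simp only
      rw [unitaryGroup_leadHam_leadEmb, ← inner_conj_symm, ← inner_conj_symm b, inner_leadEmb_left]
    choose l hl using hj
    refine ⟨∑ j, l j, (tendsto_finsetSum _ fun j _ => hl j).congr fun t => ?_⟩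
    rw [mul_apply_eq_comp _ (acProjection (leadHam N tc)), acProjection_leadHam_apply htc, map_sum]

theorem exists_waveOperator_coupledHam (hhs : IsSelfAdjoint hs)
    (hL : ∀ j, {n : ℕ | L j n ≠ 0}.Finite) (hd : Dispersive (coupledHam tc hs τ L S)) :
    ∃ W', IsWaveOperator (leadHam N tc) (coupledHam tc hs τ L S) W' := by
  have hH := isSelfAdjoint_coupledHam tc hhs τ L S
  have hA := isSelfAdjoint_leadHam (N := N) tc
  unfold IsWaveOperator
  rw [acProjection_eq_one_of_dispersive hH hd]
  simp only [mul_one]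
  refine exists_strongLimit_of_dense (C := 1) (fun t _ => ?_) dense_isCompactlySupported
    fun x hx => ?_
  · exact (norm_mul_le _ _).trans (mul_le_one₀
      (norm_unitaryGroup_le hA _) (norm_nonneg _) (norm_unitaryGroup_le hH _))
  · refine cook_tendsto hA (Integrable.integrableOn ?_)
    refine (integrable_coupledHam_sub tc hs τ L S hL (x := x) fun b hb => hd b x hb hx).neg.congr
      (Eventually.of_forall fun t => ?_)
    simp only [Pi.neg_apply]
    rw [← neg_apply, neg_sub]

/-- A function which is integrable and has a limit at infinity tends to zero. -/
theorem eq_zero_of_integrable_of_tendsto {f : ℝ → ℂ} {c : ℂ} (hf : Integrable f)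
    (h : Tendsto f atTop (𝓝 c)) : c = 0 := by
  refine IntegrableAtFilter.eq_zero_of_tendsto
    (⟨Set.univ, univ_mem, hf.integrableOn⟩ : IntegrableAtFilter f atTop volume) ?_ h
  intro s hs
  rcases mem_atTop_sets.1 hs with ⟨b, hb⟩
  rw [← top_le_iff, ← Real.volume_Ici (a := b)]
  exact measure_mono hb

/-- The lead dynamics fixes sample vectors, so the overlap with v is the limit of ⟨v, e^{itH} x⟩.
For finitely supported x this function is integrable, so its limit is zero. This is the origin of
the independence from the initial sample state. -/
theorem waveOperator_snd_eq_zero (hhs : IsSelfAdjoint hs)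
    (hd : Dispersive (coupledHam tc hs τ L S)) {W' : Hilb N →L[ℂ] Hilb N}
    (hW' : IsWaveOperator (leadHam N tc) (coupledHam tc hs τ L S) W') (x : Hilb N) :
    (W' x).snd = 0 := by
  have hH := isSelfAdjoint_coupledHam tc hhs τ L S
  have hA := isSelfAdjoint_leadHam (N := N) tc
  unfold IsWaveOperator at hW'
  rw [acProjection_eq_one_of_dispersive hH hd] at hW'
  simp only [mul_one] at hW'
  refine ext_inner_left ℂ fun v => ?_
  rw [← inner_sampleEmb_left, inner_zero_right]
  have hcs : ∀ x, IsCompactlySupported x → ⟪sampleEmb N v, W' x⟫_ℂ = 0 := by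
    intro x hx
    have h1 := ((innerSL ℂ (sampleEmb N v)).continuous.tendsto _).comp (hW' x)
    refine eq_zero_of_integrable_of_tendsto
      (hd (sampleEmb N v) x (isCompactlySupported_sampleEmb v) hx) (h1.congr fun t => ?_)
    simp only [Function.comp_apply, innerSL_apply_apply, mul_apply_eq_comp]
    rw [← neg_neg t, ← inner_unitaryGroup_left hA, neg_neg, unitaryGroup_leadHam_sampleEmb]
  have hcl : IsClosed {x | ⟪sampleEmb N v, W' x⟫_ℂ = 0} :=
    isClosed_eq (by fun_prop) continuous_const
  have : closure {x : Hilb N | IsCompactlySupported x} ⊆ _ := hcl.closure_subset_iff.2 hcs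
  rw [dense_isCompactlySupported.closure_eq] at this
  exact this (Set.mem_univ x)

theorem waveOperator_eq_adjoint (htc : 0 < tc) (hhs : IsSelfAdjoint hs)
    (hd : Dispersive (coupledHam tc hs τ L S)) {W W' : Hilb N →L[ℂ] Hilb N}
    (hW : IsWaveOperator (coupledHam tc hs τ L S) (leadHam N tc) W)
    (hW' : IsWaveOperator (leadHam N tc) (coupledHam tc hs τ L S) W') :
    W' = ContinuousLinearMap.adjoint W := by
  have hH := isSelfAdjoint_coupledHam tc hhs τ L S
  have hA := isSelfAdjoint_leadHam (N := N) tc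
  have h0 := waveOperator_snd_eq_zero τ S hhs hd hW'
  unfold IsWaveOperator at hW hW'
  rw [acProjection_eq_one_of_dispersive hH hd] at hW'
  simp only [mul_one] at hW'
  refine ContinuousLinearMap.ext fun x => ext_inner_right ℂ fun y => ?_
  rw [ContinuousLinearMap.adjoint_inner_left]
  -- W' x lives in the leads, so the projection in the definition of W can be inserted for free.
  have e : ⟪W' x, y⟫_ℂ = ⟪W' x, acProjection (leadHam N tc) y⟫_ℂ := by
    have hy : y = acProjection (leadHam N tc) y + sampleEmb N y.snd := by
      rw [acProjection_leadHam_apply htc]; exact hilb_decomp y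
    conv_lhs => rw [hy]
    rw [inner_add_right, ← inner_conj_symm _ (sampleEmb N y.snd), inner_sampleEmb_left, h0]
    simp
  rw [e]
  have h1 : Tendsto (fun t => ⟪(unitaryGroup (leadHam N tc) (-t) *
      unitaryGroup (coupledHam tc hs τ L S) t) x, acProjection (leadHam N tc) y⟫_ℂ) atTop
      (𝓝 ⟪W' x, acProjection (leadHam N tc) y⟫_ℂ) := (hW' x).inner tendsto_const_nhds
  have h2 : Tendsto (fun t => ⟪x, (unitaryGroup (coupledHam tc hs τ L S) (-t) *
      unitaryGroup (leadHam N tc) t * acProjection (leadHam N tc)) y⟫_ℂ) atTop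
      (𝓝 ⟪x, W y⟫_ℂ) := tendsto_const_nhds.inner (hW y)
  refine tendsto_nhds_unique (h1.congr fun t => ?_) h2
  simp only [mul_apply_eq_comp]
  rw [inner_unitaryGroup_left hA, neg_neg, inner_unitaryGroup_left hH]

theorem norm_waveOperator_apply (hhs : IsSelfAdjoint hs)
    (hd : Dispersive (coupledHam tc hs τ L S)) {W' : Hilb N →L[ℂ] Hilb N}
    (hW' : IsWaveOperator (leadHam N tc) (coupledHam tc hs τ L S) W') (x : Hilb N) :
    ‖W' x‖ = ‖x‖ := by
  have hH := isSelfAdjoint_coupledHam tc hhs τ L S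
  have hA := isSelfAdjoint_leadHam (N := N) tc
  unfold IsWaveOperator at hW'
  rw [acProjection_eq_one_of_dispersive hH hd] at hW'
  simp only [mul_one] at hW'
  refine tendsto_nhds_unique (hW' x).norm (tendsto_const_nhds.congr fun t => ?_)
  rw [mul_apply_eq_comp, norm_unitaryGroup_apply hA, norm_unitaryGroup_apply hH]

theorem adjoint_comp_self_of_norm_eq {E : Type*} [NormedAddCommGroup E] [InnerProductSpace ℂ E]
    [CompleteSpace E] {T : E →L[ℂ] E} (hT : ∀ x, ‖T x‖ = ‖x‖) : star T * T = 1 := by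
  let I : E →ₗᵢ[ℂ] E := ⟨T.toLinearMap, hT⟩
  refine ContinuousLinearMap.ext fun x => ext_inner_right ℂ fun y => ?_
  rw [mul_apply_eq_comp, ContinuousLinearMap.star_eq_adjoint,
    ContinuousLinearMap.adjoint_inner_left]
  exact I.inner_map_map x y

/-- Both e^{-itH_L} e^{itH} x and its derivative converge; the limit of the derivative, i (W' H x -
H_L W' x), must vanish. -/
theorem waveOperator_intertwine (hhs : IsSelfAdjoint hs)
    (hd : Dispersive (coupledHam tc hs τ L S)) {W' : Hilb N →L[ℂ] Hilb N}
    (hW' : IsWaveOperator (leadHam N tc) (coupledHam tc hs τ L S) W') :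
    leadHam N tc ∘L W' = W' ∘L coupledHam tc hs τ L S := by
  set H := coupledHam tc hs τ L S with hHdef
  set A := leadHam N tc
  have hH : IsSelfAdjoint H := isSelfAdjoint_coupledHam tc hhs τ L S
  unfold IsWaveOperator at hW'
  rw [acProjection_eq_one_of_dispersive hH hd] at hW'
  simp only [mul_one] at hW'
  refine ContinuousLinearMap.ext fun x => ?_
  have hder : ∀ t, 0 ≤ t → HasDerivAt (fun t => (unitaryGroup A (-t) * unitaryGroup H t) x)
      (Complex.I • ((unitaryGroup A (-t) * unitaryGroup H t) (H x) -
        A ((unitaryGroup A (-t) * unitaryGroup H t) x))) t := by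
    intro t _
    have h1 := (hasDerivAt_unitaryGroup_neg A t).mul (hasDerivAt_unitaryGroup' H t)
    have h2 := ((ContinuousLinearMap.apply ℂ (Hilb N) x).restrictScalars
      ℝ).hasFDerivAt.comp_hasDerivAt t h1
    refine h2.congr_deriv ?_
    simp [smul_sub]
    abel
  have h3 := eq_zero_of_tendsto_of_hasDerivAt hder (hW' x)
    (((hW' (H x)).sub ((A.continuous.tendsto _).comp (hW' x))).const_smul Complex.I)
  rw [smul_eq_zero_iff_right Complex.I_ne_zero, sub_eq_zero] at h3
  exact h3.symm

/-- The initial state commutes with H_L, so e^{-itH_L} and e^{itH_L} may be inserted on its two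
sides, which exhibits both wave operators. -/
theorem waveOperator_tendsto_conj (htc : 0 < tc) (hhs : IsSelfAdjoint hs)
    (hd : Dispersive (coupledHam tc hs τ L S)) {W W' : Hilb N →L[ℂ] Hilb N}
    (hW : IsWaveOperator (coupledHam tc hs τ L S) (leadHam N tc) W)
    (hW' : IsWaveOperator (leadHam N tc) (coupledHam tc hs τ L S) W')
    (β : Fin 2 → ℝ≥0∞) (μ : Fin 2 → ℝ) (ρs : Sample N →L[ℂ] Sample N) :
    IsStrongLimit (fun t => unitaryGroup (coupledHam tc hs τ L S) (-t) *
      initialState tc β μ ρs * unitaryGroup (coupledHam tc hs τ L S) t)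
      (W * initialState tc β μ ρs * W') := by
  have h0 := waveOperator_snd_eq_zero τ S hhs hd hW'
  have hH := isSelfAdjoint_coupledHam tc hhs τ L S
  have hA := isSelfAdjoint_leadHam (N := N) tc
  have hc := commute_leadHam_initialState (N := N) tc β μ (ρs := ρs)
  unfold IsWaveOperator at hW hW'
  rw [acProjection_eq_one_of_dispersive hH hd] at hW'
  simp only [mul_one] at hW'
  set H := coupledHam tc hs τ L S with hHdef
  set A := leadHam N tc
  set R := initialState tc β μ ρs
  intro x
  have h1 : Tendsto (fun t => R ((unitaryGroup A (-t) * unitaryGroup H t) x)) atTop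
      (𝓝 (R (W' x))) := (R.continuous.tendsto _).comp (hW' x)
  have h2 := tendsto_apply_of_strong (C := 1)
    (T := fun t => unitaryGroup H (-t) * unitaryGroup A t * acProjection A) (fun t _ => (norm_mul_le _ _).trans
    (mul_le_one₀ ((norm_mul_le _ _).trans (mul_le_one₀
      (norm_unitaryGroup_le hH _) (norm_nonneg _) (norm_unitaryGroup_le hA _))) (norm_nonneg _)
      (Submodule.starProjection_norm_le _))) hW h1
  -- The limit R (W' x) has no sample component, so the part removed by P_ac(H_L) disappears as t →
  -- ∞.
  have h3 : Tendsto (fun t => (unitaryGroup H (-t) * unitaryGroup A t)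
      ((1 - acProjection A) (R ((unitaryGroup A (-t) * unitaryGroup H t) x)))) atTop (𝓝 0) := by
    have h4 : Tendsto (fun t => (1 - acProjection A)
        (R ((unitaryGroup A (-t) * unitaryGroup H t) x))) atTop (𝓝 0) := by
      have h5 := ((1 - acProjection A).continuous.tendsto _).comp h1
      have e : (1 - acProjection A) (R (W' x)) = 0 := by
        rw [sub_apply, one_apply_eq_self, acProjection_leadHam_apply htc, sub_eq_zero]
        have e1 : W' x = ∑ j : Fin 2, leadEmb N j ((W' x).fst j) := by
          conv_lhs => rw [hilb_decomp (W' x)]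
          rw [h0 x, map_zero, add_zero]
        have e2 : (R (W' x)).snd = 0 := by
          rw [e1, map_sum, ← adjoint_sampleEmb_apply, map_sum]
          refine Finset.sum_eq_zero fun j _ => ?_
          rw [initialState_leadEmb, adjoint_sampleEmb_apply, leadEmb_snd]
        conv_lhs => rw [hilb_decomp (R (W' x))]
        rw [e2, map_zero, add_zero]
      rw [e] at h5
      exact h5
    refine squeeze_zero_norm (fun t => le_of_eq ?_) (tendsto_zero_iff_norm_tendsto_zero.1 h4)
    rw [mul_apply_eq_comp, norm_unitaryGroup_apply hH, norm_unitaryGroup_apply hA]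
  have h6 := h2.add h3
  rw [add_zero] at h6
  refine h6.congr fun t => ?_
  rw [mul_apply_eq_comp _ (acProjection A), ← map_add, ← add_apply, add_sub_cancel,
    one_apply_eq_self]
  simp only [mul_apply_eq_comp]
  congr 1
  have hc' := congrArg (fun T : Hilb N →L[ℂ] Hilb N => T (unitaryGroup H t x))
    (hc.symm.unitaryGroup_right (-t)).eq
  simp only [mul_apply_eq_comp] at hc'
  rw [hc', unitaryGroup_apply_neg_apply]

end WaveOperators

end HartreeNESS

namespace HartreeNESS

/-! ### Convolution with an integrable operator kernel -/

section Convolution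

variable {E : Type*} [NormedAddCommGroup E] [InnerProductSpace ℂ E] [CompleteSpace E]
  {K : ℝ → E →L[ℂ] E} {w w' : ℝ → E}

/-- `∫₀ᵗ K(r) w(t - r) dr` for `t ≥ 0`, extended by zero to negative times. -/
noncomputable def causalConv (K : ℝ → E →L[ℂ] E) (w : ℝ → E) (t : ℝ) : E :=
  ∫ r in (0)..(max t 0), K r (w (max t 0 - r))

theorem continuous_causalConv (hK : Continuous K) (hw : Continuous w) :
    Continuous (causalConv K w) := by
  unfold causalConv
  refine intervalIntegral.continuous_parametric_intervalIntegral_of_continuous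
    (f := fun t r => K r (w (max t 0 - r))) ?_ (by fun_prop)
  simp only [Function.uncurry_def]
  fun_prop

theorem norm_causalConv_le (hK : IntegrableOn K (Set.Ioi 0)) {M C : ℝ}
    (hM : ∫ r in Set.Ioi (0 : ℝ), ‖K r‖ ≤ M) (hC : ∀ s, ‖w s‖ ≤ C) (t : ℝ) :
    ‖causalConv K w t‖ ≤ M * C := by
  have hC0 : 0 ≤ C := (norm_nonneg _).trans (hC 0)
  unfold causalConv
  rw [intervalIntegral.integral_of_le (le_max_right _ _)]
  calc _ ≤ ∫ r in Set.Ioc 0 (max t 0), ‖K r‖ * C :=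
        norm_integral_le_of_norm_le
          (Integrable.mul_const (IntegrableOn.mono_set hK.norm Set.Ioc_subset_Ioi_self) _)
          (Eventually.of_forall fun r => (K r).le_opNorm_of_le (hC _))
    _ = (∫ r in Set.Ioc 0 (max t 0), ‖K r‖) * C := integral_mul_const _ _
    _ ≤ M * C := by
        refine mul_le_mul_of_nonneg_right (le_trans ?_ hM) hC0
        exact setIntegral_mono_set hK.norm (Eventually.of_forall fun _ => norm_nonneg _)
          (Eventually.of_forall Set.Ioc_subset_Ioi_self)

theorem causalConv_sub (hK : Continuous K) (hw : Continuous w) (hw' : Continuous w') (t : ℝ) :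
    causalConv K w t - causalConv K w' t = causalConv K (fun s => w s - w' s) t := by
  unfold causalConv
  rw [← intervalIntegral.integral_sub]
  · simp only [map_sub]
  · exact Continuous.intervalIntegrable (by fun_prop) _ _
  · exact Continuous.intervalIntegrable (by fun_prop) _ _

/-- Written over the whole half-line with an indicator, the integrand is dominated by ‖K r‖ C and
converges pointwise. -/
theorem tendsto_causalConv (hK : Continuous K) (hKi : IntegrableOn K (Set.Ioi 0))
    (hw : Continuous w) {C : ℝ} (hC : ∀ s, ‖w s‖ ≤ C) {l : E} (hl : Tendsto w atTop (𝓝 l)) :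
    Tendsto (causalConv K w) atTop (𝓝 (∫ r in Set.Ioi (0 : ℝ), K r l)) := by
  have hC0 : 0 ≤ C := (norm_nonneg _).trans (hC 0)
  have h : Tendsto (fun t => ∫ r in Set.Ioi (0 : ℝ),
      (Set.Ioc 0 (max t 0)).indicator (fun r => K r (w (max t 0 - r))) r) atTop
      (𝓝 (∫ r in Set.Ioi (0 : ℝ), K r l)) := by
    refine tendsto_integral_filter_of_dominated_convergence (fun r => ‖K r‖ * C) ?_ ?_
      (hKi.norm.mul_const _) ?_
    · refine Eventually.of_forall fun t => ?_
      refine AEStronglyMeasurable.indicator ?_ measurableSet_Ioc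
      exact Continuous.aestronglyMeasurable (by fun_prop)
    · refine Eventually.of_forall fun t => Eventually.of_forall fun r => ?_
      refine (norm_indicator_le_norm_self _ _).trans ((K r).le_opNorm_of_le (hC _))
    · refine (ae_restrict_iff' measurableSet_Ioi).2 (Eventually.of_forall fun r hr => ?_)
      have h1 : Tendsto (fun t : ℝ => max t 0 - r) atTop atTop := by
        refine tendsto_atTop_add_const_right _ (-r) ?_
        exact tendsto_atTop_mono (fun t => le_max_left t 0) tendsto_id
      refine (((K r).continuous.tendsto _).comp (hl.comp h1)).congr' ?_
      filter_upwards [eventually_ge_atTop r] with t ht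
      rw [Set.indicator_of_mem]
      · rfl
      · exact ⟨hr, ht.trans (le_max_left _ _)⟩
  refine h.congr fun t => ?_
  unfold causalConv
  rw [intervalIntegral.integral_of_le (le_max_right _ _), setIntegral_indicator measurableSet_Ioc,
    Set.inter_eq_right.2 Set.Ioc_subset_Ioi_self]

theorem norm_setIntegral_apply_le (hK : IntegrableOn K (Set.Ioi 0)) {M : ℝ}
    (hM : ∫ r in Set.Ioi (0 : ℝ), ‖K r‖ ≤ M) (v : E) :
    ‖∫ r in Set.Ioi (0 : ℝ), K r v‖ ≤ M * ‖v‖ := by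
  calc _ ≤ ∫ r in Set.Ioi (0 : ℝ), ‖K r‖ * ‖v‖ :=
        norm_integral_le_of_norm_le (hK.norm.mul_const _)
          (Eventually.of_forall fun r => (K r).le_opNorm v)
    _ = (∫ r in Set.Ioi (0 : ℝ), ‖K r‖) * ‖v‖ := integral_mul_const _ _
    _ ≤ M * ‖v‖ := mul_le_mul_of_nonneg_right hM (norm_nonneg _)

theorem setIntegral_apply_sub (hK : IntegrableOn K (Set.Ioi 0)) (v v' : E) :
    (∫ r in Set.Ioi (0 : ℝ), K r v) - ∫ r in Set.Ioi (0 : ℝ), K r v' =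
      ∫ r in Set.Ioi (0 : ℝ), K r (v - v') := by
  rw [← integral_sub (hK.apply_continuousLinearMap v) (hK.apply_continuousLinearMap v')]
  simp only [map_sub]

end Convolution

/-! ### The self-consistent Volterra equation -/

section Volterra

variable {E : Type*} [NormedAddCommGroup E] [InnerProductSpace ℂ E] [CompleteSpace E] {N : ℕ}

/-- The coefficients of the Hartree potential: `lam ∑ k, ν j k ⟪y k, T (y k)⟫`. -/
noncomputable def hartreeCoeff (ν : Fin N → Fin N → ℝ) (lam : ℝ) (T : E →L[ℂ] E)
    (y : Fin N → E) (j : Fin N) : ℂ :=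
  (lam : ℂ) * ∑ k, (ν j k : ℂ) * ⟪y k, T (y k)⟫_ℂ

/-- The source term of the Volterra equation. -/
noncomputable def hartreeSource (ν : Fin N → Fin N → ℝ) (lam : ℝ) (T : E →L[ℂ] E)
    (y : Fin N → E) (j : Fin N) : E :=
  hartreeCoeff ν lam T y j • y j

theorem hartree_eq_sum (ζ : Fin N → E) (ν : Fin N → Fin N → ℝ) (lam : ℝ) (γ : E →L[ℂ] E) :
    hartree ζ ν lam γ =
      ∑ j, hartreeCoeff ν lam γ ζ j • InnerProductSpace.rankOne ℂ (ζ j) (ζ j) := by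
  simp only [hartree, hartreeCoeff, Finset.smul_sum, smul_smul]

variable {ν : Fin N → Fin N → ℝ} {lam : ℝ} {T : E →L[ℂ] E} {y y' : Fin N → E} {R δ : ℝ}

theorem norm_hartreeCoeff_le (hlam : 0 ≤ lam) (hT : ‖T‖ ≤ 1) (hy : ∀ k, ‖y k‖ ≤ R) (j : Fin N) :
    ‖hartreeCoeff ν lam T y j‖ ≤ lam * (∑ k, |ν j k|) * R ^ 2 := by
  unfold hartreeCoeff
  rw [norm_mul, Complex.norm_real, Real.norm_of_nonneg hlam, mul_assoc, Finset.sum_mul]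
  refine mul_le_mul_of_nonneg_left ((norm_sum_le _ _).trans
    (Finset.sum_le_sum fun k _ => ?_)) hlam
  rw [norm_mul, Complex.norm_real, Real.norm_eq_abs, sq]
  refine mul_le_mul_of_nonneg_left ((norm_inner_le_norm _ _).trans ?_) (abs_nonneg _)
  have h1 : ‖T (y k)‖ ≤ R := by
    have := T.le_of_opNorm_le hT (y k)
    rw [one_mul] at this
    exact this.trans (hy k)
  exact mul_le_mul (hy k) h1 (norm_nonneg _) ((norm_nonneg _).trans (hy k))

theorem norm_hartreeCoeff_sub_le (hlam : 0 ≤ lam) (hT : ‖T‖ ≤ 1) (hy : ∀ k, ‖y k‖ ≤ R)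
    (hy' : ∀ k, ‖y' k‖ ≤ R) (hδ : ∀ k, ‖y k - y' k‖ ≤ δ) (j : Fin N) :
    ‖hartreeCoeff ν lam T y j - hartreeCoeff ν lam T y' j‖ ≤
      lam * (∑ k, |ν j k|) * (2 * R * δ) := by
  unfold hartreeCoeff
  rw [← mul_sub, ← Finset.sum_sub_distrib, norm_mul, Complex.norm_real, Real.norm_of_nonneg hlam,
    mul_assoc, Finset.sum_mul]
  refine mul_le_mul_of_nonneg_left ((norm_sum_le _ _).trans
    (Finset.sum_le_sum fun k _ => ?_)) hlam
  rw [← mul_sub, norm_mul, Complex.norm_real, Real.norm_eq_abs]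
  refine mul_le_mul_of_nonneg_left ?_ (abs_nonneg _)
  have hTn : ∀ v, ‖T v‖ ≤ ‖v‖ := fun v => by simpa using T.le_of_opNorm_le hT v
  have hR : 0 ≤ R := (norm_nonneg _).trans (hy k)
  have hδ0 : 0 ≤ δ := (norm_nonneg _).trans (hδ k)
  have e : ⟪y k, T (y k)⟫_ℂ - ⟪y' k, T (y' k)⟫_ℂ =
      ⟪y k - y' k, T (y k)⟫_ℂ + ⟪y' k, T (y k - y' k)⟫_ℂ := by
    rw [map_sub, inner_sub_left, inner_sub_right]; ring
  rw [e]
  calc _ ≤ ‖y k - y' k‖ * ‖T (y k)‖ + ‖y' k‖ * ‖T (y k - y' k)‖ :=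
        (norm_add_le _ _).trans (add_le_add (norm_inner_le_norm _ _) (norm_inner_le_norm _ _))
    _ ≤ δ * R + R * δ := by
        gcongr
        · exact hδ k
        · exact (hTn _).trans (hy k)
        · exact hy' k
        · exact (hTn _).trans (hδ k)
    _ = 2 * R * δ := by ring

theorem norm_hartreeSource_le (hlam : 0 ≤ lam) (hT : ‖T‖ ≤ 1) (hy : ∀ k, ‖y k‖ ≤ R) (j : Fin N) :
    ‖hartreeSource ν lam T y j‖ ≤ lam * (∑ k, |ν j k|) * R ^ 3 := by
  unfold hartreeSource
  rw [norm_smul]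
  have h := norm_hartreeCoeff_le (ν := ν) hlam hT hy j
  calc _ ≤ lam * (∑ k, |ν j k|) * R ^ 2 * R :=
        mul_le_mul h (hy j) (norm_nonneg _) ((norm_nonneg _).trans h)
    _ = _ := by ring

/-- The source is cubic: the quadratic coefficient contributes 2 R² δ and the remaining factor R² δ.
-/
theorem norm_hartreeSource_sub_le (hlam : 0 ≤ lam) (hT : ‖T‖ ≤ 1) (hy : ∀ k, ‖y k‖ ≤ R)
    (hy' : ∀ k, ‖y' k‖ ≤ R) (hδ : ∀ k, ‖y k - y' k‖ ≤ δ) (j : Fin N) :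
    ‖hartreeSource ν lam T y j - hartreeSource ν lam T y' j‖ ≤
      lam * (∑ k, |ν j k|) * (3 * R ^ 2 * δ) := by
  unfold hartreeSource
  have e : hartreeCoeff ν lam T y j • y j - hartreeCoeff ν lam T y' j • y' j =
      (hartreeCoeff ν lam T y j - hartreeCoeff ν lam T y' j) • y j +
        hartreeCoeff ν lam T y' j • (y j - y' j) := by
    rw [sub_smul, smul_sub]; abel
  rw [e]
  have h1 := norm_hartreeCoeff_sub_le (ν := ν) hlam hT hy hy' hδ j
  have h2 := norm_hartreeCoeff_le (ν := ν) hlam hT hy' j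
  calc _ ≤ ‖hartreeCoeff ν lam T y j - hartreeCoeff ν lam T y' j‖ * ‖y j‖ +
        ‖hartreeCoeff ν lam T y' j‖ * ‖y j - y' j‖ := by
        rw [← norm_smul, ← norm_smul]; exact norm_add_le _ _
    _ ≤ lam * (∑ k, |ν j k|) * (2 * R * δ) * R + lam * (∑ k, |ν j k|) * R ^ 2 * δ := by
        gcongr
        · exact (norm_nonneg _).trans h1
        · exact hy j
        · exact hδ j
    _ = _ := by ring

/-- The kernel `⟪f, e^{irH} x⟫ e^{-irH}`. -/
noncomputable def returnKernel (H : E →L[ℂ] E) (f x : E) (r : ℝ) : E →L[ℂ] E :=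
  ⟪f, unitaryGroup H r x⟫_ℂ • unitaryGroup H (-r)

theorem continuous_returnKernel (H : E →L[ℂ] E) (f x : E) : Continuous (returnKernel H f x) := by
  unfold returnKernel
  fun_prop

theorem norm_returnKernel_le {H : E →L[ℂ] E} (hH : IsSelfAdjoint H) (f x : E) (r : ℝ) :
    ‖returnKernel H f x r‖ ≤ ‖⟪f, unitaryGroup H r x⟫_ℂ‖ := by
  unfold returnKernel
  rw [norm_smul]
  exact mul_le_of_le_one_right (norm_nonneg _) (norm_unitaryGroup_le hH _)

theorem integrableOn_returnKernel {H : E →L[ℂ] E} (hH : IsSelfAdjoint H) {f x : E}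
    (h : IntegrableOn (fun r => ⟪f, unitaryGroup H r x⟫_ℂ) (Set.Ioi 0)) :
    IntegrableOn (returnKernel H f x) (Set.Ioi 0) :=
  Integrable.mono' h.norm (continuous_returnKernel H f x).aestronglyMeasurable
    (Eventually.of_forall fun r => norm_returnKernel_le hH f x r)

theorem integral_norm_returnKernel_le {H : E →L[ℂ] E} (hH : IsSelfAdjoint H) {f x : E}
    (h : IntegrableOn (fun r => ⟪f, unitaryGroup H r x⟫_ℂ) (Set.Ioi 0)) :
    ∫ r in Set.Ioi (0 : ℝ), ‖returnKernel H f x r‖ ≤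
      ∫ r in Set.Ioi (0 : ℝ), ‖⟪f, unitaryGroup H r x⟫_ℂ‖ :=
  integral_mono (integrableOn_returnKernel hH h).norm h.norm fun r => norm_returnKernel_le hH f x r

/-- Evolution of an observable under the linear dynamics: `e^{-itH} ρ e^{itH}`. -/
noncomputable def freeEvolution (H ρ : E →L[ℂ] E) (t : ℝ) : E →L[ℂ] E :=
  unitaryGroup H (-t) * ρ * unitaryGroup H t

theorem continuous_freeEvolution (H ρ : E →L[ℂ] E) : Continuous (freeEvolution H ρ) := by
  unfold freeEvolution
  fun_prop

theorem norm_freeEvolution_le {H ρ : E →L[ℂ] E} (hH : IsSelfAdjoint H) (hρ : ‖ρ‖ ≤ 1) (t : ℝ) :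
    ‖freeEvolution H ρ t‖ ≤ 1 :=
  (norm_mul_le _ _).trans (mul_le_one₀ ((norm_mul_le _ _).trans (mul_le_one₀
    (norm_unitaryGroup_le hH _) (norm_nonneg _) hρ)) (norm_nonneg _) (norm_unitaryGroup_le hH _))

/-- Assumptions on a coupling: the return amplitudes of the vectors `ζ` are integrable and the
coupling is small compared to their integrals. -/
structure SmallCoupling (H : E →L[ℂ] E) (ζ : Fin N → E) (ν : Fin N → Fin N → ℝ) (lam M : ℝ) :
    Prop where
  isSelfAdjoint : IsSelfAdjoint H
  norm_eq_one : ∀ k, ‖ζ k‖ = 1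
  nonneg : 0 ≤ lam
  integrableOn : ∀ j k, IntegrableOn (fun r => ⟪ζ j, unitaryGroup H r (ζ k)⟫_ℂ) (Set.Ioi 0)
  integral_le : ∀ j k, ∫ r in Set.Ioi (0 : ℝ), ‖⟪ζ j, unitaryGroup H r (ζ k)⟫_ℂ‖ ≤ M
  lt : lam * nuNorm ν * M < 1 / 12

namespace SmallCoupling

variable {H : E →L[ℂ] E} {ζ : Fin N → E} {M : ℝ}

theorem integral_norm_le (h : SmallCoupling H ζ ν lam M) (j k : Fin N) :
    ∫ r in Set.Ioi (0 : ℝ), ‖returnKernel H (ζ j) (ζ k) r‖ ≤ M :=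
  (integral_norm_returnKernel_le h.isSelfAdjoint (h.integrableOn j k)).trans (h.integral_le j k)

theorem nonneg_bound (h : SmallCoupling H ζ ν lam M) (j : Fin N) : 0 ≤ M :=
  (integral_nonneg fun _ => norm_nonneg _).trans (h.integral_le j j)

/-- The limiting equation has at most one solution. -/
theorem limit_unique (h : SmallCoupling H ζ ν lam M) {σ : E →L[ℂ] E} (hσ : ‖σ‖ ≤ 1)
    (hy : ∀ k, ‖y k‖ ≤ 6 / 5) (hy' : ∀ k, ‖y' k‖ ≤ 6 / 5)
    (e : ∀ k, y k = ζ k + Complex.I • ∑ j, ∫ r in Set.Ioi (0 : ℝ),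
      returnKernel H (ζ j) (ζ k) r (hartreeSource ν lam σ y j))
    (e' : ∀ k, y' k = ζ k + Complex.I • ∑ j, ∫ r in Set.Ioi (0 : ℝ),
      returnKernel H (ζ j) (ζ k) r (hartreeSource ν lam σ y' j)) : y = y' := by
  have hδ : ∀ k, ‖y k - y' k‖ ≤ ‖y - y'‖ := fun k => norm_le_pi_norm (y - y') k
  -- The constant is 9 / 25 = (1 / 12) · 3 · (6 / 5)².
  have hle : ‖y - y'‖ ≤ 9 / 25 * ‖y - y'‖ := by
    refine (pi_norm_le_iff_of_nonneg (by positivity)).2 fun k => ?_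
    have hM := h.nonneg_bound k
    rw [Pi.sub_apply, e k, e' k, add_sub_add_left_eq_sub, ← smul_sub, ← Finset.sum_sub_distrib,
      norm_smul, Complex.norm_I, one_mul]
    calc _ ≤ ∑ j, M * (lam * (∑ k, |ν j k|) * (3 * (6 / 5) ^ 2 * ‖y - y'‖)) := by
          refine (norm_sum_le _ _).trans (Finset.sum_le_sum fun j _ => ?_)
          have hi := integrableOn_returnKernel h.isSelfAdjoint (h.integrableOn j k)
          rw [setIntegral_apply_sub hi]
          refine (norm_setIntegral_apply_le hi (h.integral_norm_le j k) _).trans ?_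
          exact mul_le_mul_of_nonneg_left (norm_hartreeSource_sub_le h.nonneg hσ hy hy' hδ j) hM
      _ = lam * nuNorm ν * M * (3 * (6 / 5) ^ 2 * ‖y - y'‖) := by
          rw [nuNorm, Finset.mul_sum, Finset.sum_mul, Finset.sum_mul]
          exact Finset.sum_congr rfl fun j _ => by ring
      _ ≤ 1 / 12 * (3 * (6 / 5) ^ 2 * ‖y - y'‖) :=
          mul_le_mul_of_nonneg_right h.lt.le (by positivity)
      _ = 9 / 25 * ‖y - y'‖ := by ring
  have h0 : ‖y - y'‖ = 0 := by linarith [norm_nonneg (y - y')]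
  exact sub_eq_zero.1 (norm_eq_zero.1 h0)

end SmallCoupling

end Volterra

end HartreeNESS

namespace HartreeNESS

/-! ### Solution of the self-consistent Volterra equation -/

section FixedPoint

variable {E : Type*} [NormedAddCommGroup E] [InnerProductSpace ℂ E] [CompleteSpace E] {N : ℕ}
  {ν : Fin N → Fin N → ℝ} {lam : ℝ}

theorem continuous_hartreeCoeff {X : Type*} [TopologicalSpace X] {T : X → E →L[ℂ] E}
    {y : X → Fin N → E} (hT : Continuous T) (hy : Continuous y) (j : Fin N) :
    Continuous fun s => hartreeCoeff ν lam (T s) (y s) j := by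
  unfold hartreeCoeff
  fun_prop

theorem continuous_hartreeSource {X : Type*} [TopologicalSpace X] {T : X → E →L[ℂ] E}
    {y : X → Fin N → E} (hT : Continuous T) (hy : Continuous y) (j : Fin N) :
    Continuous fun s => hartreeSource ν lam (T s) (y s) j := by
  unfold hartreeSource
  have := continuous_hartreeCoeff (ν := ν) (lam := lam) hT hy j
  fun_prop

theorem tendsto_hartreeCoeff {T : ℝ → E →L[ℂ] E} {σ : E →L[ℂ] E} {y : ℝ → Fin N → E}
    {l : Fin N → E} {C : ℝ} (hC : ∀ t, ‖T t‖ ≤ C) (hT : IsStrongLimit T σ)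
    (hy : Tendsto y atTop (𝓝 l)) (j : Fin N) :
    Tendsto (fun s => hartreeCoeff ν lam (T s) (y s) j) atTop (𝓝 (hartreeCoeff ν lam σ l j)) := by
  unfold hartreeCoeff
  refine Tendsto.const_mul _ (tendsto_finsetSum _ fun k _ => Tendsto.const_mul _ ?_)
  have hk := (tendsto_pi_nhds.1 hy) k
  exact hk.inner (tendsto_apply_of_strong (fun t _ => hC t) hT hk)

theorem tendsto_hartreeSource {T : ℝ → E →L[ℂ] E} {σ : E →L[ℂ] E} {y : ℝ → Fin N → E}
    {l : Fin N → E} {C : ℝ} (hC : ∀ t, ‖T t‖ ≤ C) (hT : IsStrongLimit T σ)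
    (hy : Tendsto y atTop (𝓝 l)) (j : Fin N) :
    Tendsto (fun s => hartreeSource ν lam (T s) (y s) j) atTop
      (𝓝 (hartreeSource ν lam σ l j)) :=
  (tendsto_hartreeCoeff hC hT hy j).smul ((tendsto_pi_nhds.1 hy) j)

/-- The right-hand side of the Volterra equation. -/
noncomputable def volterraMap (H : E →L[ℂ] E) (ζ : Fin N → E) (ν : Fin N → Fin N → ℝ) (lam : ℝ)
    (ρ : E →L[ℂ] E) (y : ℝ → Fin N → E) (t : ℝ) (k : Fin N) : E :=
  ζ k + Complex.I • ∑ j, causalConv (returnKernel H (ζ j) (ζ k))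
    (fun s => hartreeSource ν lam (freeEvolution H ρ s) (y s) j) t

variable {H ρ σ : E →L[ℂ] E} {ζ : Fin N → E} {M : ℝ}

theorem continuous_volterraMap {y : ℝ → Fin N → E} (hy : Continuous y) :
    Continuous (volterraMap H ζ ν lam ρ y) := by
  refine continuous_pi fun k => ?_
  unfold volterraMap
  refine continuous_const.add (Continuous.const_smul (continuous_finsetSum _ fun j _ => ?_) _)
  exact continuous_causalConv (continuous_returnKernel _ _ _)
    (continuous_hartreeSource (continuous_freeEvolution H ρ) hy j)

namespace SmallCoupling

theorem sum_bound (h : SmallCoupling H ζ ν lam M) {B : ℝ} (hB : 0 ≤ B) :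
    ∑ j, M * (lam * (∑ k, |ν j k|) * B) ≤ 1 / 12 * B := by
  have e : ∑ j, M * (lam * (∑ k, |ν j k|) * B) = lam * nuNorm ν * M * B := by
    rw [nuNorm, Finset.mul_sum, Finset.sum_mul, Finset.sum_mul]
    exact Finset.sum_congr rfl fun j _ => by ring
  rw [e]
  exact mul_le_mul_of_nonneg_right h.lt.le hB

/-- The radius 6 / 5 works because 1 + (1 / 12) (6 / 5)³ = 1.144. This and the contraction constant
9 / 25 are where the 12 in λ₀ is used. -/
theorem norm_volterraMap_le (h : SmallCoupling H ζ ν lam M) (hρ : ‖ρ‖ ≤ 1) {y : ℝ → Fin N → E}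
    (hy : ∀ t, ‖y t‖ ≤ 6 / 5) (t : ℝ) : ‖volterraMap H ζ ν lam ρ y t‖ ≤ 6 / 5 := by
  refine (pi_norm_le_iff_of_nonneg (by norm_num)).2 fun k => ?_
  unfold volterraMap
  set w := ∑ j, causalConv (returnKernel H (ζ j) (ζ k))
      (fun s => hartreeSource ν lam (freeEvolution H ρ s) (y s) j) t with hw
  have h1 : ‖w‖ ≤ 1 / 12 * (6 / 5) ^ 3 := by
    refine ((norm_sum_le _ _).trans (Finset.sum_le_sum fun j _ => ?_)).trans
      (h.sum_bound (B := (6 / 5) ^ 3) (by positivity))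
    exact norm_causalConv_le (integrableOn_returnKernel h.isSelfAdjoint (h.integrableOn j k))
      (h.integral_norm_le j k) (fun s => norm_hartreeSource_le h.nonneg
        (norm_freeEvolution_le h.isSelfAdjoint hρ s)
        (fun k => (norm_le_pi_norm _ k).trans (hy s)) j) t
  calc _ ≤ ‖ζ k‖ + ‖Complex.I • w‖ := norm_add_le _ _
    _ ≤ 1 + 1 / 12 * (6 / 5) ^ 3 := by
        rw [h.norm_eq_one, norm_smul, Complex.norm_I, one_mul]
        exact add_le_add le_rfl h1
    _ ≤ 6 / 5 := by norm_num

theorem norm_volterraMap_sub_le (h : SmallCoupling H ζ ν lam M) (hρ : ‖ρ‖ ≤ 1)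
    {y y' : ℝ → Fin N → E} (hyc : Continuous y) (hyc' : Continuous y') (hy : ∀ t, ‖y t‖ ≤ 6 / 5)
    (hy' : ∀ t, ‖y' t‖ ≤ 6 / 5) {δ : ℝ} (hδ : ∀ t, ‖y t - y' t‖ ≤ δ) (t : ℝ) :
    ‖volterraMap H ζ ν lam ρ y t - volterraMap H ζ ν lam ρ y' t‖ ≤ 9 / 25 * δ := by
  have hδ0 : 0 ≤ δ := (norm_nonneg _).trans (hδ 0)
  refine (pi_norm_le_iff_of_nonneg (by positivity)).2 fun k => ?_
  rw [Pi.sub_apply]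
  unfold volterraMap
  rw [add_sub_add_left_eq_sub, ← smul_sub, ← Finset.sum_sub_distrib, norm_smul, Complex.norm_I,
    one_mul]
  calc _ ≤ 1 / 12 * (3 * (6 / 5) ^ 2 * δ) := by
        refine ((norm_sum_le _ _).trans (Finset.sum_le_sum fun j _ => ?_)).trans
          (h.sum_bound (B := 3 * (6 / 5) ^ 2 * δ) (by positivity))
        rw [causalConv_sub (continuous_returnKernel _ _ _)
          (continuous_hartreeSource (continuous_freeEvolution H ρ) hyc j)
          (continuous_hartreeSource (continuous_freeEvolution H ρ) hyc' j)]
        exact norm_causalConv_le (integrableOn_returnKernel h.isSelfAdjoint (h.integrableOn j k))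
          (h.integral_norm_le j k) (fun s => norm_hartreeSource_sub_le h.nonneg
          (norm_freeEvolution_le h.isSelfAdjoint hρ s)
          (fun k => (norm_le_pi_norm _ k).trans (hy s))
          (fun k => (norm_le_pi_norm _ k).trans (hy' s))
          (fun k => (norm_le_pi_norm (y s - y' s) k).trans (hδ s)) j) t
    _ = 9 / 25 * δ := by ring

theorem tendsto_volterraMap (h : SmallCoupling H ζ ν lam M) (hρ : ‖ρ‖ ≤ 1)
    (hσ : IsStrongLimit (freeEvolution H ρ) σ) {y : ℝ → Fin N → E} (hyc : Continuous y)
    (hy : ∀ t, ‖y t‖ ≤ 6 / 5) {l : Fin N → E} (hl : Tendsto y atTop (𝓝 l)) :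
    Tendsto (volterraMap H ζ ν lam ρ y) atTop (𝓝 fun k => ζ k + Complex.I •
      ∑ j, ∫ r in Set.Ioi (0 : ℝ),
        returnKernel H (ζ j) (ζ k) r (hartreeSource ν lam σ l j)) := by
  refine tendsto_pi_nhds.2 fun k => ?_
  unfold volterraMap
  refine tendsto_const_nhds.add (Tendsto.const_smul (tendsto_finsetSum _ fun j _ => ?_) _)
  exact tendsto_causalConv (continuous_returnKernel _ _ _)
    (integrableOn_returnKernel h.isSelfAdjoint (h.integrableOn j k))
    (continuous_hartreeSource (continuous_freeEvolution H ρ) hyc j)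
    (fun s => norm_hartreeSource_le h.nonneg (norm_freeEvolution_le h.isSelfAdjoint hρ s)
        (fun k => (norm_le_pi_norm _ k).trans (hy s)) j)
    (tendsto_hartreeSource (norm_freeEvolution_le h.isSelfAdjoint hρ) hσ hl j)

end SmallCoupling

theorem isClosed_bounded_convergent {F : Type*} [NormedAddCommGroup F] [CompleteSpace F] (R : ℝ) :
    IsClosed {y : BoundedContinuousFunction ℝ F |
      (∀ t, ‖y t‖ ≤ R) ∧ ∃ l, Tendsto y atTop (𝓝 l)} := by
  refine isClosed_of_closure_subset fun y hy => ⟨fun t => ?_, ?_⟩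
  · have hc : IsClosed {z : BoundedContinuousFunction ℝ F | ‖z t‖ ≤ R} :=
      isClosed_le (by fun_prop) continuous_const
    exact closure_minimal (fun z hz => hz.1 t) hc hy
  · rw [← cauchy_map_iff_exists_tendsto, Metric.cauchy_iff]
    refine ⟨inferInstance, fun ε hε => ?_⟩
    obtain ⟨z, ⟨-, l, hl⟩, hyz⟩ := Metric.mem_closure_iff.1 hy (ε / 4) (by positivity)
    refine ⟨y '' {t | dist (z t) l < ε / 4},
      image_mem_map (hl (Metric.ball_mem_nhds l (by positivity))), ?_⟩
    rintro - ⟨s, hs, rfl⟩ - ⟨t, ht, rfl⟩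
    have h1 := (BoundedContinuousFunction.dist_coe_le_dist s).trans_lt hyz
    have h2 := (BoundedContinuousFunction.dist_coe_le_dist t).trans_lt hyz
    have hs' : dist (z s) l < ε / 4 := hs
    have ht' : dist (z t) l < ε / 4 := ht
    calc dist (y s) (y t) ≤ dist (y s) (z s) + dist (z s) (y t) := dist_triangle _ _ _
      _ ≤ dist (y s) (z s) + (dist (z s) l + dist (y t) l) := by
          gcongr; exact dist_triangle_right _ _ _
      _ ≤ dist (y s) (z s) + (dist (z s) l + (dist (y t) (z t) + dist (z t) l)) := by
          gcongr; exact dist_triangle _ _ _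
      _ < ε := by linarith

/-- Solvability of the Volterra equation, with convergence of the solution. -/
theorem SmallCoupling.exists_volterra (h : SmallCoupling H ζ ν lam M) (hρ : ‖ρ‖ ≤ 1)
    (hσ : IsStrongLimit (freeEvolution H ρ) σ) :
    ∃ (y : ℝ → Fin N → E) (l : Fin N → E), Continuous y ∧ (∀ t k, ‖y t k‖ ≤ 6 / 5) ∧
      (∀ t k, y t k = volterraMap H ζ ν lam ρ y t k) ∧ Tendsto y atTop (𝓝 l) ∧
      (∀ k, ‖l k‖ ≤ 6 / 5) ∧
      ∀ k, l k = ζ k + Complex.I • ∑ j, ∫ r in Set.Ioi (0 : ℝ),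
        returnKernel H (ζ j) (ζ k) r (hartreeSource ν lam σ l j) := by
  -- The existence of a limit at infinity is built into the complete space on which the fixed point
  -- is sought, so the solution converges automatically.
  let S : Set (BoundedContinuousFunction ℝ (Fin N → E)) :=
    {y | (∀ t, ‖y t‖ ≤ 6 / 5) ∧ ∃ l, Tendsto y atTop (𝓝 l)}
  have hS : IsComplete S := (isClosed_bounded_convergent (6 / 5)).isComplete
  have : CompleteSpace S := completeSpace_coe_iff_isComplete.2 hS
  let Φ : S → S := fun y => ⟨BoundedContinuousFunction.ofNormedAddCommGroup
      (volterraMap H ζ ν lam ρ y.1) (continuous_volterraMap y.1.continuous) (6 / 5)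
      (h.norm_volterraMap_le hρ y.2.1),
    h.norm_volterraMap_le hρ y.2.1, by
      obtain ⟨l, hl⟩ := y.2.2
      exact ⟨_, h.tendsto_volterraMap hρ hσ y.1.continuous y.2.1 hl⟩⟩
  have hΦ : ContractingWith (9 / 25 : ℝ≥0) Φ := by
    refine ⟨by rw [div_lt_one₀] <;> norm_num, LipschitzWith.of_dist_le_mul fun y z => ?_⟩
    rw [Subtype.dist_eq]
    refine (BoundedContinuousFunction.dist_le (by positivity)).2 fun t => ?_
    rw [dist_eq_norm]
    refine (h.norm_volterraMap_sub_le hρ y.1.continuous z.1.continuous y.2.1 z.2.1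
      (δ := dist y z) (fun s => ?_) t).trans (le_of_eq ?_)
    · rw [← dist_eq_norm]
      exact BoundedContinuousFunction.dist_coe_le_dist s
    · norm_num
  have : Nonempty S := ⟨⟨0, fun t => by simp; norm_num, 0, tendsto_const_nhds⟩⟩
  obtain ⟨l, hl⟩ := (hΦ.fixedPoint Φ).2.2
  have hfix : Φ (hΦ.fixedPoint Φ) = hΦ.fixedPoint Φ := hΦ.fixedPoint_isFixedPt
  set z := hΦ.fixedPoint Φ with hz
  have e : volterraMap H ζ ν lam ρ z.1 = z.1 := by
    have := congrArg (fun w : S => (w.1 : ℝ → Fin N → E)) hfix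
    exact this
  refine ⟨z.1, l, z.1.continuous, fun t k => (norm_le_pi_norm _ k).trans (z.2.1 t),
    fun t k => by rw [e], hl, fun k => ?_, fun k => ?_⟩
  · exact (norm_le_pi_norm _ k).trans (le_of_tendsto hl.norm (Eventually.of_forall z.2.1))
  · have h1 := h.tendsto_volterraMap hρ hσ z.1.continuous z.2.1 hl
    rw [e] at h1
    exact congrFun (tendsto_nhds_unique hl h1) k

end FixedPoint

end HartreeNESS

namespace HartreeNESS

/-! ### The self-consistent propagator -/

section Propagator

variable {E : Type*} [NormedAddCommGroup E] [InnerProductSpace ℂ E] [CompleteSpace E] {N : ℕ}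
  {ν : Fin N → Fin N → ℝ} {lam : ℝ} {H ρ σ : E →L[ℂ] E} {ζ : Fin N → E} {M : ℝ}

/-- `1 + i ∫₀ᵗ ∑ j, |e^{isH} w_j(s)⟩⟨e^{isH} ζ_j| ds`. -/
noncomputable def dressing (H : E →L[ℂ] E) (ζ : Fin N → E) (w : ℝ → Fin N → E) (t : ℝ) :
    E →L[ℂ] E :=
  1 + Complex.I • ∫ s in (0)..t, ∑ j,
    InnerProductSpace.rankOne ℂ (unitaryGroup H s (w s j)) (unitaryGroup H s (ζ j))

theorem continuous_rankOne {X : Type*} [TopologicalSpace X] {f g : X → E} (hf : Continuous f)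
    (hg : Continuous g) : Continuous fun s => InnerProductSpace.rankOne ℂ (f s) (g s) := by
  have h1 : Continuous fun s => innerSL ℂ (g s) := (innerSL ℂ).continuous.comp hg
  exact (continuous_const (y := ContinuousLinearMap.smulRightL ℂ E E)).clm_apply h1 |>.clm_apply hf

theorem continuous_dressing_integrand {w : ℝ → Fin N → E} (hw : Continuous w) :
    Continuous fun s => ∑ j,
      InnerProductSpace.rankOne ℂ (unitaryGroup H s (w s j)) (unitaryGroup H s (ζ j)) :=
  continuous_finsetSum _ fun j _ => continuous_rankOne (by fun_prop) (by fun_prop)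

theorem hasDerivAt_dressing {w : ℝ → Fin N → E} (hw : Continuous w) (t : ℝ) :
    HasDerivAt (dressing H ζ w) (Complex.I • ∑ j,
      InnerProductSpace.rankOne ℂ (unitaryGroup H t (w t j)) (unitaryGroup H t (ζ j))) t := by
  unfold dressing
  have hc := continuous_dressing_integrand (H := H) (ζ := ζ) hw
  exact ((intervalIntegral.integral_hasDerivAt_right (hc.intervalIntegrable _ _)
    (hc.stronglyMeasurableAtFilter _ _) hc.continuousAt).const_smul Complex.I).const_add 1

theorem unitaryGroup_dressing_apply (hH : IsSelfAdjoint H) {w : ℝ → Fin N → E}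
    (hw : Continuous w) {t : ℝ} (ht : 0 ≤ t) (x : E) :
    unitaryGroup H (-t) (dressing H ζ w t (unitaryGroup H t x)) =
      x + Complex.I • ∑ j, causalConv (returnKernel H (ζ j) x) (fun s => w s j) t := by
  have hc := continuous_dressing_integrand (H := H) (ζ := ζ) hw
  unfold dressing
  rw [add_apply, smul_apply, map_add, map_smul, one_apply_eq_self, unitaryGroup_neg_apply_apply]
  congr 2
  rw [ContinuousLinearMap.intervalIntegral_apply (hc.intervalIntegrable _ _),
    ← ContinuousLinearMap.intervalIntegral_comp_comm _
      (Continuous.intervalIntegrable (by fun_prop) _ _)]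
  unfold causalConv
  rw [max_eq_left ht, ← intervalIntegral.integral_finsetSum fun j _ =>
    Continuous.intervalIntegrable (by
      have := continuous_returnKernel H (ζ j) x
      fun_prop) _ _]
  -- The substitution r = t - s turns e^{-itH} e^{isH} into e^{-irH}, which gives the convolution
  -- form.
  have e := intervalIntegral.integral_comp_sub_left (a := 0) (b := t)
    (fun s => ∑ j, returnKernel H (ζ j) x s (w (t - s) j)) t
  rw [sub_self, sub_zero] at e
  rw [← e]
  refine intervalIntegral.integral_congr fun s _ => ?_
  simp only [sum_apply, InnerProductSpace.rankOne_apply, map_sum, map_smul, returnKernel,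
    smul_apply, inner_unitaryGroup_left hH, sub_sub_cancel, neg_sub]
  refine Finset.sum_congr rfl fun j _ => ?_
  rw [← mul_apply_eq_comp, ← mul_apply_eq_comp, ← unitaryGroup_add, ← unitaryGroup_add,
    neg_add_eq_sub, neg_add_eq_sub]

/-- The nonlinear term of the Hartree equation at `U ρ U*`, in terms of `U* ζ`. -/
theorem hartreeCoeff_conj (U : E →L[ℂ] E) (j : Fin N) :
    hartreeCoeff ν lam (U * ρ * star U) ζ j = hartreeCoeff ν lam ρ (fun k => star U (ζ k)) j := by
  simp only [hartreeCoeff, mul_apply_eq_comp, ContinuousLinearMap.star_eq_adjoint,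
    ContinuousLinearMap.adjoint_inner_left]

/-- Together with `hartreeCoeff_conj` this identifies the Hartree coefficients at U ρ U* with those
of the interaction picture vectors. -/
theorem hartreeCoeff_freeEvolution (hH : IsSelfAdjoint H) (y : Fin N → E) (t : ℝ) (j : Fin N) :
    hartreeCoeff ν lam (freeEvolution H ρ t) y j =
      hartreeCoeff ν lam ρ (fun k => unitaryGroup H t (y k)) j := by
  simp only [hartreeCoeff, freeEvolution, mul_apply_eq_comp, inner_unitaryGroup_left hH]

theorem isSelfAdjoint_hartree (ζ : Fin N → E) (ν : Fin N → Fin N → ℝ) (lam : ℝ)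
    (hρ : IsSelfAdjoint ρ) : IsSelfAdjoint (hartree ζ ν lam ρ) := by
  unfold hartree
  refine isSelfAdjoint_clm_smul lam (isSelfAdjoint_sum _ fun j _ => ?_)
  have e : ∑ k, (ν j k : ℂ) * ⟪ζ k, ρ (ζ k)⟫_ℂ =
      ((∑ k, ν j k * (⟪ζ k, ρ (ζ k)⟫_ℂ).re : ℝ) : ℂ) := by
    push_cast
    exact Finset.sum_congr rfl fun k _ => by rw [← inner_apply_self_eq_re hρ]
  rw [e]
  refine isSelfAdjoint_clm_smul _ ?_
  rw [ContinuousLinearMap.isSelfAdjoint_iff', InnerProductSpace.adjoint_rankOne]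

theorem hartree_apply (ζ : Fin N → E) (ν : Fin N → Fin N → ℝ) (lam : ℝ) (γ : E →L[ℂ] E) (x : E) :
    hartree ζ ν lam γ x = ∑ j, (hartreeCoeff ν lam γ ζ j * ⟪ζ j, x⟫_ℂ) • ζ j := by
  rw [hartree_eq_sum, sum_apply]
  simp only [smul_apply, InnerProductSpace.rankOne_apply, smul_smul]

/-- In infinite dimensions both one-sided inverses are needed. V U is constant, whereas U V - 1
solves a homogeneous linear equation with zero initial value and vanishes by Grönwall. -/
theorem mul_eq_one_of_hasDerivAt {K U V : ℝ → E →L[ℂ] E} (hK : Continuous K)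
    (h0 : V 0 * U 0 = 1) (h0' : U 0 * V 0 = 1) (hU : ∀ t, 0 ≤ t → HasDerivAt U (-(Complex.I • (K t * U t))) t)
    (hV : ∀ t, 0 ≤ t → HasDerivAt V (Complex.I • (V t * K t)) t) {t : ℝ} (ht : 0 ≤ t) :
    V t * U t = 1 ∧ U t * V t = 1 := by
  have hVU : ∀ s, 0 ≤ s → HasDerivAt (fun s => V s * U s) 0 s := fun s hs => by
    refine ((hV s hs).mul (hU s hs)).congr_deriv ?_
    rw [mul_neg, mul_smul_comm, smul_mul_assoc, mul_assoc, add_neg_cancel]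
  have hUV : ∀ s, 0 ≤ s → HasDerivAt (fun s => U s * V s - 1)
      (-(Complex.I • (K s * (U s * V s - 1) - (U s * V s - 1) * K s))) s := fun s hs => by
    refine (((hU s hs).mul (hV s hs)).sub_const 1).congr_deriv ?_
    simp only [neg_mul, smul_mul_assoc, mul_smul_comm, mul_sub, sub_mul, mul_one, one_mul,
      mul_assoc, smul_sub]
    abel
  obtain ⟨C, hC⟩ := (isCompact_Icc (a := 0) (b := t)).exists_bound_of_continuousOn hK.continuousOn
  constructor
  · rw [← h0]
    exact constant_of_has_deriv_right_zero (a := 0) (b := t)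
      (fun s hs => (hVU s hs.1).continuousAt.continuousWithinAt)
      (fun s hs => (hVU s hs.1).hasDerivWithinAt) t ⟨ht, le_rfl⟩
  · refine sub_eq_zero.1 (eq_zero_of_abs_deriv_le_mul_abs_self_of_eq_zero_right
      (f := fun s => U s * V s - 1) (K := 2 * C) (a := 0) (b := t)
      (fun s hs => (hUV s hs.1).continuousAt.continuousWithinAt)
      (fun s hs => (hUV s hs.1).hasDerivWithinAt) (sub_eq_zero.2 h0') (fun s hs => ?_) t
      ⟨ht, le_rfl⟩)
    rw [norm_neg, norm_smul, Complex.norm_I, one_mul]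
    have hCs := hC s ⟨hs.1, hs.2.le⟩
    have h1 : ‖K s * (U s * V s - 1)‖ ≤ C * ‖U s * V s - 1‖ :=
      (norm_mul_le _ _).trans (mul_le_mul_of_nonneg_right hCs (norm_nonneg _))
    have h2 : ‖(U s * V s - 1) * K s‖ ≤ ‖U s * V s - 1‖ * C :=
      (norm_mul_le _ _).trans (mul_le_mul_of_nonneg_left hCs (norm_nonneg _))
    linarith [norm_sub_le (K s * (U s * V s - 1)) ((U s * V s - 1) * K s)]

/-- The nonlinear evolution, constructed from the solution of the Volterra equation. -/
theorem SmallCoupling.exists_propagator (h : SmallCoupling H ζ ν lam M) (hρ : ‖ρ‖ ≤ 1)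
    (hρs : IsSelfAdjoint ρ) (hσ : IsStrongLimit (freeEvolution H ρ) σ) :
    ∃ (U : ℝ → E →L[ℂ] E) (y : ℝ → Fin N → E) (l : Fin N → E),
      U 0 = 1 ∧
      (∀ t, 0 ≤ t → HasDerivAt U
        (-(Complex.I • ((H + hartree ζ ν lam (U t * ρ * star (U t))) * U t))) t) ∧
      (∀ t, 0 ≤ t → U t ∈ unitary (E →L[ℂ] E)) ∧
      (∀ t x, 0 ≤ t → unitaryGroup H (-t) (star (U t) x) =
        x + Complex.I • ∑ j, causalConv (returnKernel H (ζ j) x)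
          (fun s => hartreeSource ν lam (freeEvolution H ρ s) (y s) j) t) ∧
      (∀ t k, 0 ≤ t → unitaryGroup H (-t) (star (U t) (ζ k)) = y t k) ∧
      Continuous y ∧ (∀ t k, ‖y t k‖ ≤ 6 / 5) ∧ Tendsto y atTop (𝓝 l) ∧ (∀ k, ‖l k‖ ≤ 6 / 5) ∧
      ∀ k, l k = ζ k + Complex.I • ∑ j, ∫ r in Set.Ioi (0 : ℝ),
        returnKernel H (ζ j) (ζ k) r (hartreeSource ν lam σ l j) := by
  obtain ⟨y, l, hyc, hy, hye, hyl, hl, hle⟩ := h.exists_volterra hρ hσ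
  have hH := h.isSelfAdjoint
  set w : ℝ → Fin N → E := fun s j => hartreeSource ν lam (freeEvolution H ρ s) (y s) j with hw
  have hwc : Continuous w := continuous_pi fun j =>
    continuous_hartreeSource (continuous_freeEvolution H ρ) hyc j
  -- V is the candidate for U*. It is an explicit integral in the already known y, so no further
  -- fixed point is required.
  set V : ℝ → E →L[ℂ] E := fun t => dressing H ζ w t * unitaryGroup H t with hVdef
  have hVx : ∀ t x, 0 ≤ t → unitaryGroup H (-t) (V t x) =
      x + Complex.I • ∑ j, causalConv (returnKernel H (ζ j) x) (fun s => w s j) t :=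
    fun t x ht => unitaryGroup_dressing_apply hH hwc ht x
  have hVy : ∀ t k, 0 ≤ t → unitaryGroup H (-t) (V t (ζ k)) = y t k := fun t k ht => by
    rw [hVx t _ ht, hye t k]
    rfl
  have hVy' : ∀ t k, 0 ≤ t → V t (ζ k) = unitaryGroup H t (y t k) := fun t k ht => by
    rw [← hVy t k ht, unitaryGroup_apply_neg_apply]
  set K : ℝ → E →L[ℂ] E := fun t => H + hartree ζ ν lam (star (V t) * ρ * V t) with hK
  have hKs : ∀ t, IsSelfAdjoint (K t) := fun t =>
    isSelfAdjoint_clm_add hH (isSelfAdjoint_hartree ζ ν lam (hρs.conjugate' (V t)))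
  -- The derivative of the dressing contributes ∑ |e^{itH} w_j⟩⟨ζ_j|. Since V ζ_j = e^{itH} y_j,
  -- this equals V times the Hartree potential of V* ρ V, so the self-consistency closes.
  have hVd : ∀ t, 0 ≤ t → HasDerivAt V (Complex.I • (V t * K t)) t := fun t ht => by
    refine ((hasDerivAt_dressing hwc t).mul (hasDerivAt_unitaryGroup' H t)).congr_deriv ?_
    ext x
    simp only [hK, mul_apply_eq_comp, add_apply, smul_apply, sum_apply, map_add, map_smul, smul_add,
      InnerProductSpace.rankOne_apply, hartree_apply, map_sum, hVy' t _ ht, mul_smul]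
    rw [add_comm]
    congr 2
    refine Finset.sum_congr rfl fun j _ => ?_
    rw [inner_unitaryGroup_left hH, unitaryGroup_neg_apply_apply, smul_comm]
    congr 1
    rw [hw]
    simp only [hartreeSource, map_smul]
    congr 1
    have e := hartreeCoeff_conj (ν := ν) (lam := lam) (ρ := ρ) (ζ := ζ) (star (V t)) j
    rw [star_star] at e
    rw [e, hartreeCoeff_freeEvolution hH]
    simp only [hVy' t _ ht]
  have hUd : ∀ t, 0 ≤ t → HasDerivAt (fun t => star (V t)) (-(Complex.I • (K t * star (V t)))) t :=
    fun t ht => by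
      refine (hVd t ht).star.congr_deriv ?_
      rw [star_smul, star_mul, (hKs t).star_eq]
      simp
  have hV0 : V 0 = 1 := by
    simp [hVdef, dressing, unitaryGroup_zero]
  have hVc : Continuous V := by
    refine Continuous.mul ?_ (by fun_prop)
    exact continuous_iff_continuousAt.2 fun t => (hasDerivAt_dressing hwc t).continuousAt
  have hKc : Continuous K := by
    rw [hK]
    unfold hartree
    fun_prop
  have hun : ∀ t, 0 ≤ t → V t * star (V t) = 1 ∧ star (V t) * V t = 1 := fun t ht =>
    mul_eq_one_of_hasDerivAt hKc (by simp [hV0]) (by simp [hV0]) hUd hVd ht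
  refine ⟨fun t => star (V t), y, l, by simp [hV0], fun t ht => ?_, fun t ht => ?_,
    fun t x ht => ?_, fun t k ht => ?_, hyc, hy, hyl, hl, hle⟩
  · simpa only [star_star] using hUd t ht
  · exact Unitary.mem_iff.2 (by simpa only [star_star] using hun t ht)
  · simpa only [star_star] using hVx t x ht
  · simpa only [star_star] using hVy t k ht

end Propagator

end HartreeNESS

namespace HartreeNESS

/-! ### Large time asymptotics of the propagator -/

section Asymptotics

variable {E : Type*} [NormedAddCommGroup E] [InnerProductSpace ℂ E] [CompleteSpace E] {N : ℕ}
  {ν : Fin N → Fin N → ℝ} {lam : ℝ} {H ρ ρ' σ : E →L[ℂ] E} {ζ : Fin N → E} {M : ℝ}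

/-- Vectors whose return amplitudes to the vectors `ζ` are integrable. -/
def returnDomain (H : E →L[ℂ] E) (ζ : Fin N → E) : Set E :=
  {x | ∀ j, IntegrableOn (fun r => ⟪ζ j, unitaryGroup H r x⟫_ℂ) (Set.Ioi 0)}

/-- `U` solves the Hartree equation with initial state `ρ`, and `A` is its asymptotic part when the
linear evolution of `ρ` converges to `σ`. -/
structure IsHartreeFlow (H ρ σ : E →L[ℂ] E) (ζ : Fin N → E) (ν : Fin N → Fin N → ℝ) (lam : ℝ)
    (U : ℝ → E →L[ℂ] E) (A : E →L[ℂ] E) : Prop where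
  zero : U 0 = 1
  hasDerivAt : ∀ t, 0 ≤ t → HasDerivAt U
    (-(Complex.I • ((H + hartree ζ ν lam (U t * ρ * star (U t))) * U t))) t
  mem_unitary : ∀ t, 0 ≤ t → U t ∈ unitary (E →L[ℂ] E)
  strongLimit : IsStrongLimit (fun t => unitaryGroup H (-t) * star (U t)) A
  tendsto_inner : ∀ x y, Tendsto (fun t => ⟪x, (U t * ρ * star (U t)) y⟫_ℂ) atTop
    (𝓝 ⟪x, (star A * σ * A) y⟫_ℂ)

theorem norm_le_one_of_mem_unitary {U : E →L[ℂ] E} (hU : U ∈ unitary (E →L[ℂ] E)) : ‖U‖ ≤ 1 := by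
  refine U.opNorm_le_bound zero_le_one fun x => ?_
  have h := (Unitary.mem_iff.1 hU).1
  have e : ⟪U x, U x⟫_ℂ = ⟪x, x⟫_ℂ := by
    rw [← ContinuousLinearMap.adjoint_inner_right, ← ContinuousLinearMap.star_eq_adjoint,
      ← mul_apply_eq_comp, h, one_apply_eq_self]
  rw [@norm_eq_sqrt_re_inner ℂ, e, ← @norm_eq_sqrt_re_inner ℂ, one_mul]

/-- The form is ⟪Y x, (e^{-itH} ρ e^{itH}) Y y⟫ with Y = e^{-itH} U*. Both Y and the free evolution
converge strongly; the convergence obtained for the state is weak, since Y* need not converge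
strongly. -/
theorem tendsto_inner_conj (hH : IsSelfAdjoint H) (hρ : ‖ρ‖ ≤ 1)
    (hσ : IsStrongLimit (freeEvolution H ρ) σ) {U : ℝ → E →L[ℂ] E} {A : E →L[ℂ] E}
    (hA : IsStrongLimit (fun t => unitaryGroup H (-t) * star (U t)) A) (x y : E) :
    Tendsto (fun t => ⟪x, (U t * ρ * star (U t)) y⟫_ℂ) atTop (𝓝 ⟪x, (star A * σ * A) y⟫_ℂ) := by
  have h1 := (hA x).inner (𝕜 := ℂ)
    (tendsto_apply_of_strong (fun t _ => norm_freeEvolution_le hH hρ t) hσ (hA y))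
  have e : ⟪x, (star A * σ * A) y⟫_ℂ = ⟪A x, σ (A y)⟫_ℂ := by
    rw [mul_apply_eq_comp, mul_apply_eq_comp, ContinuousLinearMap.star_eq_adjoint,
      ContinuousLinearMap.adjoint_inner_right]
  rw [e]
  refine h1.congr fun t => ?_
  simp only [mul_apply_eq_comp, freeEvolution, inner_unitaryGroup_left hH, neg_neg,
    unitaryGroup_apply_neg_apply]
  rw [ContinuousLinearMap.star_eq_adjoint, ContinuousLinearMap.adjoint_inner_left]

/-- The intertwining relation satisfied by the asymptotic part of the propagator. -/
theorem IsHartreeFlow.intertwine {U : ℝ → E →L[ℂ] E} {A : E →L[ℂ] E}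
    (h : IsHartreeFlow H ρ σ ζ ν lam U A) (hH : IsSelfAdjoint H) (hρ : IsSelfAdjoint ρ) :
    H ∘L A = A ∘L (H + hartree ζ ν lam (star A * σ * A)) := by
  set K : ℝ → E →L[ℂ] E := fun t => H + hartree ζ ν lam (U t * ρ * star (U t)) with hK
  have hKs : ∀ t, star (K t) = K t := fun t =>
    (isSelfAdjoint_clm_add hH (isSelfAdjoint_hartree ζ ν lam (hρ.conjugate (U t)))).star_eq
  set Y : ℝ → E →L[ℂ] E := fun t => unitaryGroup H (-t) * star (U t) with hY
  have hYn : ∀ t, 0 ≤ t → ‖Y t‖ ≤ 1 := fun t ht =>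
    (norm_mul_le _ _).trans (mul_le_one₀ (norm_unitaryGroup_le hH _) (norm_nonneg _)
      (by rw [norm_star]; exact norm_le_one_of_mem_unitary (h.mem_unitary t ht)))
  have hYd : ∀ t, 0 ≤ t → HasDerivAt Y (Complex.I • (Y t * K t - H * Y t)) t := fun t ht => by
    refine ((hasDerivAt_unitaryGroup_neg H t).mul (h.hasDerivAt t ht).star).congr_deriv ?_
    rw [star_neg, star_smul, star_mul, hKs]
    simp only [Complex.star_def, Complex.conj_I, neg_smul, neg_neg, neg_mul, smul_mul_assoc,
      mul_smul_comm, smul_sub, mul_assoc, hY]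
    abel
  ext x
  have hKx : Tendsto (fun t => K t x) atTop
      (𝓝 ((H + hartree ζ ν lam (star A * σ * A)) x)) := by
    simp only [hK, add_apply, hartree_apply]
    refine tendsto_const_nhds.add (tendsto_finsetSum _ fun j _ => Tendsto.smul_const ?_ _)
    refine Tendsto.mul_const _ ?_
    unfold hartreeCoeff
    exact Tendsto.const_mul _ (tendsto_finsetSum _ fun k _ =>
      Tendsto.const_mul _ (h.tendsto_inner _ _))
  have h1 : Tendsto (fun t => Complex.I • (Y t (K t x) - H (Y t x))) atTop
      (𝓝 (Complex.I • (A ((H + hartree ζ ν lam (star A * σ * A)) x) - H (A x)))) :=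
    ((tendsto_apply_of_strong hYn h.strongLimit hKx).sub
      ((H.continuous.tendsto _).comp (h.strongLimit x))).const_smul _
  -- Y(t) x and its derivative both converge, so the limiting derivative, i (A (H + V) x - H A x),
  -- is zero.
  have h2 := eq_zero_of_tendsto_of_hasDerivAt
    (f := fun t => Y t x) (fun t ht =>
      (((ContinuousLinearMap.apply ℂ E x).restrictScalars ℝ).hasFDerivAt.comp_hasDerivAt t
        (hYd t ht))) (h.strongLimit x) h1
  rw [smul_eq_zero_iff_right Complex.I_ne_zero, sub_eq_zero] at h2
  exact h2.symm

theorem IsHartreeFlow.star_mul_self {U : ℝ → E →L[ℂ] E} {A : E →L[ℂ] E}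
    (h : IsHartreeFlow H ρ σ ζ ν lam U A) (hH : IsSelfAdjoint H) : star A * A = 1 := by
  refine adjoint_comp_self_of_norm_eq fun x => ?_
  refine tendsto_nhds_unique (h.strongLimit x).norm (tendsto_const_nhds.congr' ?_)
  filter_upwards [eventually_ge_atTop 0] with t ht
  rw [mul_apply_eq_comp, norm_unitaryGroup_apply hH]
  have h1 := (Unitary.mem_iff.1 (h.mem_unitary t ht)).2
  have e : ⟪star (U t) x, star (U t) x⟫_ℂ = ⟪x, x⟫_ℂ := by
    conv_lhs => rw [ContinuousLinearMap.star_eq_adjoint, ContinuousLinearMap.adjoint_inner_left,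
      ← ContinuousLinearMap.star_eq_adjoint, ← mul_apply_eq_comp, h1, one_apply_eq_self]
  rw [@norm_eq_sqrt_re_inner ℂ _ _ _ _ (star (U t) x), e, ← @norm_eq_sqrt_re_inner ℂ]

/-- The limiting equation, with its solution `l`, and the operator `A` it determines. -/
structure IsLimitOperator (H σ : E →L[ℂ] E) (ζ : Fin N → E) (ν : Fin N → Fin N → ℝ) (lam : ℝ)
    (l : Fin N → E) (A : E →L[ℂ] E) : Prop where
  norm_le : ∀ k, ‖l k‖ ≤ 6 / 5
  eq : ∀ k, l k = ζ k + Complex.I • ∑ j, ∫ r in Set.Ioi (0 : ℝ),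
    returnKernel H (ζ j) (ζ k) r (hartreeSource ν lam σ l j)
  apply_eq : ∀ x ∈ returnDomain H ζ, A x = x + Complex.I • ∑ j, ∫ r in Set.Ioi (0 : ℝ),
    returnKernel H (ζ j) x r (hartreeSource ν lam σ l j)

/-- The limiting data involve the initial state only through σ; two states with the same σ therefore
share the same A. -/
theorem SmallCoupling.limitOperator_unique (h : SmallCoupling H ζ ν lam M) (hσ : ‖σ‖ ≤ 1)
    (hD : Dense (returnDomain H ζ)) {l l' : Fin N → E} {A A' : E →L[ℂ] E}
    (hA : IsLimitOperator H σ ζ ν lam l A) (hA' : IsLimitOperator H σ ζ ν lam l' A') : A = A' := by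
  have e := h.limit_unique hσ hA.norm_le hA'.norm_le hA.eq hA'.eq
  subst e
  have h1 : Set.EqOn A A' (returnDomain H ζ) := fun x hx => by
    rw [hA.apply_eq x hx, hA'.apply_eq x hx]
  exact ContinuousLinearMap.ext fun x =>
    congrFun (Continuous.ext_on hD A.continuous A'.continuous h1) x

theorem IsLimitOperator.eq_one (hD : Dense (returnDomain H ζ)) {l : Fin N → E} {A : E →L[ℂ] E}
    (hA : IsLimitOperator H σ ζ ν 0 l A) : A = 1 := by
  have h1 : Set.EqOn A (1 : E →L[ℂ] E) (returnDomain H ζ) := fun x hx => by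
    rw [hA.apply_eq x hx]
    simp [hartreeSource, hartreeCoeff]
  exact ContinuousLinearMap.ext fun x =>
    congrFun (Continuous.ext_on hD A.continuous (1 : E →L[ℂ] E).continuous h1) x

/-- On vectors with integrable return amplitudes the Duhamel formula passes to the limit once y
converges; contractivity and density give the strong limit everywhere. -/
theorem SmallCoupling.exists_isHartreeFlow (h : SmallCoupling H ζ ν lam M) (hρ : ‖ρ‖ ≤ 1)
    (hρs : IsSelfAdjoint ρ) (hσ : IsStrongLimit (freeEvolution H ρ) σ)
    (hD : Dense (returnDomain H ζ)) :
    ∃ (U : ℝ → E →L[ℂ] E) (A : E →L[ℂ] E) (l : Fin N → E),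
      IsHartreeFlow H ρ σ ζ ν lam U A ∧ IsLimitOperator H σ ζ ν lam l A := by
  obtain ⟨U, y, l, hU0, hUd, hUu, hUx, -, hyc, hy, hyl, hl, hle⟩ := h.exists_propagator hρ hρs hσ
  have hH := h.isSelfAdjoint
  have hx : ∀ x ∈ returnDomain H ζ, Tendsto (fun t => unitaryGroup H (-t) (star (U t) x)) atTop
      (𝓝 (x + Complex.I • ∑ j, ∫ r in Set.Ioi (0 : ℝ),
        returnKernel H (ζ j) x r (hartreeSource ν lam σ l j))) := fun x hx => by
    have h1 : Tendsto (fun t => x + Complex.I • ∑ j, causalConv (returnKernel H (ζ j) x)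
        (fun s => hartreeSource ν lam (freeEvolution H ρ s) (y s) j) t) atTop
        (𝓝 (x + Complex.I • ∑ j, ∫ r in Set.Ioi (0 : ℝ),
          returnKernel H (ζ j) x r (hartreeSource ν lam σ l j))) := by
      refine tendsto_const_nhds.add (Tendsto.const_smul (tendsto_finsetSum _ fun j _ => ?_) _)
      exact tendsto_causalConv (continuous_returnKernel _ _ _)
        (integrableOn_returnKernel hH (hx j))
        (continuous_hartreeSource (continuous_freeEvolution H ρ) hyc j)
        (fun s => norm_hartreeSource_le h.nonneg (norm_freeEvolution_le hH hρ s) (hy s) j)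
        (tendsto_hartreeSource (norm_freeEvolution_le hH hρ) hσ hyl j)
    refine h1.congr' ?_
    filter_upwards [eventually_ge_atTop 0] with t ht
    exact (hUx t x ht).symm
  obtain ⟨A, hA⟩ := exists_strongLimit_of_dense
    (T := fun t => unitaryGroup H (-t) * star (U t)) (C := 1)
    (fun t ht => (norm_mul_le _ _).trans (mul_le_one₀ (norm_unitaryGroup_le hH _) (norm_nonneg _)
      (by rw [norm_star]; exact norm_le_one_of_mem_unitary (hUu t ht)))) hD
    (fun x hx' => ⟨_, hx x hx'⟩)
  exact ⟨U, A, l, ⟨hU0, hUd, hUu, hA, tendsto_inner_conj hH hρ hσ hA⟩,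
    ⟨hl, hle, fun x hx' => tendsto_nhds_unique (hA x) (hx x hx')⟩⟩

end Asymptotics

/-! ### Uniqueness for the nonlinear evolution equations -/

section Uniqueness

/-- Uniqueness for autonomous ordinary differential equations with a `C¹` vector field. -/
theorem ode_unique_of_contDiff {F : Type*} [NormedAddCommGroup F] [NormedSpace ℝ F] {v : F → F}
    (hv : ContDiff ℝ 1 v) {f g : ℝ → F}
    (hf : ∀ t, 0 ≤ t → HasDerivWithinAt f (v (f t)) (Set.Ici 0) t)
    (hg : ∀ t, 0 ≤ t → HasDerivWithinAt g (v (g t)) (Set.Ici 0) t) (h0 : f 0 = g 0) {t : ℝ}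
    (ht : 0 ≤ t) : f t = g t := by
  have hfc : ContinuousOn f (Set.Icc 0 t) := fun s hs =>
    (hf s hs.1).continuousWithinAt.mono Set.Icc_subset_Ici_self
  have hgc : ContinuousOn g (Set.Icc 0 t) := fun s hs =>
    (hg s hs.1).continuousWithinAt.mono Set.Icc_subset_Ici_self
  have hc : IsCompact (f '' Set.Icc 0 t ∪ g '' Set.Icc 0 t) :=
    (isCompact_Icc.image_of_continuousOn hfc).union (isCompact_Icc.image_of_continuousOn hgc)
  -- The vector field need not be globally Lipschitz, but a Lipschitz constant on the compact union
  -- of the two trajectories is enough.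
  obtain ⟨K, hK⟩ := LocallyLipschitzOn.exists_lipschitzOnWith_of_compact hc
    (hv.locallyLipschitz.locallyLipschitzOn)
  refine ODE_solution_unique_of_mem_Icc_right (v := fun _ => v)
    (s := fun _ => f '' Set.Icc 0 t ∪ g '' Set.Icc 0 t) (fun s _ => hK) hfc
    (fun s hs => (hf s hs.1).mono (Set.Ici_subset_Ici.2 hs.1))
    (fun s hs => Or.inl ⟨s, ⟨hs.1, hs.2.le⟩, rfl⟩) hgc
    (fun s hs => (hg s hs.1).mono (Set.Ici_subset_Ici.2 hs.1))
    (fun s hs => Or.inr ⟨s, ⟨hs.1, hs.2.le⟩, rfl⟩) h0 ⟨ht, le_rfl⟩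

variable {E : Type*} [NormedAddCommGroup E] [InnerProductSpace ℂ E] [CompleteSpace E] {N : ℕ}
  {ν : Fin N → Fin N → ℝ} {lam : ℝ} {H ρ σ : E →L[ℂ] E} {ζ : Fin N → E}

theorem contDiff_hartree (ζ : Fin N → E) (ν : Fin N → Fin N → ℝ) (lam : ℝ) :
    ContDiff ℝ 1 (hartree ζ ν lam) := by
  unfold hartree
  have h : ∀ k, ContDiff ℝ 1 fun γ : E →L[ℂ] E => ⟪ζ k, γ (ζ k)⟫_ℂ := fun k =>
    (((innerSL ℂ (ζ k)) ∘L (ContinuousLinearMap.apply ℂ E (ζ k))).restrictScalars ℝ).contDiff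
  refine ContDiff.const_smul (lam : ℂ) (ContDiff.sum fun j _ => ?_)
  have h1 : ContDiff ℝ 1 fun γ : E →L[ℂ] E => ∑ k, (ν j k : ℂ) * ⟪ζ k, γ (ζ k)⟫_ℂ :=
    ContDiff.sum fun k _ => contDiff_const.mul (h k)
  exact h1.smul contDiff_const

theorem contDiff_star : ContDiff ℝ 1 (fun U : E →L[ℂ] E => star U) :=
  (starL' ℝ (A := E →L[ℂ] E)).contDiff

theorem IsHartreeFlow.isPropagator {U : ℝ → E →L[ℂ] E} {A : E →L[ℂ] E}
    (h : IsHartreeFlow H ρ σ ζ ν lam U A) : IsPropagator H (hartree ζ ν lam) ρ U :=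
  ⟨h.zero, fun t ht => ((h.hasDerivAt t ht).congr_deriv
    (by rw [add_mul, neg_smul])).hasDerivWithinAt⟩

theorem IsPropagator.unique {U U' : ℝ → E →L[ℂ] E} (h : IsPropagator H (hartree ζ ν lam) ρ U)
    (h' : IsPropagator H (hartree ζ ν lam) ρ U') {t : ℝ} (ht : 0 ≤ t) : U t = U' t := by
  refine ode_unique_of_contDiff
    (v := fun U => (-Complex.I) • (H * U + hartree ζ ν lam (U * ρ * star U) * U)) ?_ h.2 h'.2
    (h.1.trans h'.1.symm) ht
  have h1 : ContDiff ℝ 1 fun U : E →L[ℂ] E => U * ρ * star U :=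
    (contDiff_id.mul contDiff_const).mul contDiff_star
  exact ContDiff.const_smul (-Complex.I) ((contDiff_const.mul contDiff_id).add
    (((contDiff_hartree ζ ν lam).comp h1).mul contDiff_id))

theorem IsLiouvilleSolution.unique {r r' : ℝ → E →L[ℂ] E}
    (h : IsLiouvilleSolution H (hartree ζ ν lam) ρ r)
    (h' : IsLiouvilleSolution H (hartree ζ ν lam) ρ r') {t : ℝ} (ht : 0 ≤ t) : r t = r' t := by
  refine ode_unique_of_contDiff
    (v := fun r => (-Complex.I) • ((H + hartree ζ ν lam r) * r - r * (H + hartree ζ ν lam r)))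
    ?_ h.2 h'.2 (h.1.trans h'.1.symm) ht
  have h1 := contDiff_const (c := H) |>.add (contDiff_hartree ζ ν lam)
  exact ContDiff.const_smul (-Complex.I) ((h1.mul contDiff_id).sub (contDiff_id.mul h1))

theorem IsHartreeFlow.isLiouvilleSolution {U : ℝ → E →L[ℂ] E} {A : E →L[ℂ] E}
    (h : IsHartreeFlow H ρ σ ζ ν lam U A) (hH : IsSelfAdjoint H) (hρ : IsSelfAdjoint ρ) :
    IsLiouvilleSolution H (hartree ζ ν lam) ρ (fun t => U t * ρ * star (U t)) := by
  refine ⟨by simp [h.zero], fun t ht => HasDerivAt.hasDerivWithinAt ?_⟩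
  have hK : star (H + hartree ζ ν lam (U t * ρ * star (U t))) =
      H + hartree ζ ν lam (U t * ρ * star (U t)) :=
    (isSelfAdjoint_clm_add hH (isSelfAdjoint_hartree ζ ν lam (hρ.conjugate (U t)))).star_eq
  refine (((h.hasDerivAt t ht).mul_const ρ).mul (h.hasDerivAt t ht).star).congr_deriv ?_
  rw [star_neg, star_smul, star_mul, hK]
  simp only [Complex.star_def, Complex.conj_I, neg_smul, neg_neg, neg_mul, smul_mul_assoc,
    mul_smul_comm, smul_sub, mul_assoc]
  abel

end Uniqueness

end HartreeNESS

namespace HartreeNESS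

/-! ### Trace class operators -/

section TraceClass

variable {E : Type*} [NormedAddCommGroup E] [InnerProductSpace ℂ E] [CompleteSpace E]
  {ι : Type*}

theorem norm_apply_eq_norm_sqrt_apply (O : E →L[ℂ] E) (x : E) :
    ‖O x‖ = ‖CFC.sqrt (star O * O) x‖ := by
  have hQ : star (CFC.sqrt (star O * O)) = CFC.sqrt (star O * O) :=
    (CFC.sqrt_nonneg (star O * O)).isSelfAdjoint.star_eq
  have e : ⟪O x, O x⟫_ℂ = ⟪CFC.sqrt (star O * O) x, CFC.sqrt (star O * O) x⟫_ℂ := by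
    rw [← ContinuousLinearMap.adjoint_inner_right, ← ContinuousLinearMap.adjoint_inner_right,
      ← ContinuousLinearMap.star_eq_adjoint, ← ContinuousLinearMap.star_eq_adjoint, hQ,
      ← mul_apply_eq_comp, ← mul_apply_eq_comp,
      CFC.sqrt_mul_sqrt_self (star O * O) (star_mul_self_nonneg O)]
  rw [@norm_eq_sqrt_re_inner ℂ, e, ← @norm_eq_sqrt_re_inner ℂ]

theorem norm_sq_sqrt_apply {Q : E →L[ℂ] E} (hQ : 0 ≤ Q) (x : E) :
    ‖CFC.sqrt Q x‖ ^ 2 = (⟪x, Q x⟫_ℂ).re := by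
  have hs : star (CFC.sqrt Q) = CFC.sqrt Q := (CFC.sqrt_nonneg Q).isSelfAdjoint.star_eq
  rw [← inner_self_eq_norm_sq (𝕜 := ℂ), ← ContinuousLinearMap.adjoint_inner_right,
    ← ContinuousLinearMap.star_eq_adjoint, hs, ← mul_apply_eq_comp, CFC.sqrt_mul_sqrt_self Q hQ]
  rfl

theorem re_inner_sqrt_nonneg (O : E →L[ℂ] E) (x : E) :
    0 ≤ (⟪x, CFC.sqrt (star O * O) x⟫_ℂ).re := by
  rw [← norm_sq_sqrt_apply (Q := CFC.sqrt (star O * O)) (CFC.sqrt_nonneg _) x]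
  exact sq_nonneg _

/-- Approximate factorization of an operator through the square root of its absolute value. -/
theorem exists_approx_factorization (O : E →L[ℂ] E) {ε : ℝ} (hε : 0 < ε) :
    ∃ B : E →L[ℂ] E, (∀ x, ‖B x‖ ≤ ‖CFC.sqrt (CFC.sqrt (star O * O)) x‖) ∧
      ∀ x, ‖O x - B (CFC.sqrt (CFC.sqrt (star O * O)) x)‖ ≤ ε * ‖x‖ := by
  set Q := CFC.sqrt (star O * O) with hQdef
  have hQ : 0 ≤ Q := CFC.sqrt_nonneg _
  have hQs : IsSelfAdjoint Q := hQ.isSelfAdjoint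
  set R := CFC.sqrt Q with hR
  have hg : Continuous fun q : ℝ => 1 / (|q| + ε) :=
    continuous_const.div (by fun_prop) fun q => (by positivity)
  -- G is a regularised inverse of Q = |O|, and B = O G √Q stands in for the partial isometry of a
  -- polar decomposition times √Q. The bounds needed are q / (q + ε) ≤ 1 and q - q² / (q + ε) ≤ ε;
  -- the absolute value only serves continuity on all of ℝ.
  set G := cfc (fun q : ℝ => 1 / (|q| + ε)) Q with hG
  have hQG : Q * G = cfc (fun q : ℝ => q * (1 / (|q| + ε))) Q := by
    rw [cfc_mul (fun q : ℝ => q) _ Q (by fun_prop) hg.continuousOn, cfc_id' ℝ Q]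
  have hQGQ : Q - Q * G * Q = cfc (fun q : ℝ => q - q * (1 / (|q| + ε)) * q) Q := by
    rw [cfc_sub (fun q : ℝ => q) (fun q : ℝ => q * (1 / (|q| + ε)) * q) Q (by fun_prop)
      ((continuous_id.mul hg).mul continuous_id).continuousOn,
      cfc_mul (fun q : ℝ => q * (1 / (|q| + ε))) (fun q : ℝ => q) Q
        (continuous_id.mul hg).continuousOn (by fun_prop), ← hQG, cfc_id' ℝ Q]
  have h1 : ‖Q * G‖ ≤ 1 := by
    rw [hQG]
    refine norm_cfc_le zero_le_one fun q _ => ?_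
    rw [mul_one_div, Real.norm_eq_abs, abs_div, abs_of_pos (by positivity : 0 < |q| + ε),
      div_le_one (by positivity)]
    linarith
  have h2 : ‖Q - Q * G * Q‖ ≤ ε := by
    rw [hQGQ]
    refine norm_cfc_le hε.le fun q hq => ?_
    have hq0 : 0 ≤ q := spectrum_nonneg_of_nonneg hQ hq
    rw [abs_of_nonneg hq0, Real.norm_eq_abs]
    have e : q - q * (1 / (q + ε)) * q = ε * (q / (q + ε)) := by
      field_simp
      ring
    rw [e, abs_of_nonneg (by positivity)]
    refine mul_le_of_le_one_right hε.le ?_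
    rw [div_le_one (by positivity)]
    linarith
  refine ⟨O * G * R, fun x => ?_, fun x => ?_⟩
  · rw [mul_apply_eq_comp, mul_apply_eq_comp, norm_apply_eq_norm_sqrt_apply, ← hQdef,
      ← mul_apply_eq_comp]
    simpa using (Q * G).le_of_opNorm_le h1 (R x)
  · have e : O x - (O * G * R) (R x) = O (x - G (Q x)) := by
      rw [map_sub, mul_apply_eq_comp, mul_apply_eq_comp, ← mul_apply_eq_comp R R, hR,
        CFC.sqrt_mul_sqrt_self Q hQ]
    rw [e, norm_apply_eq_norm_sqrt_apply, ← hQdef]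
    have e2 : Q (x - G (Q x)) = (Q - Q * G * Q) x := by
      rw [map_sub, sub_apply, mul_apply_eq_comp, mul_apply_eq_comp]
    rw [e2]
    exact (Q - Q * G * Q).le_of_opNorm_le h2 x

/-- The Hilbert-Schmidt norm of an adjoint, against a contraction. -/
theorem sum_norm_sq_adjoint_le (e : HilbertBasis ι ℂ E) {B T R : E →L[ℂ] E} (hT : ‖T‖ ≤ 1)
    (hB : ∀ x, ‖B x‖ ≤ ‖R x‖) (hR : Summable fun i => ‖R (e i)‖ ^ 2) (F : Finset ι) :
    ∑ i ∈ F, ‖star B (star T (e i))‖ ^ 2 ≤ ∑' i, ‖R (e i)‖ ^ 2 := by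
  have h1 : ∀ i, HasSum (fun k => ‖⟪e k, star B (star T (e i))⟫_ℂ‖ ^ 2)
      (‖star B (star T (e i))‖ ^ 2) := fun i => by
    have h := e.hasSum_inner_mul_inner (star B (star T (e i))) (star B (star T (e i)))
    have e1 : (fun k => ‖⟪e k, star B (star T (e i))⟫_ℂ‖ ^ 2) = fun k =>
        (⟪star B (star T (e i)), e k⟫_ℂ * ⟪e k, star B (star T (e i))⟫_ℂ).re := by
      funext k
      rw [← inner_conj_symm, Complex.mul_conj', RCLike.norm_conj, ← Complex.ofReal_pow, Complex.ofReal_re]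
    rw [e1, ← inner_self_eq_norm_sq (𝕜 := ℂ)]
    exact Complex.hasSum_re h
  have h2 : ∀ i k, ‖⟪e k, star B (star T (e i))⟫_ℂ‖ = ‖⟪e i, T (B (e k))⟫_ℂ‖ := fun i k => by
    rw [ContinuousLinearMap.star_eq_adjoint, ContinuousLinearMap.star_eq_adjoint,
      ContinuousLinearMap.adjoint_inner_right, ContinuousLinearMap.adjoint_inner_right,
      norm_inner_symm]
  have h3 := hasSum_sum (s := F) fun i _ => h1 i
  -- Parseval has replaced the norms by double sums of |⟪e i, T (B (e k))⟫|²; for fixed k, Bessel's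
  -- inequality over i bounds the sum by ‖T (B (e k))‖².
  refine hasSum_le (fun k => ?_) h3 hR.hasSum
  simp only [h2]
  refine (e.orthonormal.sum_inner_products_le (T (B (e k)))).trans ?_
  have h4 : ‖T (B (e k))‖ ≤ ‖R (e k)‖ := by
    have := T.le_of_opNorm_le hT (B (e k))
    rw [one_mul] at this
    exact this.trans (hB _)
  exact pow_le_pow_left₀ (norm_nonneg _) h4 2

/-- The diagonal of `T O` for a contraction `T` and a trace class operator `O`. -/
theorem sum_norm_inner_le (e : HilbertBasis ι ℂ E) {O T : E →L[ℂ] E} (hT : ‖T‖ ≤ 1)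
    (hO : IsTraceClassWrt e O) (F : Finset ι) :
    ∑ i ∈ F, ‖⟪e i, T (O (e i))⟫_ℂ‖ ≤
      √(∑' i, (⟪e i, CFC.sqrt (star O * O) (e i)⟫_ℂ).re) *
        √(∑ i ∈ F, (⟪e i, CFC.sqrt (star O * O) (e i)⟫_ℂ).re) := by
  have hQ : 0 ≤ CFC.sqrt (star O * O) := CFC.sqrt_nonneg _
  unfold IsTraceClassWrt at hO
  simp only [← norm_sq_sqrt_apply hQ] at hO ⊢
  set R := CFC.sqrt (CFC.sqrt (star O * O)) with hR
  refine le_of_forall_pos_le_add fun δ hδ => ?_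
  -- The factorization error is spread over F so that it sums to at most δ. Cauchy–Schwarz then
  -- leaves the sum over F of the diagonal of |O| as a factor, which is small on tails uniformly in
  -- T.
  obtain ⟨B, hB, hBO⟩ := exists_approx_factorization O (ε := δ / (F.card + 1)) (by positivity)
  have h1 : ∀ i ∈ F, ‖⟪e i, T (O (e i))⟫_ℂ‖ ≤
      ‖star B (star T (e i))‖ * ‖R (e i)‖ + δ / (F.card + 1) := fun i _ => by
    have e1 : ⟪e i, T (O (e i))⟫_ℂ = ⟪star B (star T (e i)), R (e i)⟫_ℂ +
        ⟪e i, T (O (e i) - B (R (e i)))⟫_ℂ := by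
      rw [ContinuousLinearMap.star_eq_adjoint, ContinuousLinearMap.star_eq_adjoint,
        ContinuousLinearMap.adjoint_inner_left, ContinuousLinearMap.adjoint_inner_left,
        map_sub, inner_sub_right]
      ring
    rw [e1]
    refine (norm_add_le _ _).trans (add_le_add (norm_inner_le_norm _ _) ?_)
    have h2 := hBO (e i)
    rw [e.orthonormal.norm_eq_one, mul_one] at h2
    refine (norm_inner_le_norm _ _).trans ?_
    rw [e.orthonormal.norm_eq_one, one_mul]
    have h3 := T.le_of_opNorm_le hT (O (e i) - B (R (e i)))
    rw [one_mul] at h3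
    exact h3.trans h2
  refine (Finset.sum_le_sum h1).trans ?_
  rw [Finset.sum_add_distrib]
  refine add_le_add ?_ ?_
  · refine (Real.sum_mul_le_sqrt_mul_sqrt F _ _).trans ?_
    exact mul_le_mul_of_nonneg_right (Real.sqrt_le_sqrt (sum_norm_sq_adjoint_le e hT hB hO F))
      (Real.sqrt_nonneg _)
  · rw [Finset.sum_const, nsmul_eq_mul, mul_div_assoc', div_le_iff₀ (by positivity)]
    nlinarith

theorem summable_inner_of_isTraceClassWrt (e : HilbertBasis ι ℂ E) {O T : E →L[ℂ] E}
    (hT : ‖T‖ ≤ 1) (hO : IsTraceClassWrt e O) : Summable fun i => ⟪e i, T (O (e i))⟫_ℂ := by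
  have hO' : Summable fun i => (⟪e i, CFC.sqrt (star O * O) (e i)⟫_ℂ).re := hO
  refine Summable.of_norm (summable_of_sum_le (fun _ => norm_nonneg _) fun F =>
    (sum_norm_inner_le e hT hO F).trans (mul_le_mul_of_nonneg_left
      (Real.sqrt_le_sqrt (hO'.sum_le_tsum F fun i _ => re_inner_sqrt_nonneg O (e i))) (Real.sqrt_nonneg _)))

/-- Weak convergence of contractions implies convergence of their expectations in trace class
operators. -/
theorem tendsto_tsum_inner (e : HilbertBasis ι ℂ E) {T : ℝ → E →L[ℂ] E} {T' O : E →L[ℂ] E}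
    (hT : ∀ t, 0 ≤ t → ‖T t‖ ≤ 1) (hT' : ‖T'‖ ≤ 1)
    (h : ∀ x y, Tendsto (fun t => ⟪x, T t y⟫_ℂ) atTop (𝓝 ⟪x, T' y⟫_ℂ))
    (hO : IsTraceClassWrt e O) :
    Tendsto (fun t => ∑' i, ⟪e i, T t (O (e i))⟫_ℂ) atTop (𝓝 (∑' i, ⟪e i, T' (O (e i))⟫_ℂ)) := by
  set q : ι → ℝ := fun i => (⟪e i, CFC.sqrt (star O * O) (e i)⟫_ℂ).re with hqdef
  have hq : ∀ i, 0 ≤ q i := fun i => re_inner_sqrt_nonneg O (e i)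
  have hqs : Summable q := hO
  classical
  rw [Metric.tendsto_atTop]
  intro ε hε
  set C := √(∑' i, q i) with hC
  have hC0 : 0 ≤ C := Real.sqrt_nonneg _
  have hδ : 0 < (ε / (4 * (C + 1))) ^ 2 := by positivity
  obtain ⟨F, hF⟩ := summable_iff_vanishing_norm.1 hqs _ hδ
  have tail : ∀ S : E →L[ℂ] E, ‖S‖ ≤ 1 →
      ‖∑' i, ⟪e i, S (O (e i))⟫_ℂ - ∑ i ∈ F, ⟪e i, S (O (e i))⟫_ℂ‖ ≤ ε / 4 := fun S hS => by
    have hs := (summable_inner_of_isTraceClassWrt e hS hO).hasSum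
    refine le_of_tendsto (hs.sub_const (∑ i ∈ F, ⟪e i, S (O (e i))⟫_ℂ)).norm ?_
    filter_upwards [eventually_ge_atTop F] with G hG
    rw [← Finset.sum_sdiff hG, add_sub_cancel_right]
    refine (norm_sum_le _ _).trans ((sum_norm_inner_le e hS hO _).trans ?_)
    have h1 := hF (G \ F) Finset.sdiff_disjoint
    have h2 : √(∑ i ∈ G \ F, q i) ≤ ε / (4 * (C + 1)) :=
      Real.sqrt_le_iff.2 ⟨by positivity, ((le_abs_self _).trans h1.le)⟩
    calc _ ≤ C * (ε / (4 * (C + 1))) := mul_le_mul_of_nonneg_left h2 hC0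
      _ ≤ ε / 4 := by
        rw [mul_div_assoc', div_le_div_iff₀ (by positivity) (by positivity)]
        nlinarith
  have hfin : Tendsto (fun t => ∑ i ∈ F, ⟪e i, T t (O (e i))⟫_ℂ) atTop
      (𝓝 (∑ i ∈ F, ⟪e i, T' (O (e i))⟫_ℂ)) := tendsto_finsetSum _ fun i _ => h _ _
  obtain ⟨t₀, ht₀⟩ := Metric.tendsto_atTop.1 hfin (ε / 4) (by positivity)
  refine ⟨max t₀ 0, fun t ht => ?_⟩
  have h1 := tail (T t) (hT t ((le_max_right _ _).trans ht))
  have h2 := tail T' hT'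
  have h3 := ht₀ t ((le_max_left _ _).trans ht)
  rw [← dist_eq_norm] at h1 h2
  rw [dist_comm] at h2
  have h4 := dist_triangle4 (∑' i, ⟪e i, T t (O (e i))⟫_ℂ) (∑ i ∈ F, ⟪e i, T t (O (e i))⟫_ℂ)
    (∑ i ∈ F, ⟪e i, T' (O (e i))⟫_ℂ) (∑' i, ⟪e i, T' (O (e i))⟫_ℂ)
  linarith

end TraceClass

end HartreeNESS

namespace HartreeNESS

/-! ### Traces against a finite rank commutator -/

section FiniteRankTrace

variable {E : Type*} [NormedAddCommGroup E] [InnerProductSpace ℂ E] [CompleteSpace E]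
  {ι κ : Type*} [Fintype κ] {K P C : E →L[ℂ] E} {a b : κ → E}

/-- Cyclicity of the trace for a finite rank factor, which is Parseval's identity for each rank-one
term. -/
theorem hasSum_inner_mul_finiteRank (e : HilbertBasis ι ℂ E) (hC : ∀ x, C x = ∑ i, ⟪b i, x⟫_ℂ • a i)
    (S T : E →L[ℂ] E) :
    HasSum (fun i => ⟪e i, (S * C * T) (e i)⟫_ℂ) (∑ i, ⟪b i, (T * S) (a i)⟫_ℂ) := by
  have h : ∀ k, HasSum (fun i => ⟪star T (b k), e i⟫_ℂ * ⟪e i, S (a k)⟫_ℂ)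
      ⟪b k, (T * S) (a k)⟫_ℂ := fun k => by
    have := e.hasSum_inner_mul_inner (star T (b k)) (S (a k))
    rwa [ContinuousLinearMap.star_eq_adjoint, ContinuousLinearMap.adjoint_inner_left] at this
  have e1 : (fun i => ⟪e i, (S * C * T) (e i)⟫_ℂ) =
      fun i => ∑ k, ⟪star T (b k), e i⟫_ℂ * ⟪e i, S (a k)⟫_ℂ := by
    funext i
    simp only [mul_apply_eq_comp, hC, map_sum, map_smul, inner_sum, inner_smul_right,
      ContinuousLinearMap.star_eq_adjoint, ContinuousLinearMap.adjoint_inner_left]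
  rw [e1]
  exact hasSum_sum fun k _ => h k

/-- The commutator telescopes, [K^{m+2}, P] = K [K^{m+1}, P] + C K^{m+1}, and each of the m + 1
finite rank terms has the same trace by cyclicity. The outer powers p and q let the induction absorb
the extra factor K. -/
theorem hasSum_inner_commutator (e : HilbertBasis ι ℂ E)
    (hC : ∀ x, C x = ∑ i, ⟪b i, x⟫_ℂ • a i) (hKP : K * P - P * K = C) (m : ℕ) (p q : ℕ) :
    HasSum (fun i => ⟪e i, (K ^ p * (K ^ (m + 1) * P - P * K ^ (m + 1)) * K ^ q) (e i)⟫_ℂ)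
      ((m + 1) * ∑ i, ⟪b i, (K ^ (p + q + m)) (a i)⟫_ℂ) := by
  induction m generalizing p q with
  | zero =>
    have h := hasSum_inner_mul_finiteRank e hC (K ^ p) (K ^ q)
    rw [← pow_add, add_comm q p] at h
    simpa [hKP] using h
  | succ m ih =>
    have h := (ih (p + 1) q).add (hasSum_inner_mul_finiteRank e hC (K ^ p) (K ^ (m + 1 + q)))
    rw [← pow_add, show m + 1 + q + p = p + q + (m + 1) by ring,
      show p + 1 + q + m = p + q + (m + 1) by ring] at h
    have e1 : ∀ i, ⟪e i, (K ^ (p + 1) * (K ^ (m + 1) * P - P * K ^ (m + 1)) * K ^ q) (e i)⟫_ℂ +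
        ⟪e i, (K ^ p * C * K ^ (m + 1 + q)) (e i)⟫_ℂ =
        ⟪e i, (K ^ p * (K ^ (m + 1 + 1) * P - P * K ^ (m + 1 + 1)) * K ^ q) (e i)⟫_ℂ := fun i => by
      rw [← inner_add_right, ← add_apply, ← hKP]
      congr 2
      rw [pow_succ K p, pow_add K (m + 1) q, pow_succ' K (m + 1)]
      noncomm_ring
    simp only [e1] at h
    convert h using 1
    push_cast
    ring

/-- P is diagonal in the basis, so [K^{m+1}, P] has zero diagonal; its diagonal sum is also (m + 1)
times the trace of K^m C. -/
theorem sum_inner_pow_eq_zero (e : HilbertBasis ι ℂ E)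
    (hC : ∀ x, C x = ∑ i, ⟪b i, x⟫_ℂ • a i) (hKP : K * P - P * K = C) (hP : IsSelfAdjoint P)
    (hPe : ∀ i, P (e i) = e i ∨ P (e i) = 0) (m : ℕ) : ∑ i, ⟪b i, (K ^ m) (a i)⟫_ℂ = 0 := by
  have h := hasSum_inner_commutator e hC hKP m 0 0
  have h0 : ∀ i, ⟪e i, (K ^ 0 * (K ^ (m + 1) * P - P * K ^ (m + 1)) * K ^ 0) (e i)⟫_ℂ = 0 :=
    fun i => by
      have hs : ∀ x, ⟪e i, P x⟫_ℂ = ⟪P (e i), x⟫_ℂ := fun x => by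
        conv_lhs => rw [← hP.star_eq, ContinuousLinearMap.star_eq_adjoint,
          ContinuousLinearMap.adjoint_inner_right]
      rw [pow_zero, one_mul, mul_one, sub_apply, inner_sub_right, mul_apply_eq_comp,
        mul_apply_eq_comp, hs]
      rcases hPe i with hi | hi <;> simp [hi]
  simp only [h0, zero_add] at h
  have h1 := h.unique hasSum_zero
  exact (mul_eq_zero.1 h1).resolve_left (by exact_mod_cast m.succ_ne_zero)

theorem norm_sum_inner_le (a b : κ → E) (T : E →L[ℂ] E) :
    ‖∑ i, ⟪b i, T (a i)⟫_ℂ‖ ≤ ‖T‖ * ∑ i, ‖b i‖ * ‖a i‖ := by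
  rw [Finset.mul_sum]
  refine (norm_sum_le _ _).trans (Finset.sum_le_sum fun i _ => ?_)
  calc _ ≤ ‖b i‖ * ‖T (a i)‖ := norm_inner_le_norm _ _
    _ ≤ ‖b i‖ * (‖T‖ * ‖a i‖) := mul_le_mul_of_nonneg_left (T.le_opNorm _) (norm_nonneg _)
    _ = _ := by ring

theorem sum_inner_cfc_eq_zero (hK : IsSelfAdjoint K)
    (h : ∀ m : ℕ, ∑ i, ⟪b i, (K ^ m) (a i)⟫_ℂ = 0) {f : ℝ → ℝ} (hf : Continuous f) :
    ∑ i, ⟪b i, cfc f K (a i)⟫_ℂ = 0 := by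
  have hp : ∀ p : Polynomial ℝ, ∑ i, ⟪b i, (Polynomial.aeval K p) (a i)⟫_ℂ = 0 := fun p => by
    induction p using Polynomial.induction_on' with
    | add p q hp hq =>
      simp only [map_add, add_apply, inner_add_right, Finset.sum_add_distrib, hp, hq, add_zero]
    | monomial n c =>
      have e : ∀ i, ⟪b i, (Polynomial.aeval K (Polynomial.monomial n c)) (a i)⟫_ℂ =
          (c : ℂ) * ⟪b i, (K ^ n) (a i)⟫_ℂ := fun i => by
        rw [Polynomial.aeval_monomial, Algebra.algebraMap_eq_smul_one, smul_mul_assoc, one_mul,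
          smul_apply, inner_smul_right_eq_smul, Complex.real_smul]
      simp only [e, ← Finset.mul_sum, h, mul_zero]
  refine norm_le_zero_iff.1 (le_of_forall_pos_le_add fun ε hε => ?_)
  set B := ∑ i, ‖b i‖ * ‖a i‖ with hB
  have hB0 : 0 ≤ B := Finset.sum_nonneg fun i _ => by positivity
  obtain ⟨p, hp1, -⟩ := exists_polynomial_near_cfc hK hK hf (ε := ε / (B + 1)) (by positivity)
  have e : ∑ i, ⟪b i, cfc f K (a i)⟫_ℂ =
      - ∑ i, ⟪b i, (Polynomial.aeval K p - cfc f K) (a i)⟫_ℂ := by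
    simp only [sub_apply, inner_sub_right, Finset.sum_sub_distrib, hp p]
    ring
  rw [e, norm_neg, zero_add]
  refine (norm_sum_inner_le a b _).trans ((mul_le_mul_of_nonneg_right hp1 hB0).trans ?_)
  rw [div_mul_eq_mul_div, div_le_iff₀ (by positivity)]
  nlinarith

theorem sum_inner_fermiDirac_eq_zero (hK : IsSelfAdjoint K)
    (h : ∀ m : ℕ, ∑ i, ⟪b i, (K ^ m) (a i)⟫_ℂ = 0) (β : ℝ≥0∞) (μ : ℝ) :
    ∑ i, ⟪b i, fermiDirac β μ K (a i)⟫_ℂ = 0 := by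
  unfold fermiDirac
  split_ifs
  · obtain ⟨f, hf, hlim⟩ := exists_cfc_tendsto_spectralProjectionIic hK μ
    refine tendsto_nhds_unique (tendsto_finsetSum Finset.univ fun i _ =>
      tendsto_const_nhds.inner (hlim (a i))) ?_
    simp only [sum_inner_cfc_eq_zero hK h (hf _)]
    exact tendsto_const_nhds
  · exact sum_inner_cfc_eq_zero hK h (continuous_fermi _ _)

end FiniteRankTrace

/-! ### Currents -/

section Current

variable {N : ℕ} {tc : ℝ} {hs : Sample N →L[ℂ] Sample N} (τ : ℝ) {L : Fin 2 → Lead}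
  (S : Fin 2 → Sample N)

theorem leadProj_sampleEmb (k : Fin 2) (v : Sample N) : leadProj N k (sampleEmb N v) = 0 := by
  rw [leadProj, onLead_apply, sampleEmb_fst]
  simp

theorem leadProj_snd (k : Fin 2) (x : Hilb N) : (leadProj N k x).snd = 0 := by
  rw [leadProj, onLead_apply, leadEmb_snd]

/-- The lead and sample Hamiltonians commute with Π_k, so only the tunnelling term survives, as a
sum of rank-one operators. -/
theorem coupledHam_commutator_apply (k : Fin 2) (x : Hilb N) :
    (coupledHam tc hs τ L S * leadProj N k - leadProj N k * coupledHam tc hs τ L S) x =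
      ∑ i : Fin 2 ⊕ Fin 2,
        ⟪(Sum.elim (fun j => (τ : ℂ) • leadProj N k (leadEmb N j (L j)))
          (fun j => (τ : ℂ) • sampleEmb N (S j)) i : Hilb N), x⟫_ℂ •
        (Sum.elim (fun j => sampleEmb N (S j))
          (fun j => -leadProj N k (leadEmb N j (L j))) i : Hilb N) := by
  have hc := congrArg (fun T : Hilb N →L[ℂ] Hilb N => T x)
    (commute_leadHam_leadProj (N := N) tc k).eq
  simp only [mul_apply_eq_comp] at hc
  have hP : ∀ y z : Hilb N, ⟪y, leadProj N k z⟫_ℂ = ⟪leadProj N k y, z⟫_ℂ := fun y z => by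
    conv_lhs => rw [← (isSelfAdjoint_leadProj k).star_eq, ContinuousLinearMap.star_eq_adjoint,
      ContinuousLinearMap.adjoint_inner_right]
  simp only [coupledHam, tunnelHam, sub_apply, mul_apply_eq_comp, add_apply, map_add, hc,
    onSample_apply, leadProj_snd, leadProj_sampleEmb, map_zero, smul_apply, sum_apply,
    InnerProductSpace.rankOne_apply, map_smul, map_sum, hP, inner_zero_left, zero_smul,
    Fintype.sum_sum_type, Sum.elim_inl, Sum.elim_inr, inner_smul_left, Complex.conj_ofReal,
    smul_neg, Finset.sum_neg_distrib, mul_smul, smul_zero, add_zero, zero_add, Finset.smul_sum]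
  abel

theorem hartree_commute_leadProj (ν : Fin N → Fin N → ℝ) (lam : ℝ) (γ : Hilb N →L[ℂ] Hilb N)
    (k : Fin 2) : hartree zeta ν lam γ * leadProj N k = leadProj N k * hartree zeta ν lam γ := by
  refine ContinuousLinearMap.ext fun x => ?_
  have h : ∀ j, ⟪(zeta j : Hilb N), leadProj N k x⟫_ℂ = 0 := fun j => by
    rw [zeta, inner_sampleEmb_left, leadProj_snd, inner_zero_right]
  have h' : ∀ j, leadProj N k (zeta j) = 0 := fun j => leadProj_sampleEmb k _
  simp only [mul_apply_eq_comp, hartree_apply, h, map_sum, map_smul, h', mul_zero, zero_smul,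
    smul_zero]

/-- No current flows in a thermal equilibrium state. -/
theorem trace_fermiDirac_mul_currentOp (hhs : IsSelfAdjoint hs) (ν : Fin N → Fin N → ℝ)
    (lam : ℝ) {γ : Hilb N →L[ℂ] Hilb N} (hγ : IsSelfAdjoint γ) (β : ℝ≥0∞) (μ : ℝ) (k : Fin 2) :
    trace (fermiDirac β μ (coupledHam tc hs τ L S + hartree zeta ν lam γ) *
      currentOp (coupledHam tc hs τ L S) k) = 0 := by
  set H := coupledHam tc hs τ L S with hH
  set K := H + hartree zeta ν lam γ with hK
  have hKs : IsSelfAdjoint K := isSelfAdjoint_clm_add (isSelfAdjoint_coupledHam tc hhs τ L S)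
    (isSelfAdjoint_hartree zeta ν lam hγ)
  have hKP : K * leadProj N k - leadProj N k * K = H * leadProj N k - leadProj N k * H := by
    rw [hK, add_mul, mul_add, hartree_commute_leadProj]
    abel
  have hC := coupledHam_commutator_apply (tc := tc) (hs := hs) τ (L := L) S k
  have h := hasSum_inner_mul_finiteRank (stdBasis N) hC (Complex.I • fermiDirac β μ K) 1
  have h0 := sum_inner_fermiDirac_eq_zero hKs (sum_inner_pow_eq_zero (stdBasis N) hC hKP
    (isSelfAdjoint_leadProj k) (by rw [coe_stdBasis]; exact leadProj_stdVec k)) β μ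
  simp only [one_mul, mul_one, smul_apply, inner_smul_right, ← Finset.mul_sum, h0, mul_zero,
    coe_stdBasis] at h
  rw [trace, currentOp, mul_smul_comm, ← smul_mul_assoc]
  exact h.tsum_eq

end Current

end HartreeNESS

namespace HartreeNESS

/-! ### Transport of states through an intertwining isometry -/

section Intertwining

variable {E : Type*} [NormedAddCommGroup E] [InnerProductSpace ℂ E] [CompleteSpace E]
  {H K A σ : E →L[ℂ] E}

theorem commute_conj_of_intertwine (hH : IsSelfAdjoint H) (hK : IsSelfAdjoint K)
    (h : H ∘L A = A ∘L K) (hσ : Commute H σ) : Commute K (star A * σ * A) := by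
  have h1 : H * A = A * K := h
  have h2 : K * star A = star A * H := adjoint_intertwine hH hK h
  calc K * (star A * σ * A) = K * star A * (σ * A) := by simp only [mul_assoc]
    _ = star A * (H * σ) * A := by rw [h2]; simp only [mul_assoc]
    _ = star A * σ * (H * A) := by rw [hσ.eq]; simp only [mul_assoc]
    _ = star A * σ * A * K := by rw [h1]; simp only [mul_assoc]

theorem conj_fermiDirac_of_intertwine (hH : IsSelfAdjoint H) (hK : IsSelfAdjoint K)
    (h : H ∘L A = A ∘L K) (hA : star A * A = 1) (β : ℝ≥0∞) (μ : ℝ) :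
    star A * fermiDirac β μ H * A = fermiDirac β μ K := by
  have h2 : fermiDirac β μ H * A = A * fermiDirac β μ K := fermiDirac_intertwine hH hK h β μ
  rw [mul_assoc, h2, ← mul_assoc, hA, one_mul]

theorem norm_le_one_of_star_mul_self (hA : star A * A = 1) : ‖A‖ ≤ 1 := by
  refine A.opNorm_le_bound zero_le_one fun x => ?_
  have e : ⟪A x, A x⟫_ℂ = ⟪x, x⟫_ℂ := by
    rw [← ContinuousLinearMap.adjoint_inner_right, ← ContinuousLinearMap.star_eq_adjoint,
      ← mul_apply_eq_comp, hA, one_apply_eq_self]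
  rw [@norm_eq_sqrt_re_inner ℂ, e, ← @norm_eq_sqrt_re_inner ℂ, one_mul]

theorem norm_conj_le_one {A B : E →L[ℂ] E} (hA : ‖A‖ ≤ 1) (hσ : ‖σ‖ ≤ 1) (hB : ‖B‖ ≤ 1) :
    ‖A * σ * B‖ ≤ 1 :=
  (norm_mul_le _ _).trans (mul_le_one₀ ((norm_mul_le _ _).trans
    (mul_le_one₀ hA (norm_nonneg _) hσ)) (norm_nonneg _) hB)

end Intertwining

/-! ### The coupled system -/

section Coupled

variable {N : ℕ} {tc : ℝ} {hs : Sample N →L[ℂ] Sample N} (τ : ℝ) {L : Fin 2 → Lead}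
  (S : Fin 2 → Sample N)

theorem maxDecay_lt_top {H : Hilb N →L[ℂ] Hilb N} (hd : Dispersive H) : maxDecay H < ∞ := by
  have hfin : ∀ j n : Fin N,
      ∫⁻ s in Set.Ioi (0 : ℝ), ‖⟪(zeta j : Hilb N), unitaryGroup H s (zeta n)⟫_ℂ‖ₑ < ∞ := fun j n =>
    (hd _ _ (isCompactlySupported_zeta j) (isCompactlySupported_zeta n)).integrableOn.2
  refine lt_of_le_of_lt ?_ (ENNReal.sum_lt_top.2 fun j (_ : j ∈ Finset.univ) =>
    ENNReal.sum_lt_top.2 fun n (_ : n ∈ Finset.univ) => hfin j n)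
  refine iSup₂_le fun j n => ?_
  exact (Finset.single_le_sum (f := fun n => ∫⁻ s in Set.Ioi (0 : ℝ),
      ‖⟪(zeta j : Hilb N), unitaryGroup H s (zeta n)⟫_ℂ‖ₑ) (fun _ _ => zero_le)
      (Finset.mem_univ n)).trans
    (Finset.single_le_sum (f := fun j => ∑ n, ∫⁻ s in Set.Ioi (0 : ℝ),
      ‖⟪(zeta j : Hilb N), unitaryGroup H s (zeta n)⟫_ℂ‖ₑ) (fun _ _ => zero_le)
      (Finset.mem_univ j))

theorem smallCoupling_of_lt_criticalCoupling {H : Hilb N →L[ℂ] Hilb N} (hH : IsSelfAdjoint H)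
    (hd : Dispersive H) {ν : Fin N → Fin N → ℝ} {lam : ℝ} (hlam : 0 ≤ lam)
    (hlam' : ENNReal.ofReal lam < criticalCoupling ν H) :
    SmallCoupling H zeta ν lam (maxDecay H).toReal where
  isSelfAdjoint := hH
  norm_eq_one := norm_zeta
  nonneg := hlam
  integrableOn j k :=
    (hd _ _ (isCompactlySupported_zeta j) (isCompactlySupported_zeta k)).integrableOn
  integral_le j k := by
    rw [integral_norm_eq_lintegral_enorm
      (hd _ _ (isCompactlySupported_zeta j) (isCompactlySupported_zeta k)).integrableOn.1]
    exact ENNReal.toReal_mono (maxDecay_lt_top hd).ne (le_iSup₂_of_le j k le_rfl)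
  lt := by
    have hν : 0 ≤ nuNorm ν := Finset.sum_nonneg fun j _ => Finset.sum_nonneg fun k _ => abs_nonneg _
    have h1 : 12 * ENNReal.ofReal (nuNorm ν) * maxDecay H =
        ENNReal.ofReal (12 * nuNorm ν * (maxDecay H).toReal) := by
      rw [ENNReal.ofReal_mul (by positivity), ENNReal.ofReal_mul (by positivity),
        ENNReal.ofReal_toReal (maxDecay_lt_top hd).ne]
      norm_num
    rw [criticalCoupling, h1] at hlam'
    have h2 : ENNReal.ofReal lam * ENNReal.ofReal (12 * nuNorm ν * (maxDecay H).toReal) < 1 := by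
      -- If ‖ν‖₁ M = 0 then λ₀ = ∞ and the bound is trivial.
      rcases eq_or_ne (ENNReal.ofReal (12 * nuNorm ν * (maxDecay H).toReal)) 0 with h0 | h0
      · rw [h0, mul_zero]; exact one_pos
      · exact (ENNReal.lt_div_iff_mul_lt (Or.inl h0) (Or.inl ENNReal.ofReal_ne_top)).1 hlam'
    rw [← ENNReal.ofReal_mul hlam, ← ENNReal.ofReal_one,
      ENNReal.ofReal_lt_ofReal_iff one_pos] at h2
    linarith

theorem dense_returnDomain {H : Hilb N →L[ℂ] Hilb N} (hd : Dispersive H) :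
    Dense (returnDomain H zeta) :=
  dense_isCompactlySupported.mono fun x hx j =>
    (hd _ x (isCompactlySupported_zeta j) hx).integrableOn

theorem waveOperator_conj_eq (hhs : IsSelfAdjoint hs)
    (hd : Dispersive (coupledHam tc hs τ L S)) (W : Hilb N →L[ℂ] Hilb N)
    {W' : Hilb N →L[ℂ] Hilb N}
    (hW' : IsWaveOperator (leadHam N tc) (coupledHam tc hs τ L S) W') (β : Fin 2 → ℝ≥0∞)
    (μ : Fin 2 → ℝ) (ρs ρs' : Sample N →L[ℂ] Sample N) :
    W * initialState tc β μ ρs * W' = W * initialState tc β μ ρs' * W' := by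
  refine ContinuousLinearMap.ext fun x => ?_
  simp only [mul_apply_eq_comp, initialState_apply, waveOperator_snd_eq_zero τ S hhs hd hW' x,
    map_zero]

theorem waveOperator_mul_eq_one (htc : 0 < tc) (hhs : IsSelfAdjoint hs)
    (hd : Dispersive (coupledHam tc hs τ L S)) {W W' : Hilb N →L[ℂ] Hilb N}
    (hW : IsWaveOperator (coupledHam tc hs τ L S) (leadHam N tc) W)
    (hW' : IsWaveOperator (leadHam N tc) (coupledHam tc hs τ L S) W') : W * W' = 1 := by
  have h := adjoint_comp_self_of_norm_eq (norm_waveOperator_apply τ S hhs hd hW')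
  rwa [ContinuousLinearMap.star_eq_adjoint, waveOperator_eq_adjoint τ S htc hhs hd hW hW',
    ContinuousLinearMap.adjoint_adjoint, ← waveOperator_eq_adjoint τ S htc hhs hd hW hW'] at h

theorem norm_waveOperator_conj_le (htc : 0 < tc) (hhs : IsSelfAdjoint hs)
    (hd : Dispersive (coupledHam tc hs τ L S)) {W W' ρ : Hilb N →L[ℂ] Hilb N}
    (hW : IsWaveOperator (coupledHam tc hs τ L S) (leadHam N tc) W)
    (hW' : IsWaveOperator (leadHam N tc) (coupledHam tc hs τ L S) W') (hρ : ‖ρ‖ ≤ 1) :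
    ‖W * ρ * W'‖ ≤ 1 := by
  have h' : ‖W'‖ ≤ 1 := W'.opNorm_le_bound zero_le_one fun x => by
    rw [norm_waveOperator_apply τ S hhs hd hW' x, one_mul]
  have h : ‖W‖ ≤ 1 := by
    rwa [waveOperator_eq_adjoint τ S htc hhs hd hW hW', LinearIsometryEquiv.norm_map] at h'
  exact norm_conj_le_one h hρ h'

theorem commute_waveOperator_conj (htc : 0 < tc) (hhs : IsSelfAdjoint hs)
    (hd : Dispersive (coupledHam tc hs τ L S)) {W W' : Hilb N →L[ℂ] Hilb N}
    (hW : IsWaveOperator (coupledHam tc hs τ L S) (leadHam N tc) W)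
    (hW' : IsWaveOperator (leadHam N tc) (coupledHam tc hs τ L S) W') (β : Fin 2 → ℝ≥0∞)
    (μ : Fin 2 → ℝ) (ρs : Sample N →L[ℂ] Sample N) :
    Commute (coupledHam tc hs τ L S) (W * initialState tc β μ ρs * W') := by
  have hH := isSelfAdjoint_coupledHam tc hhs τ L S
  have hA := isSelfAdjoint_leadHam (N := N) tc
  have h1 : leadHam N tc * W' = W' * coupledHam tc hs τ L S := waveOperator_intertwine τ S hhs hd hW'
  have h2 : coupledHam tc hs τ L S * W = W * leadHam N tc := by
    have := adjoint_intertwine hA hH (waveOperator_intertwine τ S hhs hd hW')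
    rwa [waveOperator_eq_adjoint τ S htc hhs hd hW hW',
      ContinuousLinearMap.adjoint_adjoint] at this
  have h3 := (commute_leadHam_initialState (N := N) tc β μ (ρs := ρs)).eq
  calc _ = coupledHam tc hs τ L S * W * (initialState tc β μ ρs * W') := by simp only [mul_assoc]
    _ = W * (leadHam N tc * initialState tc β μ ρs) * W' := by rw [h2]; simp only [mul_assoc]
    _ = W * initialState tc β μ ρs * (leadHam N tc * W') := by rw [h3]; simp only [mul_assoc]
    _ = _ := by rw [h1]; simp only [mul_assoc]

/-- On the leads, which contain the range of W', the initial state coincides with the Fermi function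
of H_L. Intertwining moves it past W', and W W' = 1. -/
theorem waveOperator_conj_eq_fermiDirac (htc : 0 < tc) (hhs : IsSelfAdjoint hs)
    (hd : Dispersive (coupledHam tc hs τ L S)) {W W' : Hilb N →L[ℂ] Hilb N}
    (hW : IsWaveOperator (coupledHam tc hs τ L S) (leadHam N tc) W)
    (hW' : IsWaveOperator (leadHam N tc) (coupledHam tc hs τ L S) W') {β : Fin 2 → ℝ≥0∞}
    {μ : Fin 2 → ℝ} (hβ : β 0 = β 1) (hμ : μ 0 = μ 1) (ρs : Sample N →L[ℂ] Sample N) :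
    W * initialState tc β μ ρs * W' = fermiDirac (β 0) (μ 0) (coupledHam tc hs τ L S) := by
  have hH := isSelfAdjoint_coupledHam tc hhs τ L S
  have hA := isSelfAdjoint_leadHam (N := N) tc
  have hβ' : ∀ j, β j = β 0 := fun j => by fin_cases j <;> simp [hβ]
  have hμ' : ∀ j, μ j = μ 0 := fun j => by fin_cases j <;> simp [hμ]
  have h1 : ∀ y : Hilb N, y.snd = 0 →
      initialState tc β μ ρs y = fermiDirac (β 0) (μ 0) (leadHam N tc) y := fun y hy => by
    have hj : ∀ j u, leadEmb N j (fermiDirac (β 0) (μ 0) (dirichletLaplacian tc) u) =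
        fermiDirac (β 0) (μ 0) (leadHam N tc) (leadEmb N j u) := fun j u =>
      (congrArg (fun T : Lead →L[ℂ] Hilb N => T u) (fermiDirac_intertwine hA
        (isSelfAdjoint_dirichletLaplacian tc) (leadHam_leadEmb tc j) (β 0) (μ 0))).symm
    rw [initialState_apply, hy, map_zero, map_zero, add_zero]
    conv_rhs => rw [hilb_decomp y, hy, map_zero, add_zero, map_sum]
    exact Finset.sum_congr rfl fun j _ => by rw [hβ', hμ', hj]
  have h2 := fermiDirac_intertwine hA hH (waveOperator_intertwine τ S hhs hd hW') (β 0) (μ 0)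
  refine ContinuousLinearMap.ext fun x => ?_
  rw [mul_apply_eq_comp, mul_apply_eq_comp, h1 _ (waveOperator_snd_eq_zero τ S hhs hd hW' x)]
  have h3 := congrArg (fun T : Hilb N →L[ℂ] Hilb N => T x) h2
  simp only [ContinuousLinearMap.comp_apply] at h3
  rw [h3, ← mul_apply_eq_comp, waveOperator_mul_eq_one τ S htc hhs hd hW hW', one_apply_eq_self]

end Coupled

end HartreeNESS

open HartreeNESS


/-! ### Assembly of the theorem -/

theorem theorem1
    {N : ℕ} (hN : 0 < N)
    (tc : ℝ) (htc : 0 < tc)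
    (hs : Sample N →L[ℂ] Sample N) (hhs : IsSelfAdjoint hs)
    (τ : ℝ) (hτ : 0 < τ)
    (L : Fin 2 → Lead) (hL : ∀ j, {n : ℕ | L j n ≠ 0}.Finite)
    (S : Fin 2 → Sample N)
    (ν : Fin N → Fin N → ℝ)
    (β : Fin 2 → ℝ≥0∞) (hβ : ∀ j, 0 < β j) (μ : Fin 2 → ℝ)
    (H : Hilb N →L[ℂ] Hilb N) (hH : H = coupledHam tc hs τ L S)
    (hdisp : Dispersive H)
    (lam : ℝ) (hlam : 0 ≤ lam) (hlam' : ENNReal.ofReal lam < criticalCoupling ν H) :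
    ∃ W W' ρinf : Hilb N →L[ℂ] Hilb N,
      -- the wave operators `W = W_-(H, H_L)` and `W' = W_-(H_L, H)` exist
      IsWaveOperator H (leadHam N tc) W ∧
      IsWaveOperator (leadHam N tc) H W' ∧
      W' = ContinuousLinearMap.adjoint W ∧
      ρinf.IsPositive ∧
      -- convergence: one and the same `ρinf` works for every initial state of the sample
      (∀ (βs n : ℝ) (ρs : Sample N →L[ℂ] Sample N), 0 < βs → 0 < n → n < N →
        IsSampleEquilibrium hs ν lam βs n ρs →
        ∃ U : ℝ → Hilb N →L[ℂ] Hilb N, ∃ A : Hilb N →L[ℂ] Hilb N,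
          IsPropagator H (hartree zeta ν lam) (initialState tc β μ ρs) U ∧
          (∀ U' : ℝ → Hilb N →L[ℂ] Hilb N,
            IsPropagator H (hartree zeta ν lam) (initialState tc β μ ρs) U' →
            ∀ t : ℝ, 0 ≤ t → U' t = U t) ∧
          (∀ t : ℝ, 0 ≤ t → U t ∈ unitary (Hilb N →L[ℂ] Hilb N)) ∧
          IsLiouvilleSolution H (hartree zeta ν lam) (initialState tc β μ ρs)
            (fun t => U t * initialState tc β μ ρs * star (U t)) ∧
          (∀ ρ : ℝ → Hilb N →L[ℂ] Hilb N,
            IsLiouvilleSolution H (hartree zeta ν lam) (initialState tc β μ ρs) ρ →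
            (∀ t : ℝ, 0 ≤ t → ρ t = U t * initialState tc β μ ρs * star (U t)) ∧
            ∀ O : Hilb N →L[ℂ] Hilb N, IsTraceClass O →
              Tendsto (fun t => trace (ρ t * O)) atTop (𝓝 (trace (ρinf * O)))) ∧
          IsStrongLimit (fun t => unitaryGroup H (-t) * star (U t)) A ∧
          ρinf = star A * W * initialState tc β μ ρs * W' * A ∧
          (lam = 0 → ρinf = W * initialState tc β μ ρs * W')) ∧
      -- the steady state commutes with its self-consistent Hamiltonian
      Commute (H + hartree zeta ν lam ρinf) ρinf ∧
      -- equal leads: thermal equilibrium and vanishing steady currents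
      (β 0 = β 1 → μ 0 = μ 1 →
        ρinf = fermiDirac (β 0) (μ 0) (H + hartree zeta ν lam ρinf) ∧
        ∀ k : Fin 2, trace (ρinf * currentOp H k) = 0) := by

  subst hH
  set H := coupledHam tc hs τ L S with hH
  have hHs : IsSelfAdjoint H := isSelfAdjoint_coupledHam tc hhs τ L S
  obtain ⟨W, hW⟩ := exists_waveOperator_leadHam τ S htc hhs hL
  obtain ⟨W', hW'⟩ := exists_waveOperator_coupledHam τ S hhs hL hdisp
  have hadj := waveOperator_eq_adjoint τ S htc hhs hdisp hW hW'
  have hsmall := smallCoupling_of_lt_criticalCoupling hHs hdisp hlam hlam'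
  have hD := dense_returnDomain hdisp
  -- The sample component is set to zero as a reference. The steady state is built from this choice,
  -- which makes its independence of ρs explicit.
  set σ := W * initialState tc β μ 0 * W' with hσdef
  have hσn : ‖σ‖ ≤ 1 := norm_waveOperator_conj_le τ S htc hhs hdisp hW hW'
    (norm_initialState_le tc β μ (by simp))
  have hσp : σ.IsPositive := by
    have h := (isPositive_initialState tc β μ (N := N) (ρs := 0)
      ContinuousLinearMap.isPositive_zero).conj_adjoint W
    rw [← hadj] at h
    exact h
  have hflow : ∀ ρs : Sample N →L[ℂ] Sample N, ρs.IsPositive → ‖ρs‖ ≤ 1 →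
      ∃ U A l, IsHartreeFlow H (initialState tc β μ ρs) σ zeta ν lam U A ∧
        IsLimitOperator H σ zeta ν lam l A := fun ρs hp hn => by
    refine hsmall.exists_isHartreeFlow (norm_initialState_le tc β μ hn)
      (isPositive_initialState tc β μ hp).isSelfAdjoint ?_ hD
    rw [hσdef, waveOperator_conj_eq τ S hhs hdisp W hW' β μ 0 ρs]
    exact waveOperator_tendsto_conj τ S htc hhs hdisp hW hW' β μ ρs
  obtain ⟨U₀, A, l, hU₀, hA⟩ := hflow 0 ContinuousLinearMap.isPositive_zero (by simp)
  have hAA := hU₀.star_mul_self hHs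
  have hint := hU₀.intertwine hHs
    (isPositive_initialState tc β μ ContinuousLinearMap.isPositive_zero).isSelfAdjoint
  set ρinf := star A * σ * A with hρinf
  have hρp : ρinf.IsPositive := hσp.adjoint_conj A
  have hρn : ‖ρinf‖ ≤ 1 := norm_conj_le_one
    (by rw [norm_star]; exact norm_le_one_of_star_mul_self hAA) hσn
    (norm_le_one_of_star_mul_self hAA)
  have hKs : IsSelfAdjoint (H + hartree zeta ν lam ρinf) :=
    isSelfAdjoint_clm_add hHs (isSelfAdjoint_hartree zeta ν lam hρp.isSelfAdjoint)
  refine ⟨W, W', ρinf, hW, hW', hadj, hρp, ?_, ?_, ?_⟩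
  · intro βs n ρs _ _ _ hρs
    obtain ⟨hp, -, μs, hfd⟩ := hρs
    -- Fermi functions are at most 1, which is the bound on the state required by the contraction
    -- argument.
    have hn : ‖ρs‖ ≤ 1 := by
      rw [hfd]; exact norm_fermiDirac_le _ _ _
    obtain ⟨U, A', l', hU, hA'⟩ := hflow ρs hp hn
    -- The flow started from ρs has the same σ as the reference flow, so uniqueness for the limiting
    -- equation identifies their asymptotic operators.
    have eA : A' = A := hsmall.limitOperator_unique hσn hD hA' hA
    subst eA
    have hρis : IsSelfAdjoint (initialState tc β μ ρs) :=
      (isPositive_initialState tc β μ hp).isSelfAdjoint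
    have eσ : σ = W * initialState tc β μ ρs * W' :=
      waveOperator_conj_eq τ S hhs hdisp W hW' β μ 0 ρs
    refine ⟨U, A', hU.isPropagator, fun U' hU' t ht => hU'.unique hU.isPropagator ht,
      hU.mem_unitary, hU.isLiouvilleSolution hHs hρis, fun ρ hρ => ?_, hU.strongLimit, ?_, ?_⟩
    · have hρU : ∀ t : ℝ, 0 ≤ t → ρ t = U t * initialState tc β μ ρs * star (U t) :=
        fun t ht => hρ.unique (hU.isLiouvilleSolution hHs hρis) ht
      refine ⟨hρU, fun O hO => ?_⟩
      have h := tendsto_tsum_inner (stdBasis N)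
        (T := fun t => U t * initialState tc β μ ρs * star (U t)) (T' := ρinf) (O := O)
        (fun t ht => ?_) hρn hU.tendsto_inner (by rw [coe_stdBasis]; exact hO)
      · rw [coe_stdBasis] at h
        refine h.congr' ?_
        filter_upwards [eventually_ge_atTop 0] with t ht
        rw [hρU t ht]
        rfl
      · have hUn := norm_le_one_of_mem_unitary (hU.mem_unitary t ht)
        exact norm_conj_le_one hUn (norm_initialState_le tc β μ hn) (by rwa [norm_star])
    · rw [hρinf, eσ]
      simp only [mul_assoc]
    -- At zero coupling the source vanishes and A = 1.
    · rintro rfl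
      rw [hρinf, hA.eq_one hD, star_one, one_mul, mul_one, eσ]
  · exact commute_conj_of_intertwine hHs hKs hint
      (commute_waveOperator_conj τ S htc hhs hdisp hW hW' β μ 0)
  · intro hβ hμ
    have h1 : ρinf = fermiDirac (β 0) (μ 0) (H + hartree zeta ν lam ρinf) := by
      have e : σ = fermiDirac (β 0) (μ 0) H :=
        waveOperator_conj_eq_fermiDirac τ S htc hhs hdisp hW hW' hβ hμ 0
      rw [← conj_fermiDirac_of_intertwine hHs hKs hint hAA, ← e]
    refine ⟨h1, fun k => ?_⟩
    rw [h1]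
    exact trace_fermiDirac_mul_currentOp τ S hhs ν lam hρp.isSelfAdjoint (β 0) (μ 0) k
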